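/- Let $n\ge 2$ and let $A=A_o(n)$ be the free orthogonal quantum group, i.e. the unital complex algebra generated by elements $u_{ij}$ ($1\le i,j\le n$) with relations $\sum_j u_{ij}u_{kj}=\delta_{ik}$ and $\sum_j u_{ji}u_{jk}=\delta_{ik}$ (it is a $*$-algebra with $u_{ij}^*=u_{ij}$). Let $\varepsilon:A\to\mathbb{C}$, $\varepsilon(u_{ij})=\delta_{ij}$, be the counit, and regard $\mathbb{C}$ as a trivial left or right $A$-module through $\varepsilon$. For a left $A$-module $M$ put $H_i(A,M)=\mathrm{Tor}_i^A(\mathbb{C},M)$ and $H^i(A,M)=\mathrm{Ext}_A^i(\mathbb{C},M)$. Then: (i) $\mathrm{Ext}_A^3(\mathbb{C},A)\cong\mathbb{C}$, and $\mathrm{Ext}_A^i(\mathbb{C},A)=0$ for all $i\neq 3$. The isomorphism in degree $3$ is one of right $A$-modules, where $A$ acts on $\mathrm{Ext}_A^3(\mathbb{C},A)$ through right multiplication on the second argument and on $\mathbb{C}$ through $\varepsilon$. (ii) For $0\le i\le 3$ there are isomorphisms of complex vector spaces $H_i(A,M)\cong H^{3-i}(A,M)$, for all left $A$-modules $M$,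 natural in $M$; and for $i>3$, $H_i(A,M)=0=H^i(A,M)$ for all $M$. (iii) $A$ is smooth of dimension $3$: as a module over the enveloping algebra $A^e=A\otimes_{\mathbb{C}}A^{\mathrm{op}}$, $A$ has a resolution of finite length by finitely generated projective modules, and its projective dimension is $3$. -/

import Mathlib

open CategoryTheory TensorProduct

universe v

noncomputable section

/-! ### The relative tensor product and (co)homology of an augmented algebra -/

section Homology

variable {k A : Type} [Field k] [Ring A] [Algebra k A]

attribute [local instance] ModuleCat.moduleOfAlgebraModule
attribute [local instance] ModuleCat.isScalarTower_of_algebra_moduleCat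

/-- The subspace of `N ⊗[k] M` spanned by the elements `n a ⊗ m - n ⊗ a m`, for a right
`A`-module `N` and a left `A`-module `M`. -/
def relTensorRelations (k : Type) {A : Type} [Field k] [Ring A] [Algebra k A]
    (N : ModuleCat.{v} Aᵐᵒᵖ) (M : ModuleCat.{v} A) : Submodule k (N ⊗[k] M) :=
  Submodule.span k
    {t | ∃ (n : N) (a : A) (m : M), t = (MulOpposite.op a • n) ⊗ₜ[k] m - n ⊗ₜ[k] (a • m)}

/-- The tensor product `N ⊗_A M` of a right `A`-module `N` and a left `A`-module `M` over the
(noncommutative) `k`-algebra `A`. -/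
abbrev RelTensor (k : Type) {A : Type} [Field k] [Ring A] [Algebra k A]
    (N : ModuleCat.{v} Aᵐᵒᵖ) (M : ModuleCat.{v} A) : Type v :=
  (N ⊗[k] M) ⧸ relTensorRelations k N M

/-- An `A`-linear map, viewed as a `k`-linear map. -/
def kLinearOfHom (k : Type) {A : Type} [Field k] [Ring A] [Algebra k A]
    {M M' : ModuleCat.{v} A} (f : M ⟶ M') : M →ₗ[k] M' :=
  f.hom.restrictScalars k

theorem relTensorRelations_le_comap (N : ModuleCat.{v} Aᵐᵒᵖ) {M M' : ModuleCat.{v} A}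
    (f : M ⟶ M') :
    relTensorRelations k N M ≤
      (relTensorRelations k N M').comap ((kLinearOfHom k f).lTensor N) := by
  refine Submodule.span_le.2 ?_
  rintro _ ⟨n, a, m, rfl⟩
  refine Submodule.subset_span ⟨n, a, f.hom m, ?_⟩
  simp [kLinearOfHom]

/-- The map `N ⊗_A M → N ⊗_A M'` induced by an `A`-linear map `M → M'`. -/
def RelTensor.map (N : ModuleCat.{v} Aᵐᵒᵖ) {M M' : ModuleCat.{v} A} (f : M ⟶ M') :
    RelTensor k N M →ₗ[k] RelTensor k N M' :=
  (relTensorRelations k N M).mapQ (relTensorRelations k N M')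
    ((kLinearOfHom k f).lTensor N) (relTensorRelations_le_comap N f)

/-- The functor `N ⊗_A -` from left `A`-modules to `k`-vector spaces. -/
def relTensorFunctor (k : Type) {A : Type} [Field k] [Ring A] [Algebra k A]
    (N : ModuleCat.{v} Aᵐᵒᵖ) : ModuleCat.{v} A ⥤ ModuleCat.{v} k where
  obj M := ModuleCat.of k (RelTensor k N M)
  map f := ModuleCat.ofHom (RelTensor.map N f)
  map_id M := by
    ext : 1
    refine Submodule.linearMap_qext _ (TensorProduct.ext' fun n m => ?_)
    rfl
  map_comp f g := by
    ext : 1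
    refine Submodule.linearMap_qext _ (TensorProduct.ext' fun n m => ?_)
    rfl

instance relTensorFunctor_additive (N : ModuleCat.{v} Aᵐᵒᵖ) :
    (relTensorFunctor k N).Additive where
  map_add {M M'} f g := by
    ext : 1
    refine Submodule.linearMap_qext _ (TensorProduct.ext' fun n m => ?_)
    change (relTensorRelations k N M').mkQ (n ⊗ₜ[k] (f.hom m + g.hom m)) =
      (relTensorRelations k N M').mkQ (n ⊗ₜ[k] f.hom m) +
        (relTensorRelations k N M').mkQ (n ⊗ₜ[k] g.hom m)
    rw [TensorProduct.tmul_add, map_add]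

/-- `Tor_i^A(N, -)`: the left derived functors of `N ⊗_A -`. -/
def torFunctor (k : Type) {A : Type} [Field k] [Ring A] [Algebra k A]
    (N : ModuleCat.{v} Aᵐᵒᵖ) (i : ℕ) : ModuleCat.{v} A ⥤ ModuleCat.{v} k :=
  (relTensorFunctor k N).leftDerived i

/-- The trivial left module `k` of an algebra `A` with augmentation `ε`: `a • z = ε(a) z`. -/
def trivialLeft (ε : A →ₐ[k] k) : ModuleCat.{v} A :=
  (ModuleCat.restrictScalars (ε : A →+* k)).obj (ModuleCat.of k (ULift.{v} k))

/-- The trivial right module `k` of an algebra `A` with augmentation `ε`: `z • a = z ε(a)`. -/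
def trivialRight (ε : A →ₐ[k] k) : ModuleCat.{v} Aᵐᵒᵖ :=
  (ModuleCat.restrictScalars
    ((ε.fromOpposite fun _ _ => mul_comm _ _ : Aᵐᵒᵖ →ₐ[k] k) : Aᵐᵒᵖ →+* k)).obj
      (ModuleCat.of k (ULift.{v} k))

/-- The homology `H_i(A, M) = Tor_i^A(k, M)`, as a functor of the left `A`-module `M`. -/
def augHomology (ε : A →ₐ[k] k) (i : ℕ) : ModuleCat.{v} A ⥤ ModuleCat.{v} k :=
  torFunctor k (trivialRight ε) i

/-- The cohomology `H^i(A, M) = Ext_A^i(k, M)` of a left `A`-module `M`. -/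
abbrev augCohomology (ε : A →ₐ[k] k) (i : ℕ) (M : ModuleCat.{v} A) : Type v :=
  Abelian.Ext (trivialLeft.{v} ε) M i

/-- The map `H^i(A, M) → H^i(A, M')` induced by an `A`-linear map `M → M'`. -/
def augCohomology.map (ε : A →ₐ[k] k) (i : ℕ) {M M' : ModuleCat.{v} A} (f : M ⟶ M')
    (x : augCohomology ε i M) : augCohomology ε i M' :=
  x.comp (Abelian.Ext.mk₀ f) (add_zero i)

/-- Right multiplication `x ↦ x a`, an endomorphism of the left `A`-module `A`. Through these
endomorphisms `H^i(A, A)` is a right `A`-module. -/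
def rightMul (a : A) : ModuleCat.of A A ⟶ ModuleCat.of A A :=
  ModuleCat.ofHom (LinearMap.toSpanSingleton A A a)

end Homology

/-! ### Smoothness and dimension -/

section Smooth

variable (k A : Type) [Field k] [Ring A] [Algebra k A]

/-- `A` as a module over the enveloping algebra `A ⊗ Aᵒᵖ`, with `(a ⊗ b) • x = a x b`. -/
def diagonalBimodule : ModuleCat.{0} (A ⊗[k] Aᵐᵒᵖ) :=
  letI : Module (A ⊗[k] Aᵐᵒᵖ) A := instModuleTensorProductMop k A
  ModuleCat.of (A ⊗[k] Aᵐᵒᵖ) A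

/-- `A` is smooth over `k` if, as a module over `A ⊗ Aᵒᵖ`, it has a resolution of finite length
by finitely generated projective modules. -/
def IsSmoothAlgebra : Prop :=
  ∃ P : ProjectiveResolution (diagonalBimodule k A),
    (∀ i, Module.Finite (A ⊗[k] Aᵐᵒᵖ) (P.complex.X i)) ∧
      ∃ d : ℕ, ∀ i, d < i → Limits.IsZero (P.complex.X i)

/-- The dimension of the algebra `A`: its projective dimension as a module over `A ⊗ Aᵒᵖ`. -/
def algebraDim : WithBot ℕ∞ :=
  projectiveDimension (diagonalBimodule k A)

end Smooth

/-! ### The free orthogonal quantum group -/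

/-- The free algebra `ℂ⟨u_ij⟩`. -/
abbrev FreeOrthogonalGen (n : ℕ) : Type := FreeAlgebra ℂ (Fin n × Fin n)

/-- The defining relations `∑ⱼ u_ij u_kj = δ_ik` and `∑ⱼ u_ji u_jk = δ_ik`. -/
inductive FreeOrthogonalRel (n : ℕ) : FreeOrthogonalGen n → FreeOrthogonalGen n → Prop
  | row (i k : Fin n) : FreeOrthogonalRel n
      (∑ j, FreeAlgebra.ι ℂ (i, j) * FreeAlgebra.ι ℂ (k, j)) (if i = k then 1 else 0)
  | col (i k : Fin n) : FreeOrthogonalRel n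
      (∑ j, FreeAlgebra.ι ℂ (j, i) * FreeAlgebra.ι ℂ (j, k)) (if i = k then 1 else 0)

/-- The algebra `A_o(n)`: the unital complex algebra with generators `u_ij` and the relations
above. All relations are preserved by the conjugate linear anti-automorphism of the free algebra
that fixes every `u_ij`, so that this is also the algebra underlying the unital `*`-algebra
generated by self-adjoint `u_ij` with these relations. -/
abbrev FreeOrthogonal (n : ℕ) : Type := RingQuot (FreeOrthogonalRel n)

/-- The generator `u_ij` of `A_o(n)`. -/
def FreeOrthogonal.u (n : ℕ) (i j : Fin n) : FreeOrthogonal n :=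
  RingQuot.mkAlgHom ℂ (FreeOrthogonalRel n) (FreeAlgebra.ι ℂ (i, j))

/-- The counit `ε : A_o(n) → ℂ`, `ε(u_ij) = δ_ij`. -/
def FreeOrthogonal.counit (n : ℕ) : FreeOrthogonal n →ₐ[ℂ] ℂ :=
  RingQuot.liftAlgHom ℂ
    ⟨FreeAlgebra.lift ℂ fun p : Fin n × Fin n => if p.1 = p.2 then (1 : ℂ) else 0, by
      rintro _ _ (⟨i, k⟩ | ⟨i, k⟩)
      · by_cases h : i = k
        · simp [h]
        · simp [h]
      · by_cases h : i = k
        · simp [h]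
        · simp [h, Ne.symm (Ne.intro h)]⟩

theorem FreeOrthogonal.counit_u (n : ℕ) (i j : Fin n) :
    FreeOrthogonal.counit n (FreeOrthogonal.u n i j) = if i = j then 1 else 0 := by
  simp [FreeOrthogonal.counit, FreeOrthogonal.u]

end

/-! The trivial left module has a resolution `0 → A → M_n(A) → M_n(A) → A → ℂ → 0` with maps `x ↦ (x
u_ij - δ_ij x)`, `c ↦ c + cᵗ u` and `y ↦ ∑ y_ij (u_ij - δ_ij)`. Applying `Hom_A(-, M)` gives a
complex of the same shape, with maps `m ↦ (u_ij m - δ_ij m)`, `c ↦ c + u cᵗ` and `y ↦ ∑ (u_ij -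
δ_ij) y_ij`. For `M = A` the antipode `u_ij ↦ u_ji` exchanges the two complexes, so the same
exactness statements give both the resolution and the vanishing of `Ext^i(ℂ, A)` for `i ≠ 3`, while
the last cokernel `A / (ker ε) A = ℂ` gives `Ext³`.

Two of these statements use only generators and relations: the `u_ij - δ_ij` generate the
augmentation ideal (`exists_of_counit_eq_zero`), and Fox calculus on the defining relations
describes the relations between them (`exists_of_sum_eq_zero`). The other two
(`eq_zero_of_invariant`, `exists_of_cocycle`) need the size of `A`. By Peter–Weyl theory `A` should
be the sum of the `V_m ⊗ V_m`, where `V_m` is the space of traceless tensors in `(ℂⁿ)^{⊗m}`, and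
`u_ij` should act by a raising and a lowering part, because `V_1 ⊗ V_m = V_{m+1} ⊕ V_{m-1}`. This
module is built by hand: `create` followed by restriction to traceless functions is the Wenzl
recursion, with coefficients `γ` determined by `γ_{m+1} (n - γ_m) = 1`. The map `totalEval` from the
model to `A` is `A`-linear and sends the orbit of the vacuum back to `A`, so `A` is a direct summand
of the model. In the model the two statements follow by looking at components of highest degree, on
which only the raising part acts.

For duality, `ℂ ⊗_A M` and `Ext³(ℂ, M)` are both `M / (ker ε) M`. On a free cover `0 → K → F → M →
0`, `Ext^j(ℂ, F) = 0` for `j ≠ 3` and `Tor_i(ℂ, F) = 0` for `i > 0`, so both theories satisfy the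
same dimension shift and the isomorphism propagates from degree zero (`DimensionShift.isoOfIso`).

For smoothness, the exact functor `M ↦ M ⊗ A`, with `A` acting on the left through the
comultiplication and on the right on the second factor, takes `A` to a free bimodule of rank one and
`ℂ` to the diagonal bimodule. It carries the resolution of `ℂ` to one of `A` by finitely generated
free bimodules. The length cannot be reduced, because `Ext³` with values in the trivial bimodule is
nonzero (`not_subsingleton_ext_diagonal`). -/

open scoped ZeroObject

noncomputable section

/-! ### Creation and annihilation operators on functions on words -/

namespace WordFunction

variable {n : ℕ} {E E' : Type*} [AddCommGroup E] [Module ℂ E] [AddCommGroup E'] [Module ℂ E']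

/-- Functions on words in the letters `0, …, n - 1`. -/
abbrev WordFun (n : ℕ) (E : Type*) : Type _ := List (Fin n) → E

/-- The annihilation operator `f ↦ (w ↦ f (i w))`. -/
def ann (i : Fin n) : WordFun n E →ₗ[ℂ] WordFun n E where
  toFun f w := f (i :: w)
  map_add' _ _ := rfl
  map_smul' _ _ := rfl

/-- Multiplication by a function of the length. -/
def scale (ρ : ℕ → ℂ) : WordFun n E →ₗ[ℂ] WordFun n E where
  toFun f w := ρ w.length • f w
  map_add' _ _ := by ext; simp
  map_smul' c f := by ext w; exact smul_comm _ _ _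

/-- The values of the creation operators, by recursion on the word. -/
def createAux (γ : ℕ → ℂ) : List (Fin n) → Fin n → WordFun n E → E
  | [], _, _ => 0
  | i :: w, k, f => (if i = k then f w else 0) - γ w.length • createAux γ w i (ann k f)

theorem createAux_add (γ : ℕ → ℂ) (w : List (Fin n)) (k : Fin n) (f g : WordFun n E) :
    createAux γ w k (f + g) = createAux γ w k f + createAux γ w k g := by
  induction w generalizing k f g with
  | nil => simp [createAux]
  | cons i w ih =>
    simp only [createAux, map_add, ih, smul_add, Pi.add_apply]
    split_ifs <;> abel

theorem createAux_smul (γ : ℕ → ℂ) (w : List (Fin n)) (k : Fin n) (c : ℂ) (f : WordFun n E) :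
    createAux γ w k (c • f) = c • createAux γ w k f := by
  induction w generalizing k f with
  | nil => simp [createAux]
  | cons i w ih =>
    simp only [createAux, map_smul, ih, smul_sub, Pi.smul_apply, smul_comm c]
    split_ifs <;> simp

/-- The creation operators. -/
def create (γ : ℕ → ℂ) (k : Fin n) : WordFun n E →ₗ[ℂ] WordFun n E where
  toFun f w := createAux γ w k f
  map_add' f g := by ext w; exact createAux_add γ w k f g
  map_smul' c f := by ext w; exact createAux_smul γ w k c f

@[simp] theorem ann_apply (i : Fin n) (f : WordFun n E) (w : List (Fin n)) :
    ann i f w = f (i :: w) := rfl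

@[simp] theorem scale_apply (ρ : ℕ → ℂ) (f : WordFun n E) (w : List (Fin n)) :
    scale ρ f w = ρ w.length • f w := rfl

@[simp] theorem create_nil (γ : ℕ → ℂ) (k : Fin n) (f : WordFun n E) : create γ k f [] = 0 := rfl

theorem create_cons (γ : ℕ → ℂ) (k : Fin n) (f : WordFun n E) (i : Fin n) (w : List (Fin n)) :
    create γ k f (i :: w) = (if i = k then f w else 0) - γ w.length • create γ i (ann k f) w := rfl

/-- A deformed commutation relation. The correction term is what makes `create γ k f` the traceless
part of `e_k ⊗ f` once `γ` is normalized. -/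
theorem ann_create (γ : ℕ → ℂ) (i k : Fin n) (f : WordFun n E) :
    ann i (create γ k f) = (if i = k then f else 0) - scale γ (create γ i (ann k f)) := by
  ext w
  rw [ann_apply, create_cons]
  split_ifs <;> simp

theorem ann_scale (ρ : ℕ → ℂ) (i : Fin n) (f : WordFun n E) :
    ann i (scale ρ f) = scale (fun m => ρ (m + 1)) (ann i f) := rfl

/-- Creation raises the word length by one, hence the shift. The value `ρ' 0` is free because
created functions vanish on the empty word. -/
theorem create_scale (γ : ℕ → ℂ) (ρ ρ' : ℕ → ℂ) (h : ∀ m, ρ m = ρ' (m + 1)) (k : Fin n)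
    (f : WordFun n E) : create γ k (scale ρ f) = scale ρ' (create γ k f) := by
  ext w
  induction w generalizing k f ρ ρ' with
  | nil => simp
  | cons i w ih =>
    rw [create_cons, scale_apply, scale_apply, create_cons, ann_scale, smul_sub]
    congr 1
    · split_ifs <;> simp [h]
    · rcases w with _ | ⟨j, w⟩
      · simp
      · rw [ih (fun m => ρ (m + 1)) ρ (fun _ => rfl), scale_apply, smul_comm]
        simp [h]

theorem create_comp (γ : ℕ → ℂ) (k : Fin n) (φ : E →ₗ[ℂ] E') (f : WordFun n E) :
    create γ k (fun w => φ (f w)) = fun w => φ (create γ k f w) := by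
  ext w
  induction w generalizing k f with
  | nil => simp
  | cons i w ih =>
    rw [create_cons, create_cons, map_sub, map_smul]
    congr 1
    · split_ifs <;> simp
    · congr 1
      exact ih i (ann k f)

theorem sum_create_apply (γ : ℕ → ℂ) (i : Fin n) {κ : Type*} (s : Finset κ) (F : κ → WordFun n E)
    (w : List (Fin n)) : ∑ x ∈ s, create γ i (F x) w = create γ i (∑ x ∈ s, F x) w := by
  rw [map_sum, Finset.sum_apply]

/-- The functions all of whose contractions of two adjacent letters vanish. -/
def Traceless (n : ℕ) (E : Type*) [AddCommGroup E] [Module ℂ E] : Submodule ℂ (WordFun n E) where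
  carrier := {f | ∀ w₁ w₂, ∑ k, f (w₁ ++ k :: k :: w₂) = 0}
  add_mem' hf hg w₁ w₂ := by simp [Finset.sum_add_distrib, hf w₁ w₂, hg w₁ w₂]
  zero_mem' _ _ := by simp
  smul_mem' c f hf w₁ w₂ := by simp [← Finset.smul_sum, hf w₁ w₂]

theorem ann_mem {f : WordFun n E} (hf : f ∈ Traceless n E) (i : Fin n) : ann i f ∈ Traceless n E :=
  fun w₁ w₂ => hf (i :: w₁) w₂

theorem scale_mem (ρ : ℕ → ℂ) {f : WordFun n E} (hf : f ∈ Traceless n E) :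
    scale ρ f ∈ Traceless n E := fun w₁ w₂ => by
  have := hf w₁ w₂
  simp only [scale_apply, List.length_append, List.length_cons]
  rw [← Finset.smul_sum, this, smul_zero]

theorem comp_mem (φ : E →ₗ[ℂ] E') {f : WordFun n E} (hf : f ∈ Traceless n E) :
    (fun w => φ (f w)) ∈ Traceless n E' := fun w₁ w₂ => by
  rw [← map_sum, hf w₁ w₂, map_zero]

theorem sum_ann_ann {f : WordFun n E} (hf : f ∈ Traceless n E) : ∑ k, ann k (ann k f) = 0 := by
  ext w
  simpa using hf [] w

/-- The correction terms add up to `create γ i` of `∑ ann k (ann k f)`, which is zero for traceless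
`f`. -/
theorem sum_create_ann (γ : ℕ → ℂ) {f : WordFun n E} (hf : f ∈ Traceless n E) (i : Fin n)
    (w : List (Fin n)) : (∑ k, create γ k (ann k f)) (i :: w) = f (i :: w) := by
  simp only [Finset.sum_apply, create_cons, Finset.sum_sub_distrib]
  rw [← Finset.smul_sum, sum_create_apply, sum_ann_ann hf]
  simp

section Normalized

variable {γ : ℕ → ℂ} (h0 : γ 0 = 0) (hγ : ∀ m, γ (m + 1) * (n - γ m) = 1)

include h0 in
-- `sum_create_ann` fails on the empty word; the factor `γ 0 = 0` hides this.
theorem scale_sum_create_ann {f : WordFun n E} (hf : f ∈ Traceless n E) :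
    scale γ (∑ k, create γ k (ann k f)) = scale γ f := by
  ext w
  rcases w with _ | ⟨i, w⟩
  · simp [h0]
  · simp only [scale_apply, sum_create_ann γ hf]

include h0 in
theorem sum_ann_create {f : WordFun n E} (hf : f ∈ Traceless n E) :
    ∑ k, ann k (create γ k f) = scale (fun m => n - γ m) f := by
  simp only [ann_create, Finset.sum_sub_distrib, if_true]
  rw [← map_sum, scale_sum_create_ann h0 hf]
  ext w
  simp [sub_smul, Nat.cast_smul_eq_nsmul]

include h0 hγ

/-- On `i :: w` with `w` of length `m > 0`, the sum is `create γ i f w` times `1 - γ_m (n -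
γ_{m-1})`, which is zero by the recursion. -/
theorem sum_create_create {f : WordFun n E} (hf : f ∈ Traceless n E) :
    ∑ k, create γ k (create γ k f) = 0 := by
  ext w
  rcases w with _ | ⟨i, w⟩
  · simp
  · simp only [Finset.sum_apply, create_cons, Finset.sum_sub_distrib]
    rw [← Finset.smul_sum, sum_create_apply, sum_ann_create h0 hf]
    rcases w with _ | ⟨j, w⟩
    · simp
    · rw [create_scale γ (fun m => n - γ m) (fun m => n - γ (m - 1)) (fun m => rfl),
        scale_apply, smul_smul]
      simp [hγ]

/-- The recursion for `γ` says exactly that the contraction of the first two letters vanishes. The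
other contractions reduce to `ann k f` by induction. -/
theorem create_mem {f : WordFun n E} (hf : f ∈ Traceless n E) (k : Fin n) :
    create γ k f ∈ Traceless n E := by
  intro w₁ w₂
  induction w₁ generalizing k f with
  | nil =>
    have h := congrFun (sum_ann_create h0 (ann_mem hf k)) w₂
    simp only [Finset.sum_apply, ann_apply, scale_apply] at h
    simp only [List.nil_append, create_cons _ _ _ _ (_ :: _), Finset.sum_sub_distrib,
      List.length_cons]
    rw [← Finset.smul_sum, h, smul_smul, hγ]
    simp
  | cons j w₁ ih =>
    simp only [List.cons_append, create_cons, Finset.sum_sub_distrib, List.length_append,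
      List.length_cons]
    rw [← Finset.smul_sum, ih (ann_mem hf k) j]
    split_ifs
    · simp [hf w₁ w₂]
    · simp

/-- The sum `∑ ann k (create γ k f)` is `f` scaled by `n - γ_m`, which is invertible with inverse
`γ_{m+1}`. -/
theorem eq_zero_of_create_eq_zero {f : WordFun n E} (hf : f ∈ Traceless n E)
    (h : ∀ k, create γ k f = 0) : f = 0 := by
  have h1 := sum_ann_create h0 hf
  simp only [h, map_zero, Finset.sum_const_zero] at h1
  ext w
  have h2 := congrFun h1 w
  have h3 : (n - γ w.length : ℂ) ≠ 0 := fun h4 => by simpa [h4] using hγ w.length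
  simpa [h3] using h2.symm

omit h0 hγ in
/-- The relations `∑ ℓ_k f_k = 0` come from the relation `∑ ℓ_k ℓ_k = 0`. -/
theorem eq_create_of_sum_create_eq_zero (γ : ℕ → ℂ) {f : Fin n → WordFun n E}
    (h : ∑ k, create γ k (f k) = 0) (i : Fin n) :
    f i = create γ i (∑ k, ann k (scale γ (f k))) := by
  -- Annihilating `i` isolates `f i`; every correction term is already of the form `create γ i`.
  have h1 := congrArg (ann i) h
  simp only [map_sum, ann_create, map_zero, Finset.sum_sub_distrib, Finset.sum_ite_eq,
    Finset.mem_univ, if_true, sub_eq_zero] at h1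
  rw [h1, map_sum]
  refine Finset.sum_congr rfl fun k _ => ?_
  rw [ann_scale, create_scale γ _ γ (fun _ => rfl)]

end Normalized

end WordFunction

/-! ### Functions of two words and the operators representing the generators -/

namespace WordFunction

variable {n : ℕ}

/-- Functions of two words. -/
abbrev BiFun (n : ℕ) : Type := WordFun n (WordFun n ℂ)

/-- The annihilation operators in the second word. -/
def annR (j : Fin n) : BiFun n →ₗ[ℂ] BiFun n := (ann j).compLeft (List (Fin n))

/-- The creation operators in the second word. -/
def createR (γ : ℕ → ℂ) (j : Fin n) : BiFun n →ₗ[ℂ] BiFun n :=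
  (create γ j).compLeft (List (Fin n))

/-- The exchange of the two words. -/
def swapWords : BiFun n →ₗ[ℂ] BiFun n where
  toFun f w w' := f w' w
  map_add' _ _ := rfl
  map_smul' _ _ := rfl

@[simp] theorem annR_apply (j : Fin n) (f : BiFun n) (w : List (Fin n)) :
    annR j f w = ann j (f w) := rfl

@[simp] theorem createR_apply (γ : ℕ → ℂ) (j : Fin n) (f : BiFun n) (w : List (Fin n)) :
    createR γ j f w = create γ j (f w) := rfl

@[simp] theorem swapWords_apply (f : BiFun n) (w w' : List (Fin n)) :
    swapWords f w w' = f w' w := rfl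

@[simp] theorem swapWords_swapWords (f : BiFun n) : swapWords (swapWords f) = f := rfl

theorem ann_annR (i j : Fin n) (f : BiFun n) : ann i (annR j f) = annR j (ann i f) := rfl

theorem ann_createR (γ : ℕ → ℂ) (i j : Fin n) (f : BiFun n) :
    ann i (createR γ j f) = createR γ j (ann i f) := rfl

theorem create_annR (γ : ℕ → ℂ) (i j : Fin n) (f : BiFun n) :
    create γ i (annR j f) = annR j (create γ i f) := create_comp γ i (ann j) f

theorem create_createR (γ : ℕ → ℂ) (i j : Fin n) (f : BiFun n) :
    create γ i (createR γ j f) = createR γ j (create γ i f) := create_comp γ i (create γ j) f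

theorem scale_annR (ρ : ℕ → ℂ) (j : Fin n) (f : BiFun n) :
    scale ρ (annR j f) = annR j (scale ρ f) := rfl

theorem scale_createR (ρ γ : ℕ → ℂ) (j : Fin n) (f : BiFun n) :
    scale ρ (createR γ j f) = createR γ j (scale ρ f) := by
  ext w : 1
  simp

theorem createR_swapWords (γ : ℕ → ℂ) (j : Fin n) (f : BiFun n) :
    createR γ j (swapWords f) = swapWords (create γ j f) := by
  ext w w'
  exact congrFun (create_comp γ j (LinearMap.proj w : WordFun n ℂ →ₗ[ℂ] ℂ) f) w'

theorem create_swapWords (γ : ℕ → ℂ) (j : Fin n) (f : BiFun n) :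
    create γ j (swapWords f) = swapWords (createR γ j f) := by
  have := createR_swapWords γ j (swapWords f)
  rw [swapWords_swapWords] at this
  rw [this, swapWords_swapWords]

/-- Functions of two words that vanish unless the words have the same length. -/
def Diagonal (n : ℕ) : Submodule ℂ (BiFun n) where
  carrier := {f | ∀ w w', w.length ≠ w'.length → f w w' = 0}
  add_mem' hf hg w w' h := by simp [hf w w' h, hg w w' h]
  zero_mem' _ _ _ := rfl
  smul_mem' c _ hf w w' h := by simp [hf w w' h]

/-- The functions of two words that are traceless in both words and supported on pairs of words of
equal length. -/
def Admissible (n : ℕ) : Submodule ℂ (BiFun n) where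
  carrier := {f | f ∈ Traceless n (WordFun n ℂ) ∧ (∀ w, f w ∈ Traceless n ℂ) ∧ f ∈ Diagonal n}
  add_mem' hf hg := ⟨add_mem hf.1 hg.1, fun w => add_mem (hf.2.1 w) (hg.2.1 w),
    add_mem hf.2.2 hg.2.2⟩
  zero_mem' := ⟨zero_mem _, fun _ => zero_mem (Traceless n ℂ), zero_mem _⟩
  smul_mem' c _ hf := ⟨Submodule.smul_mem _ c hf.1, fun w => Submodule.smul_mem _ c (hf.2.1 w),
    Submodule.smul_mem _ c hf.2.2⟩

theorem swapWords_mem {f : BiFun n} (hf : f ∈ Admissible n) : swapWords f ∈ Admissible n :=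
  ⟨fun w₁ w₂ => by ext w'; simpa using hf.2.1 w' w₁ w₂,
    fun w w₁ w₂ => by simpa using congrFun (hf.1 w₁ w₂) w,
    fun w w' h => hf.2.2 w' w h.symm⟩

theorem scale_mem_admissible (ρ : ℕ → ℂ) {f : BiFun n} (hf : f ∈ Admissible n) :
    scale ρ f ∈ Admissible n :=
  ⟨scale_mem ρ hf.1, fun w => Submodule.smul_mem _ _ (hf.2.1 w),
    fun w w' h => by simp [hf.2.2 w w' h]⟩

theorem ann_annR_mem {f : BiFun n} (hf : f ∈ Admissible n) (i j : Fin n) :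
    ann i (annR j f) ∈ Admissible n :=
  ⟨ann_mem (comp_mem (ann j) hf.1) i, fun w => ann_mem (hf.2.1 (i :: w)) j,
    fun w w' h => hf.2.2 _ _ (by simpa using h)⟩

theorem annR_mem {f : BiFun n} (hf : f ∈ Traceless n (WordFun n ℂ)) (j : Fin n) :
    annR j f ∈ Traceless n (WordFun n ℂ) := comp_mem (ann j) hf

theorem createR_mem (γ : ℕ → ℂ) {f : BiFun n} (hf : f ∈ Traceless n (WordFun n ℂ)) (j : Fin n) :
    createR γ j f ∈ Traceless n (WordFun n ℂ) := comp_mem (create γ j) hf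

/-- When both words have the same length it does not matter which of them measures the degree. This
lets the one-word identities be applied in the second word. -/
theorem scale_apply_of_diagonal (ρ : ℕ → ℂ) {f : BiFun n} (hf : f ∈ Diagonal n)
    (w : List (Fin n)) : scale ρ (f w) = scale ρ f w := by
  ext w'
  by_cases h : w.length = w'.length
  · simp [h]
  · simp [hf w w' h]

theorem scale_swapWords (ρ : ℕ → ℂ) {f : BiFun n} (hf : f ∈ Diagonal n) :
    scale ρ (swapWords f) = swapWords (scale ρ f) := by
  ext w w'
  by_cases h : w'.length = w.length
  · simp [h]
  · simp [hf w' w h]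

/-- The indicator of `p (m + 1)` fixes `f` under `scale` and passes through `create` as the
indicator of `p`. -/
theorem create_eq_zero_of_length (γ : ℕ → ℂ) (k : Fin n) {E : Type*} [AddCommGroup E] [Module ℂ E]
    (p : ℕ → Prop) (f : WordFun n E) (hf : ∀ w, ¬ p (w.length + 1) → f w = 0) (w : List (Fin n))
    (hw : ¬ p w.length) : create γ k f w = 0 := by
  classical
  have h1 : scale (fun m => if p (m + 1) then 1 else 0) f = f := by
    ext w
    by_cases h : p (w.length + 1)
    · simp [h]
    · simp [hf w h]
  rw [← h1, create_scale γ _ (fun m => if p m then 1 else 0) (fun _ => rfl)]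
  simp [hw]

theorem create_createR_diagonal (γ : ℕ → ℂ) {f : BiFun n} (hf : f ∈ Diagonal n) (i j : Fin n) :
    create γ i (createR γ j f) ∈ Diagonal n := by
  intro w w' h
  have h1 : create γ i (createR γ j f) w w' =
      create γ i (fun w => createR γ j f w w') w :=
    (congrFun (create_comp γ i (LinearMap.proj w' : WordFun n ℂ →ₗ[ℂ] ℂ) (createR γ j f)) w).symm
  rw [h1]
  refine create_eq_zero_of_length γ i (fun m => m = w'.length) _ (fun v hv => ?_) w h
  refine create_eq_zero_of_length γ j (fun m => v.length + 1 = m) _ (fun v' hv' => ?_) w' hv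
  exact hf v v' fun h => hv' (by simpa using h)

/-- The action of the generators of `A_o(n)` on functions of two words. -/
def genOp (γ : ℕ → ℂ) (i j : Fin n) : BiFun n →ₗ[ℂ] BiFun n :=
  create γ i ∘ₗ createR γ j + ann i ∘ₗ annR j ∘ₗ scale γ

theorem genOp_apply (γ : ℕ → ℂ) (i j : Fin n) (f : BiFun n) :
    genOp γ i j f = create γ i (createR γ j f) + ann i (annR j (scale γ f)) := rfl

section Normalized

variable {γ : ℕ → ℂ} (h0 : γ 0 = 0) (hγ : ∀ m, γ (m + 1) * (n - γ m) = 1)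

/-- Exchanging the words transposes the matrix of generators, so the column relations will follow
from the row relations. -/
theorem genOp_swapWords {f : BiFun n} (hf : f ∈ Diagonal n) (i j : Fin n) :
    genOp γ i j (swapWords f) = swapWords (genOp γ j i f) := by
  rw [genOp_apply, genOp_apply, createR_swapWords, create_swapWords, scale_swapWords γ hf,
    map_add, create_createR]
  rfl

include h0 hγ

theorem create_createR_mem {f : BiFun n} (hf : f ∈ Admissible n) (i j : Fin n) :
    create γ i (createR γ j f) ∈ Admissible n := by
  refine ⟨create_mem h0 hγ (createR_mem γ hf.1 j) i, fun w => ?_,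
    create_createR_diagonal γ hf.2.2 i j⟩
  rw [create_createR]
  refine create_mem h0 hγ ?_ j
  have h1 := (swapWords_mem hf).1
  have h2 := createR_mem γ h1 i
  rw [createR_swapWords] at h2
  intro w₁ w₂
  simpa using congrFun (h2 w₁ w₂) w

theorem genOp_mem {f : BiFun n} (hf : f ∈ Admissible n) (i j : Fin n) :
    genOp γ i j f ∈ Admissible n :=
  add_mem (create_createR_mem h0 hγ hf i j) (ann_annR_mem (scale_mem_admissible γ hf) i j)

omit hγ in
theorem sum_createR_annR {f : BiFun n} (hf : f ∈ Admissible n) :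
    scale γ (∑ j, createR γ j (annR j f)) = scale γ f := by
  ext w : 1
  have h1 := scale_sum_create_ann h0 (hf.2.1 w)
  rw [scale_apply_of_diagonal γ hf.2.2] at h1
  rw [← h1]
  have h2 : (∑ j, createR γ j (annR j f)) ∈ Diagonal n := by
    intro v v' h
    simp only [Finset.sum_apply]
    refine Finset.sum_eq_zero fun j _ => ?_
    refine create_eq_zero_of_length γ j (fun m => v.length = m) _ (fun u hu => ?_) v' h
    exact hf.2.2 _ _ hu
  rw [← scale_apply_of_diagonal γ h2]
  simp

theorem sum_createR_createR {f : BiFun n} (hf : f ∈ Admissible n) :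
    ∑ j, createR γ j (createR γ j f) = 0 := by
  ext w : 1
  simpa using sum_create_create h0 hγ (hf.2.1 w)

omit h0 hγ in
theorem sum_annR_annR {f : BiFun n} (hf : f ∈ Admissible n) :
    ∑ j, annR j (annR j f) = 0 := by
  ext w : 1
  simpa using sum_ann_ann (hf.2.1 w)

omit hγ in
theorem sum_annR_createR {f : BiFun n} (hf : f ∈ Admissible n) :
    ∑ j, annR j (createR γ j f) = scale (fun m => n - γ m) f := by
  ext w : 1
  have := sum_ann_create h0 (hf.2.1 w)
  rw [scale_apply_of_diagonal _ hf.2.2] at this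
  simpa using this

/-- Of the four products of raising and lowering parts, raising twice and lowering twice vanish
(`t1`, `t4`). The mixed ones contribute `γ create_i ann_k` and, since `γ_{m+1} (n - γ_m) = 1`,
`ann_i create_k`; by `ann_create` they add up to `δ_ik`. -/
theorem genOp_row {f : BiFun n} (hf : f ∈ Admissible n) (i k : Fin n) :
    ∑ j, genOp γ i j (genOp γ k j f) = if i = k then f else 0 := by
  have t1 : ∑ j, create γ i (createR γ j (create γ k (createR γ j f))) = 0 := by
    simp_rw [← create_createR γ k]
    rw [← map_sum, ← map_sum, sum_createR_createR h0 hγ hf, map_zero, map_zero]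
  have t2 : ∑ j, create γ i (createR γ j (ann k (annR j (scale γ f)))) =
      scale γ (create γ i (ann k f)) := by
    simp_rw [← ann_createR, ← scale_annR, ← scale_createR]
    rw [← map_sum, ← map_sum, ← map_sum, sum_createR_annR h0 hf, ann_scale,
      create_scale γ _ γ (fun _ => rfl)]
  have t3 : ∑ j, ann i (annR j (scale γ (create γ k (createR γ j f)))) = ann i (create γ k f) := by
    simp_rw [← scale_annR, ← create_annR]
    rw [← map_sum, ← map_sum, ← map_sum, sum_annR_createR h0 hf,
      create_scale γ (fun m => n - γ m) (fun m => n - γ (m - 1)) (fun _ => rfl)]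
    ext w : 1
    simp [smul_smul, hγ]
  have t4 : ∑ j, ann i (annR j (scale γ (ann k (annR j (scale γ f))))) = 0 := by
    simp_rw [← scale_annR, ← ann_annR, ← scale_annR]
    rw [← map_sum, ← map_sum, ← map_sum, ← map_sum, sum_annR_annR hf]
    simp
  simp only [genOp_apply, map_add, Finset.sum_add_distrib, t1, t2, t3, t4, ann_create]
  abel

theorem genOp_col {f : BiFun n} (hf : f ∈ Admissible n) (i k : Fin n) :
    ∑ j, genOp γ j i (genOp γ j k f) = if i = k then f else 0 := by
  have h1 := genOp_row h0 hγ (swapWords_mem hf) i k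
  have h2 : ∀ j, genOp γ i j (genOp γ k j (swapWords f)) =
      swapWords (genOp γ j i (genOp γ j k f)) := fun j => by
    rw [genOp_swapWords hf.2.2, genOp_swapWords (genOp_mem h0 hγ hf j k).2.2]
  simp_rw [h2] at h1
  rw [← map_sum] at h1
  have h3 := congrArg swapWords h1
  rw [swapWords_swapWords] at h3
  rw [h3]
  split_ifs <;> rfl

end Normalized

end WordFunction

/-! ### Invariants and cocycles in the model -/

namespace WordFunction

variable {n : ℕ}

section Cocycles

variable {γ : ℕ → ℂ}

/-- The component of degree `N`. -/
abbrev component (N : ℕ) : BiFun n →ₗ[ℂ] BiFun n := scale fun m => if m = N then 1 else 0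

theorem component_eq_zero {N : ℕ} {f : BiFun n} (hf : ∀ w, w.length = N → f w = 0) :
    component N f = 0 := by
  ext w : 1
  rw [scale_apply]
  split_ifs with h
  · simp [hf w h]
  · simp

/-- Only the raising part of a generator reaches degree `N + 1` from degrees at most `N`. -/
theorem component_genOp {N : ℕ} {f : BiFun n} (hf : ∀ w, N + 1 ≤ w.length → f w = 0)
    (i j : Fin n) :
    component (N + 1) (genOp γ i j f) = create γ i (createR γ j (component N f)) := by
  rw [genOp_apply, map_add,
    component_eq_zero (f := ann i _) (fun w hw => by simp [hf (i :: w) (by simp [hw])]), add_zero,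
    ← scale_createR, create_scale γ _ (fun m => if m = N + 1 then 1 else 0) (fun m => by simp)]

theorem apply_eq_component {N : ℕ} {f : BiFun n} (hf : ∀ w, N + 1 ≤ w.length → f w = 0)
    {w : List (Fin n)} (hw : N ≤ w.length) : f w = component N f w := by
  rw [scale_apply]
  split_ifs with h
  · simp
  · rw [hf w (by omega), smul_zero]

variable (h0 : γ 0 = 0) (hγ : ∀ m, γ (m + 1) * (n - γ m) = 1)
include h0 hγ

theorem eq_zero_of_createR_eq_zero {f : BiFun n} (hf : ∀ w, f w ∈ Traceless n ℂ)
    (h : ∀ k, createR γ k f = 0) : f = 0 := by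
  ext w : 1
  exact eq_zero_of_create_eq_zero h0 hγ (hf w) fun k => congrFun (h k) w

/-- The raising parts must kill the component of highest degree, and they are jointly injective. -/
theorem eq_zero_of_genOp_eq {N : ℕ} {x : BiFun n} (hx : x ∈ Admissible n)
    (hN : ∀ w, N ≤ w.length → x w = 0)
    (h : ∀ i j, genOp γ i j x = if i = j then x else 0) : x = 0 := by
  induction N with
  | zero => exact funext fun w => hN w (Nat.zero_le _)
  | succ N ih =>
    refine ih fun w hw => ?_
    have h1 : ∀ i j, create γ i (createR γ j (component N x)) = 0 := fun i j => by
      rw [← component_genOp hN, h]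
      split_ifs
      · exact component_eq_zero fun w hw => hN w hw.ge
      · simp
    have hx' := scale_mem_admissible (fun m => if m = N then 1 else 0) hx
    rw [apply_eq_component hN hw, eq_zero_of_createR_eq_zero h0 hγ hx'.2.1 fun j =>
      eq_zero_of_create_eq_zero h0 hγ (createR_mem γ hx'.1 j) fun i => h1 i j]
    rfl

/-- The top component of a cocycle is in the image of the creation operators. -/
theorem exists_create_createR {c : Fin n → Fin n → BiFun n} (hc : ∀ i j, c i j ∈ Admissible n)
    (h1 : ∀ i j, ∑ k, create γ i (createR γ k (c j k)) = 0)
    (h2 : ∀ i j, ∑ k, create γ k (createR γ i (c k j)) = 0) :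
    ∀ i j, c i j = create γ i (createR γ j
      (∑ l, ∑ m, ann m (annR l (scale γ (scale γ (c m l)))))) := by
  have h3 : ∀ j k, c j k = createR γ k (∑ l, annR l (scale γ (c j l))) := fun j k => by
    have h : ∑ k, createR γ k (c j k) = 0 :=
      eq_zero_of_create_eq_zero h0 hγ (sum_mem fun k _ => createR_mem γ (hc j k).1 k) fun i => by
        rw [map_sum, h1]
    ext w : 1
    have h' := eq_create_of_sum_create_eq_zero γ (f := fun k => c j k w)
      (by simpa using congrFun h w) k
    rw [h', createR_apply, Finset.sum_apply]
    simp only [scale_apply_of_diagonal γ (hc j _).2.2, annR_apply]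
  have h4 : ∀ k j, c k j = create γ k (∑ l, ann l (scale γ (c l j))) := fun k j => by
    have h : ∑ k, create γ k (c k j) = 0 := by
      refine eq_zero_of_createR_eq_zero h0 hγ (fun w => ?_) fun i => ?_
      · rw [Finset.sum_apply]
        refine sum_mem fun k _ => ?_
        have h5 := createR_mem γ (swapWords_mem (hc k j)).1 k
        rw [createR_swapWords] at h5
        intro w₁ w₂
        simpa using congrFun (h5 w₁ w₂) w
      · rw [map_sum, ← h2 i j]
        simp only [create_createR]
    exact eq_create_of_sum_create_eq_zero γ (f := fun k => c k j) h k
  -- By `h3` the entry lies in the image of `createR γ k`; substituting `h4` inside also pulls out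
  -- `create γ j`. Each substitution contributes one factor `scale γ`.
  intro j k
  conv_lhs => rw [h3 j k]
  rw [create_createR]
  congr 1
  rw [map_sum]
  refine Finset.sum_congr rfl fun l _ => ?_
  conv_lhs => rw [h4 j l]
  rw [← create_scale γ (fun m => γ (m + 1)) γ (fun _ => rfl), ← create_annR]
  simp only [map_sum, ann_annR, ann_scale]

/-- Induction on the degree. The highest component of the equation forces the highest component of
`c` to be `create_i createR_j r`, which is also the highest component of the coboundary of `r`;
subtracting that coboundary lowers the degree. -/
theorem exists_of_genOp_cocycle {N : ℕ} {c : Fin n → Fin n → BiFun n}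
    (hc : ∀ i j, c i j ∈ Admissible n) (hN : ∀ i j w, N ≤ w.length → c i j w = 0)
    (h : ∀ i j, c i j + ∑ k, genOp γ i k (c j k) = 0) :
    ∃ x ∈ Admissible n, (∀ w, N ≤ w.length → x w = 0) ∧
      ∀ i j, c i j = genOp γ i j x - if i = j then x else 0 := by
  induction N generalizing c with
  | zero =>
    refine ⟨0, zero_mem _, fun _ _ => rfl, fun i j => ?_⟩
    rw [show c i j = 0 from funext fun w => hN i j w (Nat.zero_le _)]
    simp
  | succ N ih =>
    -- Multiplication by the transpose of `u` gives a second form of the cocycle equation. The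
    -- original form controls the second word of the highest component, this one the first word.
    have h' : ∀ i j, c j i + ∑ k, genOp γ k i (c k j) = 0 := fun i j => by
      have h2 : ∑ k, genOp γ k i (c k j + ∑ l, genOp γ k l (c j l)) = 0 :=
        Finset.sum_eq_zero fun k _ => by rw [h, map_zero]
      simp only [map_add, map_sum, Finset.sum_add_distrib] at h2
      rw [Finset.sum_comm (f := fun k l => genOp γ k i (genOp γ k l (c j l)))] at h2
      simp only [genOp_col h0 hγ (hc _ _), Finset.sum_ite_eq, Finset.mem_univ, if_true] at h2
      rw [add_comm, h2]
    have hbar : ∀ i j, component N (c i j) ∈ Admissible n := fun i j =>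
      scale_mem_admissible _ (hc i j)
    have key := exists_create_createR h0 hγ hbar
      (fun i j => by
        have h3 := congrArg (component (N + 1)) (h i j)
        rw [map_add, component_eq_zero fun w hw => hN i j w hw.ge, zero_add, map_sum,
          map_zero] at h3
        rw [← h3]
        exact Finset.sum_congr rfl fun k _ => (component_genOp (hN j k) i k).symm)
      (fun i j => by
        have h3 := congrArg (component (N + 1)) (h' i j)
        rw [map_add, component_eq_zero fun w hw => hN j i w hw.ge, zero_add, map_sum,
          map_zero] at h3
        rw [← h3]
        exact Finset.sum_congr rfl fun k _ => (component_genOp (hN k j) k i).symm)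
    set r := ∑ l, ∑ m, ann m (annR l (scale γ (scale γ (component N (c m l))))) with hr
    have hrA : r ∈ Admissible n := sum_mem fun l _ => sum_mem fun m _ =>
      ann_annR_mem (scale_mem_admissible _ (scale_mem_admissible _ (hbar m l))) m l
    have hrN : ∀ w, N ≤ w.length → r w = 0 := fun w hw => by
      simp only [hr, Finset.sum_apply]
      refine Finset.sum_eq_zero fun l _ => Finset.sum_eq_zero fun m _ => ?_
      simp [show ¬ (w.length + 1 = N) by omega]
    obtain ⟨x, hx, hxN, hxc⟩ := ih (c := fun i j => c i j - (genOp γ i j r - if i = j then r else 0))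
      (fun i j => sub_mem (hc i j) (sub_mem (genOp_mem h0 hγ hrA i j)
        (by split_ifs; exacts [hrA, zero_mem _])))
      (fun i j w hw => by
        have h5 : (if i = j then r else 0 : BiFun n) w = 0 := by
          split_ifs
          · exact hrN w hw
          · rfl
        have h6 : ann i (annR j (scale γ r)) w = 0 := by
          simp [hrN (i :: w) (by simp; omega)]
        rw [Pi.sub_apply, Pi.sub_apply, h5, genOp_apply, Pi.add_apply, h6, ← key,
          apply_eq_component (hN i j) hw]
        simp)
      (fun i j => by
        have h7 : ∀ k, genOp γ i k (if j = k then r else 0) = if j = k then genOp γ i k r else 0 :=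
          fun k => by split_ifs <;> simp
        simp only [map_sub, Finset.sum_sub_distrib, genOp_row h0 hγ hrA, h7, Finset.sum_ite_eq,
          Finset.mem_univ, if_true]
        have := h i j
        rw [add_eq_zero_iff_eq_neg] at this
        rw [this]
        abel)
    refine ⟨x + r, add_mem hx hrA, fun w hw => ?_, fun i j => ?_⟩
    · rw [Pi.add_apply, hxN w (by omega), hrN w (by omega), add_zero]
    · have := hxc i j
      rw [sub_eq_iff_eq_add] at this
      rw [this, map_add]
      split_ifs <;> abel

end Cocycles

end WordFunction

/-! ### Relations, induction and universal property of `A_o(n)` -/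

namespace FreeOrthogonal

variable {n : ℕ}

theorem sum_row (i k : Fin n) : ∑ j, u n i j * u n k j = if i = k then 1 else 0 := by
  have := RingQuot.mkAlgHom_rel ℂ (FreeOrthogonalRel.row (n := n) i k)
  simp only [map_sum, map_mul] at this
  unfold u
  rw [this]
  split_ifs <;> simp

theorem sum_col (i k : Fin n) : ∑ j, u n j i * u n j k = if i = k then 1 else 0 := by
  have := RingQuot.mkAlgHom_rel ℂ (FreeOrthogonalRel.col (n := n) i k)
  simp only [map_sum, map_mul] at this
  unfold u
  rw [this]
  split_ifs <;> simp

theorem sum_row_mul (i k : Fin n) (x : FreeOrthogonal n) :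
    ∑ j, u n i j * (u n k j * x) = if i = k then x else 0 := by
  simp_rw [← mul_assoc]
  rw [← Finset.sum_mul, sum_row]
  split_ifs <;> simp

theorem sum_col_mul (i k : Fin n) (x : FreeOrthogonal n) :
    ∑ j, u n j i * (u n j k * x) = if i = k then x else 0 := by
  simp_rw [← mul_assoc]
  rw [← Finset.sum_mul, sum_col]
  split_ifs <;> simp

@[elab_as_elim]
theorem induction {P : FreeOrthogonal n → Prop} (hc : ∀ c : ℂ, P (algebraMap ℂ _ c))
    (hu : ∀ i j, P (u n i j)) (hadd : ∀ a b, P a → P b → P (a + b))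
    (hmul : ∀ a b, P a → P b → P (a * b)) (a : FreeOrthogonal n) : P a := by
  obtain ⟨a, rfl⟩ := RingQuot.mkAlgHom_surjective ℂ (FreeOrthogonalRel n) a
  induction a using FreeAlgebra.induction with
  | grade0 c => simpa using hc c
  | grade1 p => exact hu p.1 p.2
  | mul a b ha hb => rw [map_mul]; exact hmul _ _ ha hb
  | add a b ha hb => rw [map_add]; exact hadd _ _ ha hb

/-- The universal property of `A_o(n)`. -/
def lift {B : Type*} [Ring B] [Algebra ℂ B] (x : Fin n → Fin n → B)
    (hr : ∀ i k, ∑ j, x i j * x k j = if i = k then 1 else 0)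
    (hc : ∀ i k, ∑ j, x j i * x j k = if i = k then 1 else 0) : FreeOrthogonal n →ₐ[ℂ] B :=
  RingQuot.liftAlgHom ℂ ⟨FreeAlgebra.lift ℂ fun p => x p.1 p.2, by
    rintro _ _ (⟨i, k⟩ | ⟨i, k⟩)
    · simp only [map_sum, map_mul, FreeAlgebra.lift_ι_apply, hr]
      split_ifs <;> simp
    · simp only [map_sum, map_mul, FreeAlgebra.lift_ι_apply, hc]
      split_ifs <;> simp⟩

@[simp]
theorem lift_u {B : Type*} [Ring B] [Algebra ℂ B] (x : Fin n → Fin n → B) (hr hc) (i j : Fin n) :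
    lift x hr hc (u n i j) = x i j := by
  simp [lift, u]

theorem algHom_ext {B : Type*} [Semiring B] [Algebra ℂ B] {f g : FreeOrthogonal n →ₐ[ℂ] B}
    (h : ∀ i j, f (u n i j) = g (u n i j)) : f = g := by
  refine AlgHom.ext fun a => ?_
  induction a using induction with
  | hc c => simp
  | hu i j => exact h i j
  | hadd a b ha hb => simp [ha, hb]
  | hmul a b ha hb => simp [ha, hb]

end FreeOrthogonal

/-! ### Evaluation of functions of two words in `A_o(n)` -/

namespace WordFunction

open FreeOrthogonal

variable {n : ℕ}

/-- The linear form `f ↦ ∑ u_{w₁w'₁} ⋯ u_{wₘw'ₘ} f(w, w')`, the sum over all words `w`, `w'` of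
length `m`. -/
def eval : ℕ → (BiFun n →ₗ[ℂ] FreeOrthogonal n)
  | 0 => Algebra.linearMap ℂ _ ∘ₗ LinearMap.proj [] ∘ₗ
      (LinearMap.proj [] : WordFun n (WordFun n ℂ) →ₗ[ℂ] WordFun n ℂ)
  | m + 1 => ∑ i, ∑ j, LinearMap.mulLeft ℂ (u n i j) ∘ₗ eval m ∘ₗ ann i ∘ₗ annR j

theorem eval_zero (f : BiFun n) : eval 0 f = algebraMap ℂ _ (f [] []) := rfl

theorem eval_succ (m : ℕ) (f : BiFun n) :
    eval (m + 1) f = ∑ i, ∑ j, u n i j * eval m (ann i (annR j f)) := by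
  simp [eval]

theorem eval_scale (m : ℕ) (ρ : ℕ → ℂ) (f : BiFun n) : eval m (scale ρ f) = ρ m • eval m f := by
  induction m generalizing ρ f with
  | zero => simp [eval_zero, Algebra.smul_def]
  | succ m ih =>
    simp only [eval_succ, Finset.smul_sum]
    refine Finset.sum_congr rfl fun i _ => Finset.sum_congr rfl fun j _ => ?_
    rw [← scale_annR, ann_scale, ih, mul_smul_comm]

theorem eval_eq_zero {m : ℕ} {f : BiFun n} (hf : ∀ w, w.length = m → f w = 0) : eval m f = 0 := by
  have h1 : scale (fun k => if k = m then 0 else 1) f = f := by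
    ext w : 1
    rw [scale_apply]
    split_ifs with h
    · simp [hf w h]
    · simp
  rw [← h1, eval_scale]
  simp

theorem annR_createR {γ : ℕ → ℂ} {f : BiFun n} (hf : f ∈ Diagonal n) (l j : Fin n) :
    annR l (createR γ j f) = (if l = j then f else 0) - scale γ (createR γ l (annR j f)) := by
  have hD : createR γ l (annR j f) ∈ Diagonal n := fun v v' h =>
    create_eq_zero_of_length γ l (fun m => v.length = m) _ (fun u hu => hf _ _ hu) v' h
  ext w : 1
  rw [annR_apply, createR_apply, ann_create, Pi.sub_apply, ← scale_apply_of_diagonal γ hD]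
  congr 1
  split_ifs <;> rfl

section Normalized

variable {γ : ℕ → ℂ}

theorem create_traceless_right {f : BiFun n} (hf : ∀ w, f w ∈ Traceless n ℂ) (k : Fin n) :
    ∀ w, create γ k f w ∈ Traceless n ℂ := by
  intro w w₁ w₂
  have h1 : swapWords f ∈ Traceless n (WordFun n ℂ) := fun w₁ w₂ => by
    ext w'
    simpa using hf w' w₁ w₂
  have h2 := createR_mem γ h1 k
  rw [createR_swapWords] at h2
  simpa using congrFun (h2 w₁ w₂) w

/-- In degree `m + 1` only nonempty words matter, and on these `∑ create_k ann_k` is the identity.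
-/
theorem eval_sum_create_ann (m : ℕ) {f : BiFun n} (hf : f ∈ Traceless n (WordFun n ℂ)) :
    eval (m + 1) f = ∑ k, eval (m + 1) (create γ k (ann k f)) := by
  have h1 : ∀ i j, ann i (annR j f) = ann i (annR j (∑ k, create γ k (ann k f))) := fun i j => by
    rw [ann_annR, ann_annR]
    congr 1
    ext w : 1
    exact (sum_create_ann γ hf i w).symm
  rw [← map_sum]
  simp only [eval_succ, h1]

theorem eval_sum_createR_annR (m : ℕ) {f : BiFun n} (hf : ∀ w, f w ∈ Traceless n ℂ) :
    eval (m + 1) f = ∑ k, eval (m + 1) (createR γ k (annR k f)) := by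
  have h1 : ∀ i j, ann i (annR j f) = ann i (annR j (∑ k, createR γ k (annR k f))) := fun i j => by
    congr 1
    ext w w'
    have := sum_create_ann γ (hf w) j w'
    simpa using this.symm
  rw [← map_sum]
  simp only [eval_succ, h1]

variable (h0 : γ 0 = 0) (hγ : ∀ m, γ (m + 1) * (n - γ m) = 1)
include h0 hγ

/-- The three-term recursion for matrix coefficients that reflects `V_1 ⊗ V_m = V_{m+1} ⊕ V_{m-1}`.
For `m = 0` the truncated `m - 1` is harmless because `γ 0 = 0`. -/
theorem eval_create_createR (m : ℕ) {f : BiFun n} (hf : f ∈ Admissible n) (i j : Fin n) :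
    eval (m + 1) (create γ i (createR γ j f)) =
      u n i j * eval m f - γ m • eval (m - 1) (ann i (annR j f)) := by
  induction m generalizing f i j with
  | zero =>
    simp only [eval_succ, eval_zero, ann_apply, annR_apply, h0, zero_smul, sub_zero]
    simp only [createR_apply, create_cons, List.length_nil, h0, zero_smul,
      sub_zero]
    rw [Finset.sum_eq_single i, Finset.sum_eq_single j]
    · simp [create_cons, h0]
    · intro l _ hl; simp [create_cons, h0, hl]
    · simp
    · intro k _ hk; simp [hk]
    · simp
  | succ m ih =>
    set g := ann i (annR j f) with hg
    have hgA : g ∈ Admissible n := ann_annR_mem hf i j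
    -- The commutation relation in both words gives four terms. After evaluation the first is `u_ij`
    -- times the value of `f`; the others are handled by the row relations, the column relations and
    -- `∑ u_kl u_kl = n`.
    have hexp : ∀ k l, ann k (annR l (create γ i (createR γ j f))) =
        (if k = i then (if l = j then f else 0) else 0)
        - (if k = i then scale γ (createR γ l (annR j f)) else 0)
        - (if l = j then scale γ (create γ k (ann i f)) else 0)
        + scale γ (scale γ (create γ k (createR γ l g))) := fun k l => by
      rw [← create_annR, ann_create, annR_createR hf.2.2]
      have e : ann i (scale γ (createR γ l (annR j f))) =
          scale (fun m => γ (m + 1)) (createR γ l g) := rfl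
      rw [map_sub, map_sub, e, create_scale γ _ γ (fun _ => rfl), map_sub]
      split_ifs <;> (try simp only [map_zero]) <;> abel
    -- This function is traceless in the first word, so it is a sum of creations to which the
    -- induction hypothesis applies; the lower-order terms add up to a contraction of `f` and
    -- vanish.
    have hA : ∀ l, eval (m + 1) (createR γ l (annR j f)) =
        ∑ k, u n k l * eval m (ann k (annR j f)) := fun l => by
      rw [eval_sum_create_ann (γ := γ) m (createR_mem γ (annR_mem hf.1 j) l)]
      have h1 : ∀ k, eval (m + 1) (create γ k (ann k (createR γ l (annR j f)))) =
          u n k l * eval m (ann k (annR j f)) -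
            γ m • eval (m - 1) (ann k (annR l (ann k (annR j f)))) := fun k =>
        ih (ann_annR_mem hf k j) k l
      simp only [h1, Finset.sum_sub_distrib, sub_eq_self]
      rw [← Finset.smul_sum, ← map_sum]
      have h2 : ∀ k, ann k (annR l (ann k (annR j f))) = annR l (annR j (ann k (ann k f))) :=
        fun _ => rfl
      simp only [h2]
      rw [← map_sum, ← map_sum, sum_ann_ann hf.1]
      simp
    have hB : ∀ k, eval (m + 1) (create γ k (ann i f)) =
        ∑ l, u n k l * eval m (ann i (annR l f)) := fun k => by
      rw [eval_sum_createR_annR (γ := γ) m (f := create γ k (ann i f))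
        (create_traceless_right (fun w => hf.2.1 (i :: w)) k)]
      have h1 : ∀ l, eval (m + 1) (createR γ l (annR l (create γ k (ann i f)))) =
          u n k l * eval m (ann i (annR l f)) -
            γ m • eval (m - 1) (ann k (annR l (ann i (annR l f)))) := fun l => by
        rw [← create_annR, ← create_createR]
        exact ih (ann_annR_mem hf i l) k l
      simp only [h1, Finset.sum_sub_distrib, sub_eq_self]
      rw [← Finset.smul_sum, ← map_sum]
      have h2 : ∀ l, ann k (annR l (ann i (annR l f))) = ann k (ann i (annR l (annR l f))) :=
        fun _ => rfl
      simp only [h2]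
      rw [← map_sum, ← map_sum, sum_annR_annR hf]
      simp
    have hC : ∀ k l, eval (m + 1) (create γ k (createR γ l g)) =
        u n k l * eval m g - γ m • eval (m - 1) (ann k (annR l g)) := fun k l => ih hgA k l
    have hlow : γ m • ∑ k, ∑ l, u n k l * eval (m - 1) (ann k (annR l g)) = γ m • eval m g := by
      rcases m with _ | m
      · simp [h0]
      · rw [eval_succ]; rfl
    rw [eval_succ]
    simp only [hexp, map_add, map_sub, mul_add, mul_sub, Finset.sum_add_distrib,
      Finset.sum_sub_distrib, apply_ite (eval (m + 1)), map_zero, eval_scale, mul_ite, mul_zero,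
      Finset.sum_ite_eq', Finset.mem_univ, if_true, hA, hB, hC, smul_sub,
      mul_smul_comm, ← Finset.smul_sum, Finset.mul_sum, Finset.sum_ite_irrel,
      Finset.sum_const_zero]
    have hA' : ∑ l, ∑ k, u n i l * (u n k l * eval m (ann k (annR j f))) = eval m g := by
      rw [Finset.sum_comm]
      simp [sum_row_mul, hg]
    have hB' : ∑ k, ∑ l, u n k j * (u n k l * eval m (ann i (annR l f))) = eval m g := by
      rw [Finset.sum_comm]
      simp [sum_col_mul, hg]
    have hC' : ∑ k, ∑ l, u n k l * (u n k l * eval m g) = (n : ℂ) • eval m g := by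
      simp [sum_row_mul, Nat.cast_smul_eq_nsmul]
    rw [hA', hB', hC', hlow]
    -- The last term contributes `γ_{m+1}² (n - γ_m) = γ_{m+1}`, cancelling one of the two mixed
    -- terms, each of which contributes `-γ_{m+1}`.
    have h3 : γ (m + 1) • γ (m + 1) • ((n : ℂ) • eval m g - γ m • eval m g) =
        γ (m + 1) • eval m g := by
      have h4 : (n : ℂ) • eval m g - γ m • eval m g = (n - γ m : ℂ) • eval m g :=
        (sub_smul (n : ℂ) (γ m) (eval m g)).symm
      rw [h4, smul_smul, smul_smul, mul_assoc, hγ, mul_one]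
    rw [← smul_sub, ← smul_sub, h3, Nat.add_sub_cancel]
    abel

/-- A telescoping sum: the defect `-γ_m eval (m - 1) g` of the raising part in degree `m + 1`
cancels the lowering part in degree `m - 1`, where `g = ann i (annR j f)`. -/
theorem sum_eval_genOp {N : ℕ} {f : BiFun n} (hf : f ∈ Admissible n)
    (hN : ∀ w, N ≤ w.length → f w = 0) (i j : Fin n) :
    ∑ m ∈ Finset.range (N + 1), eval m (genOp γ i j f) =
      u n i j * ∑ m ∈ Finset.range N, eval m f := by
  set g := ann i (annR j f) with hg
  have h1 : ∀ m, eval m (ann i (annR j (scale γ f))) = γ (m + 1) • eval m g := fun m => by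
    rw [← scale_annR, ann_scale, eval_scale]
  have h2 : ∀ M, ∑ m ∈ Finset.range (M + 1), eval m (genOp γ i j f) =
      u n i j * ∑ m ∈ Finset.range M, eval m f + γ M • eval (M - 1) g + γ (M + 1) • eval M g := by
    intro M
    induction M with
    | zero =>
      simp [genOp_apply, h1, h0, eval_zero (create γ i _)]
    | succ M ih =>
      rw [Finset.sum_range_succ, ih, genOp_apply, map_add, h1, eval_create_createR h0 hγ M hf,
        Finset.sum_range_succ, mul_add, Nat.add_sub_cancel]
      abel
  rw [h2]
  have h3 : eval N g = 0 := eval_eq_zero fun w hw => by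
    simp [hg, hN (i :: w) (by simp; omega)]
  have h4 : γ N • eval (N - 1) g = 0 := by
    rcases N with _ | N
    · simp [h0]
    · rw [eval_eq_zero fun w hw => ?_, smul_zero]
      simp [hg, hN (i :: w) (by simp at hw ⊢; omega)]
  rw [h3, h4]
  simp

end Normalized

end WordFunction

/-! ### The model as a module with `A_o(n)` as a direct summand -/

namespace WordFunction

open FreeOrthogonal

variable {n : ℕ}

/-- The admissible functions of bounded degree. -/
def Model (n : ℕ) : Submodule ℂ (BiFun n) where
  carrier := {f | f ∈ Admissible n ∧ ∃ N : ℕ, ∀ w, N ≤ w.length → f w = 0}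
  add_mem' := by
    rintro f g ⟨hf, N, hN⟩ ⟨hg, N', hN'⟩
    refine ⟨add_mem hf hg, max N N', fun w hw => ?_⟩
    rw [Pi.add_apply, hN w (by omega), hN' w (by omega), add_zero]
  zero_mem' := ⟨zero_mem _, 0, fun _ _ => rfl⟩
  smul_mem' := by
    rintro c f ⟨hf, N, hN⟩
    exact ⟨Submodule.smul_mem _ c hf, N, fun w hw => by rw [Pi.smul_apply, hN w hw, smul_zero]⟩

theorem genOp_bounded {γ : ℕ → ℂ} {N : ℕ} {f : BiFun n} (hN : ∀ w, N ≤ w.length → f w = 0)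
    (i j : Fin n) {w : List (Fin n)} (hw : N + 1 ≤ w.length) : genOp γ i j f w = 0 := by
  rw [genOp_apply, Pi.add_apply]
  have h1 : create γ i (createR γ j f) w = 0 :=
    create_eq_zero_of_length γ i (fun m => m < N + 1) _ (fun v hv => by
      rw [createR_apply, hN v (by omega), map_zero]) w (by omega)
  rw [h1, ann_apply, annR_apply, scale_apply, hN (i :: w) (by simp; omega)]
  simp

/-- The recursion never divides by zero, because `γ_m < 1` persists when `n ≥ 2`. In terms of
quantum integers with `[2] = n`, `γ_m = [m] / [m + 1]`. -/
theorem exists_normalization (hn : 2 ≤ n) :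
    ∃ γ : ℕ → ℂ, γ 0 = 0 ∧ ∀ m, γ (m + 1) * (n - γ m) = 1 := by
  let g : ℕ → ℝ := fun m => Nat.rec 0 (fun _ x => 1 / (n - x)) m
  have hn' : (2 : ℝ) ≤ n := by exact_mod_cast hn
  have hg : ∀ m, g m < 1 := by
    intro m
    induction m with
    | zero => exact one_pos
    | succ m ih =>
      change 1 / (n - g m) < 1
      rw [div_lt_one (by linarith)]
      linarith
  refine ⟨fun m => Complex.ofReal (g m), by simp [g], fun m => ?_⟩
  have h1 : g (m + 1) * (n - g m) = 1 := by
    change 1 / (n - g m) * (n - g m) = 1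
    have := hg m
    rw [one_div_mul_cancel (by linarith)]
  simpa using congrArg Complex.ofReal h1

/-- The function supported on the pair of empty words. -/
def vacuum (n : ℕ) : Model n :=
  ⟨fun w w' => if w = [] ∧ w' = [] then 1 else 0,
    ⟨fun w₁ w₂ => by ext; simp, fun w w₁ w₂ => by simp, fun w w' h => by
      refine if_neg ?_
      rintro ⟨rfl, rfl⟩
      exact h rfl⟩, 1, fun w hw => by
      ext w'
      have : w ≠ [] := fun h => by simp [h] at hw
      simp [this]⟩

section Normalized

variable {γ : ℕ → ℂ} (h0 : γ 0 = 0) (hγ : ∀ m, γ (m + 1) * (n - γ m) = 1)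

/-- The generators of `A_o(n)` as operators on the model. -/
def modelOp (i j : Fin n) : Module.End ℂ (Model n) :=
  (genOp γ i j).restrict fun _ hf => ⟨genOp_mem h0 hγ hf.1 i j,
    hf.2.choose + 1, fun _ hw => genOp_bounded hf.2.choose_spec i j hw⟩

/-- The representation of `A_o(n)` on the model. -/
def modelRep : FreeOrthogonal n →ₐ[ℂ] Module.End ℂ (Model n) :=
  FreeOrthogonal.lift (modelOp h0 hγ)
    (fun i k => LinearMap.ext fun f => Subtype.ext <| by
      have := genOp_row h0 hγ f.2.1 i k
      rw [LinearMap.sum_apply, Submodule.coe_sum]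
      refine this.trans ?_
      split_ifs <;> rfl)
    (fun i k => LinearMap.ext fun f => Subtype.ext <| by
      have := genOp_col h0 hγ f.2.1 i k
      rw [LinearMap.sum_apply, Submodule.coe_sum]
      refine this.trans ?_
      split_ifs <;> rfl)

theorem modelRep_u (i j : Fin n) (f : Model n) :
    (modelRep h0 hγ (u n i j) f : BiFun n) = genOp γ i j f := by
  rw [modelRep, lift_u]
  rfl

/-- The sum of the linear forms `eval m`. -/
def totalEval (f : Model n) : FreeOrthogonal n :=
  ∑ m ∈ Finset.range f.2.2.choose, eval m f.1

theorem totalEval_eq (f : Model n) {N : ℕ} (hN : ∀ w, N ≤ w.length → f.1 w = 0) :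
    totalEval f = ∑ m ∈ Finset.range N, eval m f.1 := by
  have key : ∀ {N M : ℕ}, (∀ w, N ≤ w.length → f.1 w = 0) → N ≤ M →
      ∑ m ∈ Finset.range M, eval m f.1 = ∑ m ∈ Finset.range N, eval m f.1 := by
    intro N M hN hNM
    symm
    refine Finset.sum_subset (Finset.range_subset_range.2 hNM) fun m _ hm => ?_
    exact eval_eq_zero fun w hw => hN w (by simpa [hw] using hm)
  rcases le_total N f.2.2.choose with h | h
  · exact key hN h
  · exact (key f.2.2.choose_spec h).symm

theorem totalEval_add (f g : Model n) : totalEval (f + g) = totalEval f + totalEval g := by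
  obtain ⟨N, hN⟩ := f.2.2
  obtain ⟨M, hM⟩ := g.2.2
  have hN' : ∀ w, max N M ≤ w.length → f.1 w = 0 := fun w hw => hN w (by omega)
  have hM' : ∀ w, max N M ≤ w.length → g.1 w = 0 := fun w hw => hM w (by omega)
  rw [totalEval_eq f hN', totalEval_eq g hM', totalEval_eq (f + g) (N := max N M),
    ← Finset.sum_add_distrib]
  · exact Finset.sum_congr rfl fun m _ => map_add _ _ _
  · intro w hw
    change f.1 w + g.1 w = 0
    rw [hN' w hw, hM' w hw, add_zero]

theorem totalEval_smul (c : ℂ) (f : Model n) : totalEval (c • f) = c • totalEval f := by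
  obtain ⟨N, hN⟩ := f.2.2
  rw [totalEval_eq f hN, totalEval_eq (c • f) (N := N), Finset.smul_sum]
  · exact Finset.sum_congr rfl fun m _ => map_smul _ _ _
  · intro w hw
    change c • f.1 w = 0
    rw [hN w hw, smul_zero]

theorem totalEval_vacuum : totalEval (vacuum n) = 1 := by
  rw [totalEval_eq (N := 1)]
  · simp [eval_zero, vacuum]
  · intro w hw
    ext w'
    have : w ≠ [] := fun h => by simp [h] at hw
    simp [this, vacuum]

theorem totalEval_modelRep (a : FreeOrthogonal n) (f : Model n) :
    totalEval (modelRep h0 hγ a f) = a * totalEval f := by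
  induction a using FreeOrthogonal.induction generalizing f with
  | hc c =>
    rw [AlgHom.commutes, Module.algebraMap_end_apply, totalEval_smul, Algebra.smul_def]
  | hu i j =>
    obtain ⟨N, hN⟩ := f.2.2
    rw [totalEval_eq f hN, totalEval_eq (N := N + 1), modelRep_u,
      sum_eval_genOp h0 hγ f.2.1 hN]
    intro w hw
    rw [modelRep_u]
    exact genOp_bounded hN i j hw
  | hadd a b ha hb => rw [map_add, LinearMap.add_apply, totalEval_add, ha, hb, add_mul]
  | hmul a b ha hb => rw [map_mul, Module.End.mul_apply, ha, hb, mul_assoc]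

/-- The `A`-linear map `totalEval` is a retraction of the orbit map of the vacuum, so equations in
`A` can be solved in the model. -/
theorem totalEval_modelRep_vacuum (a : FreeOrthogonal n) :
    totalEval (modelRep h0 hγ a (vacuum n)) = a := by
  rw [totalEval_modelRep, totalEval_vacuum, mul_one]

end Normalized

end WordFunction

/-! ### Transfer of invariants and cocycles from the model to `A_o(n)` -/

namespace FreeOrthogonal

open WordFunction

variable {n : ℕ}

theorem eq_zero_of_invariant (hn : 2 ≤ n) {x : FreeOrthogonal n}
    (h : ∀ i j, u n i j * x = if i = j then x else 0) : x = 0 := by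
  obtain ⟨γ, h0, hγ⟩ := exists_normalization hn
  set f := modelRep h0 hγ x (vacuum n) with hf
  have h1 : f = 0 := by
    obtain ⟨N, hN⟩ := f.2.2
    refine Subtype.ext (eq_zero_of_genOp_eq h0 hγ f.2.1 hN fun i j => ?_)
    rw [← modelRep_u h0 hγ, hf, ← Module.End.mul_apply, ← map_mul, h]
    split_ifs <;> simp
  rw [← totalEval_modelRep_vacuum h0 hγ x, ← hf, h1, totalEval_eq (N := 0) _ fun _ _ => rfl]
  simp

/-- The orbit map of the vacuum carries the cocycle into the model; `totalEval` carries the solution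
back. -/
theorem exists_of_cocycle (hn : 2 ≤ n) {c : Fin n → Fin n → FreeOrthogonal n}
    (h : ∀ i j, c i j + ∑ k, u n i k * c j k = 0) :
    ∃ x, ∀ i j, c i j = u n i j * x - if i = j then x else 0 := by
  obtain ⟨γ, h0, hγ⟩ := exists_normalization hn
  let f : Fin n → Fin n → Model n := fun i j => modelRep h0 hγ (c i j) (vacuum n)
  choose N hN using fun i j => (f i j).2.2
  -- The sum of the individual degree bounds serves as a common bound for all entries.
  obtain ⟨x, hx, hxN, hxf⟩ := exists_of_genOp_cocycle h0 hγ (N := ∑ i, ∑ j, N i j)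
    (c := fun i j => (f i j).1) (fun i j => (f i j).2.1)
    (fun i j w hw => hN i j w (le_trans (le_trans
      (Finset.single_le_sum (f := fun j => N i j) (fun _ _ => Nat.zero_le _) (Finset.mem_univ j))
      (Finset.single_le_sum (f := fun i => ∑ j, N i j) (fun _ _ => Nat.zero_le _)
        (Finset.mem_univ i))) hw))
    (fun i j => by
      have h1 : f i j + ∑ k, modelRep h0 hγ (u n i k) (f j k) = 0 := by
        simp only [f, ← Module.End.mul_apply, ← map_mul]
        rw [← LinearMap.sum_apply, ← map_sum, ← LinearMap.add_apply, ← map_add, h]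
        simp
      have h2 := congrArg Subtype.val h1
      simpa [modelRep_u] using h2)
  let y : Model n := ⟨x, hx, _, hxN⟩
  refine ⟨totalEval y, fun i j => ?_⟩
  have h3 : f i j + (if i = j then y else 0) = modelRep h0 hγ (u n i j) y := by
    refine Subtype.ext ?_
    rw [modelRep_u, Submodule.coe_add, hxf]
    split_ifs <;> simp [y]
  have h4 := congrArg totalEval h3
  rw [totalEval_add, totalEval_modelRep, totalEval_vacuum, mul_one, totalEval_modelRep] at h4
  rw [← h4]
  split_ifs
  · simp
  · rw [totalEval_eq (N := 0) _ fun _ _ => rfl]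
    simp

end FreeOrthogonal

/-! ### The augmentation ideal, Fox calculus and the antipode -/

namespace FreeOrthogonal

variable {n : ℕ}

/-- For products one uses `ab - ε(ab) = (a - ε(a)) b + (b - ε(b)) ε(a)`, which keeps the elements
`u_ij - δ_ij` on the left. -/
theorem exists_of_counit_eq_zero (a : FreeOrthogonal n) :
    ∃ y : Fin n → Fin n → FreeOrthogonal n,
      a - algebraMap ℂ _ (counit n a) = ∑ i, ∑ j, (u n i j * y i j - if i = j then y i j else 0) := by
  induction a using FreeOrthogonal.induction with
  | hc c => exact ⟨0, by simp⟩
  | hu i j =>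
    refine ⟨fun k l => if k = i then if l = j then 1 else 0 else 0, ?_⟩
    rw [Finset.sum_eq_single i, Finset.sum_eq_single j]
    · simp [counit_u]
    · intro l _ hl; simp [hl]
    · simp
    · intro k _ hk; simp [hk]
    · simp
  | hadd a b ha hb =>
    obtain ⟨y, hy⟩ := ha
    obtain ⟨z, hz⟩ := hb
    refine ⟨y + z, ?_⟩
    have : a + b - algebraMap ℂ _ (counit n (a + b)) =
        (a - algebraMap ℂ _ (counit n a)) + (b - algebraMap ℂ _ (counit n b)) := by
      rw [map_add, map_add]; abel
    rw [this, hy, hz, ← Finset.sum_add_distrib]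
    refine Finset.sum_congr rfl fun i _ => ?_
    rw [← Finset.sum_add_distrib]
    refine Finset.sum_congr rfl fun j _ => ?_
    simp only [Pi.add_apply, mul_add]
    split_ifs <;> abel
  | hmul a b ha hb =>
    obtain ⟨y, hy⟩ := ha
    obtain ⟨z, hz⟩ := hb
    refine ⟨fun i j => y i j * b + z i j * algebraMap ℂ _ (counit n a), ?_⟩
    have : a * b - algebraMap ℂ _ (counit n (a * b)) =
        (a - algebraMap ℂ _ (counit n a)) * b +
          (b - algebraMap ℂ _ (counit n b)) * algebraMap ℂ _ (counit n a) := by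
      rw [map_mul, map_mul, sub_mul, sub_mul, ← Algebra.commutes _ b, ← Algebra.commutes _ (algebraMap ℂ (FreeOrthogonal n) _)]
      abel
    rw [this, hy, hz, Finset.sum_mul, Finset.sum_mul, ← Finset.sum_add_distrib]
    refine Finset.sum_congr rfl fun i _ => ?_
    rw [Finset.sum_mul, Finset.sum_mul, ← Finset.sum_add_distrib]
    refine Finset.sum_congr rfl fun j _ => ?_
    simp only [mul_add, sub_mul, mul_assoc]
    split_ifs <;> (try simp only [zero_mul]) <;> abel

/-- The linear map `c ↦ c + u cᵗ`. -/
def foxMap (n : ℕ) :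
    (Fin n → Fin n → FreeOrthogonal n) →ₗ[ℂ] (Fin n → Fin n → FreeOrthogonal n) where
  toFun c i j := c i j + ∑ k, u n i k * c j k
  map_add' c d := by
    ext i j
    simp only [Pi.add_apply, mul_add, Finset.sum_add_distrib]
    abel
  map_smul' r c := by
    ext i j
    simp [Finset.smul_sum]

/-- The matrix with entry `x` at `(i, j)`. -/
def entry (i j : Fin n) : FreeOrthogonal n →ₗ[ℂ] (Fin n → Fin n → FreeOrthogonal n) :=
  LinearMap.single ℂ (fun _ => Fin n → FreeOrthogonal n) i ∘ₗ
    LinearMap.single ℂ (fun _ => FreeOrthogonal n) j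

theorem entry_apply (i j k l : Fin n) (x : FreeOrthogonal n) :
    entry i j x k l = if k = i then if l = j then x else 0 else 0 := by
  simp only [entry, LinearMap.comp_apply, LinearMap.single_apply, Pi.single_apply]
  split_ifs <;> simp [*]

theorem sum_entry (y : Fin n → Fin n → FreeOrthogonal n) : ∑ i, ∑ j, entry i j (y i j) = y := by
  ext k l
  simp [Finset.sum_apply, entry_apply]

theorem foxMap_entry (i j : Fin n) (x : FreeOrthogonal n) :
    foxMap n (entry i j x) = entry i j x + ∑ k, entry k i (u n k j * x) := by
  ext k l
  simp only [foxMap, LinearMap.coe_mk, AddHom.coe_mk, Pi.add_apply, Finset.sum_apply, entry_apply]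
  congr 1
  simp

/-- The right-hand side is the Fox derivative of a row relation, just as `foxMap_entry` gives that
of a column relation. Both therefore vanish in the cokernel, which makes `foxRep` well defined. -/
theorem foxMap_sum_entry (i k : Fin n) (x : FreeOrthogonal n) :
    foxMap n (∑ j, entry i j (u n k j * x)) = ∑ j, entry i j (u n k j * x) + entry k i x := by
  rw [map_sum]
  simp only [foxMap_entry, Finset.sum_add_distrib]
  congr 1
  rw [Finset.sum_comm]
  simp only [← map_sum, sum_row_mul]
  rw [Finset.sum_eq_single k]
  · simp
  · intro l _ hl; simp [hl]
  · simp

/-- The cokernel of `c ↦ c + u cᵗ`. -/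
abbrev FoxCokernel (n : ℕ) : Type :=
  (Fin n → Fin n → FreeOrthogonal n) ⧸ LinearMap.range (foxMap n)

/-- The operators by which the generators act on `A × FoxCokernel`. -/
def foxOp (i j : Fin n) : Module.End ℂ (FreeOrthogonal n × FoxCokernel n) :=
  (LinearMap.mulLeft ℂ (u n i j) ∘ₗ LinearMap.fst ℂ _ _).prod
    ((LinearMap.range (foxMap n)).mkQ ∘ₗ entry i j ∘ₗ LinearMap.fst ℂ _ _ +
      (if i = j then 1 else 0 : ℂ) • LinearMap.snd ℂ _ _)

theorem foxOp_apply (i j : Fin n) (x : FreeOrthogonal n) (c : FoxCokernel n) :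
    foxOp i j (x, c) = (u n i j * x,
      (LinearMap.range (foxMap n)).mkQ (entry i j x) + (if i = j then 1 else 0 : ℂ) • c) := rfl

theorem mkQ_foxMap (c : Fin n → Fin n → FreeOrthogonal n) :
    (LinearMap.range (foxMap n)).mkQ (foxMap n c) = 0 := by
  simp

theorem prod_sum {ι M N : Type*} [AddCommMonoid M] [AddCommMonoid N] (s : Finset ι) (f : ι → M)
    (g : ι → N) : ∑ i ∈ s, ((f i, g i) : M × N) = (∑ i ∈ s, f i, ∑ i ∈ s, g i) := by
  ext <;> simp [Prod.fst_sum, Prod.snd_sum]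

/-- The representation of `A` on `A × FoxCokernel` given by the universal derivation. -/
def foxRep (n : ℕ) : FreeOrthogonal n →ₐ[ℂ] Module.End ℂ (FreeOrthogonal n × FoxCokernel n) :=
  lift foxOp
    (fun i k => by
      refine LinearMap.ext fun p => ?_
      obtain ⟨x, c⟩ := p
      simp only [LinearMap.sum_apply, Module.End.mul_apply, foxOp_apply, prod_sum, sum_row_mul]
      have h1 := mkQ_foxMap (∑ j, entry i j (u n k j * x))
      rw [foxMap_sum_entry, map_add, map_sum] at h1
      have h2 : ∑ j, ((LinearMap.range (foxMap n)).mkQ (entry i j (u n k j * x)) +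
          (if i = j then 1 else 0 : ℂ) • ((LinearMap.range (foxMap n)).mkQ (entry k j x) +
            (if k = j then 1 else 0 : ℂ) • c)) = (if i = k then 1 else 0 : ℂ) • c := by
        simp only [Finset.sum_add_distrib, smul_add, ite_smul, one_smul, zero_smul,
          Finset.sum_ite_eq, Finset.mem_univ, if_true]
        rw [← add_assoc, h1, zero_add]
        simp [eq_comm]
      rw [h2]
      split_ifs <;> simp)
    (fun i k => by
      refine LinearMap.ext fun p => ?_
      obtain ⟨x, c⟩ := p
      simp only [LinearMap.sum_apply, Module.End.mul_apply, foxOp_apply, prod_sum, sum_col_mul]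
      have h1 := mkQ_foxMap (entry i k x)
      rw [foxMap_entry, map_add, map_sum] at h1
      have h2 : ∑ j, ((LinearMap.range (foxMap n)).mkQ (entry j i (u n j k * x)) +
          (if j = i then 1 else 0 : ℂ) • ((LinearMap.range (foxMap n)).mkQ (entry j k x) +
            (if j = k then 1 else 0 : ℂ) • c)) = (if i = k then 1 else 0 : ℂ) • c := by
        simp only [Finset.sum_add_distrib, smul_add, ite_smul, one_smul, zero_smul,
          Finset.sum_ite_eq', Finset.mem_univ, if_true]
        rw [← add_assoc, add_comm (∑ _, _), h1, zero_add]
      rw [h2]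
      split_ifs <;> simp)

theorem foxRep_u (i j : Fin n) : foxRep n (u n i j) = foxOp i j := lift_u _ _ _ _ _

theorem fst_foxRep (a : FreeOrthogonal n) (p : FreeOrthogonal n × FoxCokernel n) :
    (foxRep n a p).1 = a * p.1 := by
  induction a using FreeOrthogonal.induction generalizing p with
  | hc c => simp [Algebra.smul_def]
  | hu i j => rw [foxRep_u]; rfl
  | hadd a b ha hb => simp [ha, hb, add_mul]
  | hmul a b ha hb => simp [ha, hb, mul_assoc]

/-- The relations between the elements `u_ij - δ_ij`. -/
theorem exists_of_sum_eq_zero {y : Fin n → Fin n → FreeOrthogonal n}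
    (h : ∑ i, ∑ j, (u n i j * y i j - if i = j then y i j else 0) = 0) :
    ∃ c : Fin n → Fin n → FreeOrthogonal n, ∀ i j, y i j = c i j + ∑ k, u n i k * c j k := by
  -- On the vector `(1, 0)`, the second coordinate of the action of `(u_ij - δ_ij) y` is the class
  -- of the matrix with single entry `y`. A relation thus gives a matrix whose class is zero.
  have h1 : ∑ i, ∑ j, (foxRep n (u n i j * y i j - if i = j then y i j else 0)) (1, 0) = 0 := by
    simp only [← LinearMap.sum_apply, ← map_sum, h, map_zero, LinearMap.zero_apply]
  have h2 : ∀ i j, (foxRep n (u n i j * y i j - if i = j then y i j else 0) (1, 0)).2 =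
      (LinearMap.range (foxMap n)).mkQ (entry i j (y i j)) := fun i j => by
    obtain ⟨d, hd⟩ : ∃ d, foxRep n (y i j) (1, 0) = (y i j, d) :=
      ⟨_, Prod.ext (by rw [fst_foxRep, mul_one]) rfl⟩
    rw [map_sub, map_mul, LinearMap.sub_apply, Module.End.mul_apply, hd, foxRep_u, foxOp_apply]
    split_ifs
    · simp [hd]
    · simp
  have h3 := congrArg Prod.snd h1
  simp only [Prod.snd_sum, h2, Prod.snd_zero, ← map_sum, sum_entry] at h3
  obtain ⟨c, hc⟩ := (Submodule.Quotient.mk_eq_zero _).1 h3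
  exact ⟨c, fun i j => by rw [← hc]; rfl⟩

/-- The antipode of `A_o(n)`, which exchanges `u_ij` and `u_ji`. -/
def antipode (n : ℕ) : FreeOrthogonal n →ₐ[ℂ] (FreeOrthogonal n)ᵐᵒᵖ :=
  lift (fun i j => MulOpposite.op (u n j i))
    (fun i k => by
      simp only [← MulOpposite.op_mul, ← Finset.op_sum, sum_col, eq_comm (a := k)]
      split_ifs <;> simp)
    (fun i k => by
      simp only [← MulOpposite.op_mul, ← Finset.op_sum, sum_row, eq_comm (a := k)]
      split_ifs <;> simp)

theorem antipode_u (i j : Fin n) : antipode n (u n i j) = MulOpposite.op (u n j i) :=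
  lift_u _ _ _ _ _

theorem antipode_antipode (a : FreeOrthogonal n) :
    (antipode n (antipode n a).unop).unop = a := by
  induction a using FreeOrthogonal.induction with
  | hc c => simp [MulOpposite.algebraMap_apply]
  | hu i j => simp [antipode_u]
  | hadd a b ha hb => simp [ha, hb]
  | hmul a b ha hb => simp [ha, hb]

theorem counit_antipode (a : FreeOrthogonal n) : counit n (antipode n a).unop = counit n a := by
  induction a using FreeOrthogonal.induction with
  | hc c => simp [MulOpposite.algebraMap_apply]
  | hu i j => simp [antipode_u, counit_u, eq_comm]
  | hadd a b ha hb => simp [ha, hb]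
  | hmul a b ha hb => simp [ha, hb, mul_comm]

/-- The involutive antipode turns right multiplication into left multiplication and transposes
indices. The remaining right-handed statements follow in the same way. -/
theorem eq_zero_of_invariant_right (hn : 2 ≤ n) {x : FreeOrthogonal n}
    (h : ∀ i j, x * u n i j = if i = j then x else 0) : x = 0 := by
  have h1 : (antipode n x).unop = 0 := eq_zero_of_invariant hn fun i j => by
    have h2 := congrArg (fun y => (antipode n y).unop) (h j i)
    simp only [map_mul, antipode_u, MulOpposite.unop_mul, MulOpposite.unop_op] at h2
    rw [h2]
    simp only [eq_comm (a := j)]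
    split_ifs <;> simp
  rw [← antipode_antipode x, h1]
  simp

theorem exists_of_cocycle_right (hn : 2 ≤ n) {c : Fin n → Fin n → FreeOrthogonal n}
    (h : ∀ i j, c i j + ∑ k, c k i * u n k j = 0) :
    ∃ x, ∀ i j, c i j = x * u n i j - if i = j then x else 0 := by
  obtain ⟨x, hx⟩ := exists_of_cocycle hn (c := fun i j => (antipode n (c j i)).unop)
    (fun i j => by
      have h2 := congrArg (fun y => (antipode n y).unop) (h j i)
      simpa [antipode_u] using h2)
  refine ⟨(antipode n x).unop, fun i j => ?_⟩
  have h3 := congrArg (fun y => (antipode n y).unop) (hx j i)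
  simp only [antipode_antipode] at h3
  rw [h3]
  simp only [eq_comm (a := j)]
  split_ifs <;> simp [antipode_u]

theorem exists_of_sum_eq_zero_right {y : Fin n → Fin n → FreeOrthogonal n}
    (h : ∑ i, ∑ j, (y i j * u n i j - if i = j then y i j else 0) = 0) :
    ∃ c : Fin n → Fin n → FreeOrthogonal n, ∀ i j, y i j = c i j + ∑ k, c k i * u n k j := by
  obtain ⟨c, hc⟩ := exists_of_sum_eq_zero (y := fun i j => (antipode n (y j i)).unop) (by
    have h2 := congrArg (fun y => (antipode n y).unop) h
    simp only [map_sum, map_sub, map_mul, antipode_u, map_zero, MulOpposite.unop_zero,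
      Finset.unop_sum, MulOpposite.unop_sub, MulOpposite.unop_mul, MulOpposite.unop_op] at h2
    rw [Finset.sum_comm]
    refine Eq.trans ?_ h2
    refine Finset.sum_congr rfl fun i _ => Finset.sum_congr rfl fun j _ => ?_
    simp only [eq_comm (a := j)]
    split_ifs <;> simp)
  refine ⟨fun i j => (antipode n (c j i)).unop, fun i j => ?_⟩
  have h3 := congrArg (fun y => (antipode n y).unop) (hc j i)
  simp only [antipode_antipode] at h3
  rw [h3]
  simp [antipode_u]

theorem exists_of_counit_eq_zero_right {a : FreeOrthogonal n} (ha : counit n a = 0) :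
    ∃ y : Fin n → Fin n → FreeOrthogonal n,
      a = ∑ i, ∑ j, (y i j * u n i j - if i = j then y i j else 0) := by
  obtain ⟨y, hy⟩ := exists_of_counit_eq_zero (antipode n a).unop
  rw [counit_antipode, ha, map_zero, sub_zero] at hy
  refine ⟨fun i j => (antipode n (y j i)).unop, ?_⟩
  have h3 := congrArg (fun y => (antipode n y).unop) hy
  simp only [antipode_antipode] at h3
  rw [h3, Finset.sum_comm]
  simp only [map_sum, map_sub, map_mul, antipode_u, Finset.unop_sum, MulOpposite.unop_sub,
    MulOpposite.unop_mul, MulOpposite.unop_op]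
  refine Finset.sum_congr rfl fun i _ => Finset.sum_congr rfl fun j _ => ?_
  simp only [eq_comm (a := j)]
  split_ifs <;> simp

end FreeOrthogonal

/-! ### Projective resolutions from exact sequences, and splicing -/

namespace CategoryTheory.ProjectiveResolution

universe w₁ w₂

variable {C : Type w₁} [Category.{w₂} C] [Abelian C]

/-- A projective resolution from an exact augmented complex of projective objects. -/
def ofExact {Z : C} (K : ChainComplex C ℕ) (hK : ∀ i, Projective (K.X i)) (p : K.X 0 ⟶ Z)
    (w : K.d 1 0 ≫ p = 0) (hp : Epi p) (h0 : (ShortComplex.mk _ _ w).Exact)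
    (hexact : ∀ i, (ShortComplex.mk _ _ (K.d_comp_d (i + 2) (i + 1) i)).Exact) :
    ProjectiveResolution Z where
  complex := K
  projective := hK
  π := (ChainComplex.toSingle₀Equiv _ _).symm ⟨p, w⟩
  quasiIso := ⟨fun i => by
    cases i with
    | zero =>
      rw [ChainComplex.quasiIsoAt₀_iff, ShortComplex.quasiIso_iff_of_zeros']
      · refine (ShortComplex.exact_and_epi_g_iff_of_iso (S₂ := ShortComplex.mk _ _ w) ?_).2 ⟨h0, hp⟩
        refine ShortComplex.isoMk (Iso.refl _) (Iso.refl _) (Iso.refl _) ?_ ?_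
        · exact (Category.id_comp _).trans (Category.comp_id _).symm
        · refine (Category.id_comp _).trans (Eq.trans ?_ (Category.comp_id _).symm)
          exact (ChainComplex.toSingle₀Equiv_symm_apply_f_zero p w).symm
      · exact K.shape _ _ (by simp)
      all_goals rfl
    | succ i =>
      rw [quasiIsoAt_iff_exactAt']
      · rw [HomologicalComplex.exactAt_iff' _ (i + 2) (i + 1) i (by simp) (by simp)]
        exact hexact i
      · apply ChainComplex.exactAt_succ_single_obj⟩

theorem ofExact_π_f_zero {Z : C} (K : ChainComplex C ℕ) (hK) (p : K.X 0 ⟶ Z) (w hp h0 hexact) :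
    (ofExact K hK p w hp h0 hexact).π.f 0 = p := by
  simp [ofExact]

/-- The augmentation of a projective resolution. -/
def augmentation {Z : C} (P : ProjectiveResolution Z) : P.complex.X 0 ⟶ Z := P.π.f 0

instance {Z : C} (P : ProjectiveResolution Z) : Epi P.augmentation :=
  inferInstanceAs (Epi (P.π.f 0))

theorem d_augmentation {Z : C} (P : ProjectiveResolution Z) :
    P.complex.d 1 0 ≫ P.augmentation = 0 := P.complex_d_comp_π_f_zero

theorem d_augmentation_comp {Z W : C} (P : ProjectiveResolution Z) (f : Z ⟶ W) :
    P.complex.d 1 0 ≫ P.augmentation ≫ f = 0 := by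
  rw [← Category.assoc, d_augmentation, Limits.zero_comp]

theorem exact_augmentation {Z : C} (P : ProjectiveResolution Z) :
    (ShortComplex.mk _ _ P.d_augmentation).Exact :=
  ShortComplex.exact_of_g_is_cokernel _ P.isColimitCokernelCofork

section Splice

variable {S : ShortComplex C} (hS : S.ShortExact) (P : ProjectiveResolution S.X₁)

/-- The complex obtained by splicing a projective resolution of `S.X₁` with `S.X₂`. -/
abbrev spliceComplex : ChainComplex C ℕ :=
  P.complex.augment (P.augmentation ≫ S.f) (P.d_augmentation_comp S.f)

include hS in
-- At the seam, composing the augmentation with the monomorphism `S.f` does not change its kernel.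
theorem splice_exact (i : ℕ) :
    (ShortComplex.mk _ _ ((spliceComplex P).d_comp_d (i + 2) (i + 1) i)).Exact := by
  rcases i with _ | i
  · have := hS.mono_f
    exact (ShortComplex.exact_iff_of_epi_of_isIso_of_mono
      (S₁ := ShortComplex.mk _ _ P.d_augmentation)
      (S₂ := ShortComplex.mk _ _ (P.d_augmentation_comp S.f))
      { τ₁ := 𝟙 _, τ₂ := 𝟙 _, τ₃ := S.f }).1 P.exact_augmentation
  · exact P.exact_succ i

/-- A projective resolution of the kernel of an epimorphism from a projective object gives a
projective resolution of the target. -/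
def splice [Projective S.X₂] : ProjectiveResolution S.X₃ :=
  ofExact (spliceComplex P)
    (fun i => match i with
      | 0 => (inferInstance : Projective S.X₂)
      | i + 1 => (inferInstance : Projective (P.complex.X i)))
    S.g
    (by
      change (P.augmentation ≫ S.f) ≫ S.g = 0
      rw [Category.assoc, S.zero, Limits.comp_zero])
    hS.epi_g
    (by
      exact (ShortComplex.exact_iff_of_epi_of_isIso_of_mono
        (S₁ := ShortComplex.mk (P.augmentation ≫ S.f) S.g
          (by rw [Category.assoc, S.zero, Limits.comp_zero]))
        (S₂ := S) { τ₁ := P.augmentation, τ₂ := 𝟙 _, τ₃ := 𝟙 _ }).2 hS.exact)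
    (splice_exact hS P)

end Splice

section FourTerm

variable {P₀ P₁ P₂ P₃ Z : C} (d₁ : P₁ ⟶ P₀) (d₂ : P₂ ⟶ P₁) (d₃ : P₃ ⟶ P₂)

/-- The complex `P₃ ⟶ P₂ ⟶ P₁ ⟶ P₀`. -/
def fourTerm (h₁ : d₂ ≫ d₁ = 0) (h₂ : d₃ ≫ d₂ = 0) : ChainComplex C ℕ :=
  ChainComplex.augment (ChainComplex.augment (ChainComplex.augment (ChainComplex.augment
    ({ X := fun _ => 0, d := fun _ _ => 0 } : ChainComplex C ℕ)
    (0 : (0 : C) ⟶ P₃) Limits.comp_zero) d₃ Limits.zero_comp) d₂ h₂) d₁ h₁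

variable {d₁ d₂ d₃}

theorem isZero_fourTerm (h₁ : d₂ ≫ d₁ = 0) (h₂ : d₃ ≫ d₂ = 0) (i : ℕ) (hi : 3 < i) :
    Limits.IsZero ((fourTerm d₁ d₂ d₃ h₁ h₂).X i) := by
  match i, hi with
  | i + 4, _ => exact Limits.isZero_zero C

/-- A projective resolution from an exact sequence `0 ⟶ P₃ ⟶ P₂ ⟶ P₁ ⟶ P₀ ⟶ Z ⟶ 0`. -/
def ofFourTerm [Projective P₀] [Projective P₁] [Projective P₂] [Projective P₃]
    {p : P₀ ⟶ Z} {h₁ : d₂ ≫ d₁ = 0} {h₂ : d₃ ≫ d₂ = 0} {w : d₁ ≫ p = 0} (hp : Epi p)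
    (e₀ : (ShortComplex.mk _ _ w).Exact) (e₁ : (ShortComplex.mk _ _ h₁).Exact)
    (e₂ : (ShortComplex.mk _ _ h₂).Exact) (e₃ : Mono d₃) : ProjectiveResolution Z :=
  ofExact (fourTerm d₁ d₂ d₃ h₁ h₂)
    (fun i => match i with
      | 0 => (inferInstance : Projective P₀)
      | 1 => (inferInstance : Projective P₁)
      | 2 => (inferInstance : Projective P₂)
      | 3 => (inferInstance : Projective P₃)
      | _ + 4 => (inferInstance : Projective (0 : C)))
    p w hp e₀
    (fun i => match i with
      | 0 => e₁
      | 1 => e₂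
      | 2 => (ShortComplex.exact_iff_mono (ShortComplex.mk (0 : (0 : C) ⟶ P₃) d₃
          Limits.zero_comp) rfl).2 e₃
      | 3 => ShortComplex.exact_of_isZero_X₂ _ (Limits.isZero_zero C)
      | _ + 4 => ShortComplex.exact_of_isZero_X₂ _ (Limits.isZero_zero C))

theorem isZero_ofFourTerm [Projective P₀] [Projective P₁] [Projective P₂] [Projective P₃]
    {p : P₀ ⟶ Z} {h₁ : d₂ ≫ d₁ = 0} {h₂ : d₃ ≫ d₂ = 0} {w : d₁ ≫ p = 0} (hp : Epi p)
    (e₀ : (ShortComplex.mk _ _ w).Exact) (e₁ : (ShortComplex.mk _ _ h₁).Exact)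
    (e₂ : (ShortComplex.mk _ _ h₂).Exact) (e₃ : Mono d₃) (i : ℕ) (hi : 3 < i) :
    Limits.IsZero ((ofFourTerm hp e₀ e₁ e₂ e₃).complex.X i) :=
  isZero_fourTerm h₁ h₂ i hi

end FourTerm

end CategoryTheory.ProjectiveResolution

/-! ### The resolution of the trivial module -/

namespace FreeOrthogonal

variable {n : ℕ}

/-- The index set of the matrix of generators, in an arbitrary universe. -/
abbrev Index (n : ℕ) : Type v := ULift.{v} (Fin n × Fin n)

theorem map_eq_sum {R M : Type*} [Ring R] [AddCommGroup M] [Module R M]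
    (f : (Index.{v} n → R) →ₗ[R] M) (y : Index.{v} n → R) :
    f y = ∑ i, ∑ j, y ⟨i, j⟩ • f (Pi.single ⟨i, j⟩ 1) := by
  conv_lhs => rw [← Finset.univ_sum_single y, map_sum]
  rw [← Equiv.ulift.symm.sum_comp, Fintype.sum_prod_type]
  refine Finset.sum_congr rfl fun i _ => Finset.sum_congr rfl fun j _ => ?_
  rw [← map_smul, ← Pi.single_smul, smul_eq_mul, mul_one]
  rfl

/-- The first differential of the resolution of the trivial module. -/
def dOne (n : ℕ) : (Index.{v} n → FreeOrthogonal n) →ₗ[FreeOrthogonal n]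
    (PUnit.{v + 1} → FreeOrthogonal n) where
  toFun y _ := ∑ i, ∑ j, (y ⟨i, j⟩ * u n i j - if i = j then y ⟨i, j⟩ else 0)
  map_add' x y := by
    ext
    simp only [Pi.add_apply, ← Finset.sum_add_distrib]
    refine Finset.sum_congr rfl fun i _ => Finset.sum_congr rfl fun j _ => ?_
    split_ifs <;> simp only [add_mul] <;> abel
  map_smul' a y := by
    ext
    simp only [Pi.smul_apply, smul_eq_mul, RingHom.id_apply, Finset.mul_sum]
    refine Finset.sum_congr rfl fun i _ => Finset.sum_congr rfl fun j _ => ?_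
    split_ifs <;> simp only [mul_sub, mul_assoc, mul_zero]

/-- The second differential of the resolution of the trivial module. -/
def dTwo (n : ℕ) : (Index.{v} n → FreeOrthogonal n) →ₗ[FreeOrthogonal n]
    (Index.{v} n → FreeOrthogonal n) where
  toFun c p := c p + ∑ k, c ⟨k, p.down.1⟩ * u n k p.down.2
  map_add' x y := by
    ext
    simp only [Pi.add_apply, add_mul, Finset.sum_add_distrib]
    abel
  map_smul' a y := by
    ext
    simp only [Pi.smul_apply, smul_eq_mul, RingHom.id_apply, Finset.mul_sum, mul_add, mul_assoc]

/-- The third differential of the resolution of the trivial module. -/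
def dThree (n : ℕ) : (PUnit.{v + 1} → FreeOrthogonal n) →ₗ[FreeOrthogonal n]
    (Index.{v} n → FreeOrthogonal n) where
  toFun x p := x ⟨⟩ * u n p.down.1 p.down.2 - if p.down.1 = p.down.2 then x ⟨⟩ else 0
  map_add' x y := by
    ext p
    simp only [Pi.add_apply, add_mul]
    split_ifs <;> abel
  map_smul' a y := by
    ext p
    simp only [Pi.smul_apply, smul_eq_mul, RingHom.id_apply]
    split_ifs <;> simp only [mul_sub, mul_assoc, mul_zero]

/-- The augmentation of the resolution of the trivial module. -/
def augment (n : ℕ) : (PUnit.{v + 1} → FreeOrthogonal n) →ₗ[FreeOrthogonal n]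
    trivialLeft.{v} (counit n) where
  toFun x := ULift.up.{v} (counit n (x ⟨⟩))
  map_add' x y := by
    simp only [Pi.add_apply, map_add]
    rfl
  map_smul' a y := by
    simp only [Pi.smul_apply, smul_eq_mul, map_mul]
    rfl

theorem augment_dOne (y : Index.{v} n → FreeOrthogonal n) : augment n (dOne n y) = 0 := by
  have h : counit n (∑ i, ∑ j, (y ⟨i, j⟩ * u n i j - if i = j then y ⟨i, j⟩ else 0)) = 0 := by
    simp only [map_sum, map_sub, map_mul, counit_u]
    refine Finset.sum_eq_zero fun i _ => Finset.sum_eq_zero fun j _ => ?_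
    split_ifs <;> simp
  exact congrArg ULift.up.{v} h

/-- The row relations turn the quadratic term into the trace of `c`, which cancels the subtracted
trace; the two terms linear in `u` cancel each other. -/
theorem dOne_dTwo (c : Index.{v} n → FreeOrthogonal n) : dOne n (dTwo n c) = 0 := by
  have h (i j : Fin n) : ((c ⟨i, j⟩ + ∑ k, c ⟨k, i⟩ * u n k j) * u n i j -
      if i = j then c ⟨i, j⟩ + ∑ k, c ⟨k, i⟩ * u n k j else 0) =
      c ⟨i, j⟩ * u n i j + (∑ k, c ⟨k, i⟩ * (u n k j * u n i j)) -
        (if i = j then c ⟨i, j⟩ else 0) - if i = j then ∑ k, c ⟨k, i⟩ * u n k j else 0 := by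
    split_ifs <;> simp only [add_mul, Finset.sum_mul, mul_assoc] <;> abel
  ext
  change ∑ i, ∑ j, ((c ⟨i, j⟩ + ∑ k, c ⟨k, i⟩ * u n k j) * u n i j -
      if i = j then c ⟨i, j⟩ + ∑ k, c ⟨k, i⟩ * u n k j else 0) = 0
  simp only [h, Finset.sum_sub_distrib, Finset.sum_add_distrib]
  have h1 (i : Fin n) : ∑ j, ∑ k, c ⟨k, i⟩ * (u n k j * u n i j) = c ⟨i, i⟩ := by
    rw [Finset.sum_comm]
    simp only [← Finset.mul_sum, sum_row]
    simp
  simp only [h1, Finset.sum_ite_eq, Finset.mem_univ, if_true]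
  rw [Finset.sum_comm (f := fun i k => c ⟨k, i⟩ * u n k i)]
  abel

theorem dTwo_dThree (x : PUnit.{v + 1} → FreeOrthogonal n) : dTwo n (dThree n x) = 0 := by
  ext ⟨i, j⟩
  change (x ⟨⟩ * u n i j - if i = j then x ⟨⟩ else 0) +
    ∑ k, (x ⟨⟩ * u n k i - if k = i then x ⟨⟩ else 0) * u n k j = 0
  simp only [sub_mul, Finset.sum_sub_distrib, mul_assoc, ← Finset.mul_sum, sum_col, ite_mul,
    zero_mul, Finset.sum_ite_eq', Finset.mem_univ, if_true, mul_ite, mul_one, mul_zero]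
  abel

instance projective_pi (R : Type) [Ring R] (ι : Type v) [Finite ι] :
    Projective (ModuleCat.of R (ι → R)) :=
  have := Module.Projective.of_basis (Pi.basisFun R ι)
  inferInstance

/-- The resolution of the trivial module of `A_o(n)`. -/
def resolution (hn : 2 ≤ n) : ProjectiveResolution (trivialLeft.{v} (counit n)) :=
  ProjectiveResolution.ofFourTerm
    (d₁ := ModuleCat.ofHom (dOne n)) (d₂ := ModuleCat.ofHom (dTwo n))
    (d₃ := ModuleCat.ofHom (dThree n)) (p := ModuleCat.homEquiv.symm (augment n))
    (h₁ := by ext1; exact LinearMap.ext dOne_dTwo)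
    (h₂ := by ext1; exact LinearMap.ext dTwo_dThree)
    (w := by ext1; exact LinearMap.ext augment_dOne)
    ((ModuleCat.epi_iff_surjective _).2 fun z =>
      ⟨fun _ => algebraMap ℂ _ (ULift.down.{v} z), by
        exact congrArg ULift.up.{v} ((counit n).commutes (ULift.down.{v} z))⟩)
    ((ShortComplex.moduleCat_exact_iff _).2 fun x hx => by
      obtain ⟨y, hy⟩ := exists_of_counit_eq_zero_right (a := x ⟨⟩) (congrArg ULift.down.{v} hx)
      exact ⟨fun p => y p.down.1 p.down.2, funext fun _ => hy.symm⟩)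
    ((ShortComplex.moduleCat_exact_iff _).2 fun y hy => by
      obtain ⟨c, hc⟩ := exists_of_sum_eq_zero_right (y := fun i j => y ⟨i, j⟩) (congrFun hy ⟨⟩)
      exact ⟨fun p => c p.down.1 p.down.2, funext fun p => (hc p.down.1 p.down.2).symm⟩)
    ((ShortComplex.moduleCat_exact_iff _).2 fun c hc => by
      obtain ⟨x, hx⟩ := exists_of_cocycle_right hn (c := fun i j => c ⟨i, j⟩)
        (fun i j => congrFun hc ⟨i, j⟩)
      exact ⟨fun _ => x, funext fun p => (hx p.down.1 p.down.2).symm⟩)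
    ((ModuleCat.mono_iff_ker_eq_bot _).2 (LinearMap.ker_eq_bot'.2 fun x hx => by
      refine funext fun _ => eq_zero_of_invariant_right hn fun i j => ?_
      exact sub_eq_zero.1 (congrFun hx ⟨i, j⟩)))

theorem isZero_resolution (hn : 2 ≤ n) (i : ℕ) (hi : 3 < i) :
    Limits.IsZero ((resolution.{v} hn).complex.X i) :=
  ProjectiveResolution.isZero_ofFourTerm _ _ _ _ _ i hi

end FreeOrthogonal

/-! ### Computation of `Ext(ℂ, M)` from the resolution -/

namespace FreeOrthogonal

open Abelian

attribute [local instance] ModuleCat.moduleOfAlgebraModule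
attribute [local instance] ModuleCat.isScalarTower_of_algebra_moduleCat

variable {n : ℕ}

section Differentials

variable {M : Type*} [AddCommGroup M] [Module (FreeOrthogonal n) M]

theorem map_eq_smul_one (f : (PUnit.{v + 1} → FreeOrthogonal n) →ₗ[FreeOrthogonal n] M)
    (x : PUnit.{v + 1} → FreeOrthogonal n) : f x = x ⟨⟩ • f 1 := by
  rw [← map_smul]
  congr 1
  ext
  simp

/-- On basis vectors, composition with a right-handed differential becomes the corresponding
left-handed map on `M`. This and the two analogous statements below identify the complex `Hom_A(P,
M)`. -/
theorem map_dOne_single (f : (PUnit.{v + 1} → FreeOrthogonal n) →ₗ[FreeOrthogonal n] M)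
    (i j : Fin n) :
    f (dOne n (Pi.single ⟨i, j⟩ 1)) = u n i j • f 1 - if i = j then f 1 else 0 := by
  rw [map_eq_smul_one]
  have h : dOne n (Pi.single (⟨i, j⟩ : Index.{v} n) 1) ⟨⟩ = u n i j - if i = j then 1 else 0 := by
    change ∑ k, ∑ l, ((Pi.single (⟨i, j⟩ : Index.{v} n) 1 : Index.{v} n → FreeOrthogonal n) ⟨k, l⟩ *
      u n k l - if k = l then (Pi.single (⟨i, j⟩ : Index.{v} n) 1 : Index.{v} n → _) ⟨k, l⟩ else 0) = _
    rw [Finset.sum_eq_single i, Finset.sum_eq_single j]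
    · simp
    · rintro l - hl
      simp [ULift.ext_iff, hl]
    · simp
    · rintro k - hk
      refine Finset.sum_eq_zero fun l _ => ?_
      simp [ULift.ext_iff, hk]
    · simp
  rw [h]
  split_ifs <;> simp [sub_smul]

theorem map_dTwo_single (f : (Index.{v} n → FreeOrthogonal n) →ₗ[FreeOrthogonal n] M)
    (i j : Fin n) :
    f (dTwo n (Pi.single ⟨i, j⟩ 1)) =
      f (Pi.single ⟨i, j⟩ 1) + ∑ k, u n i k • f (Pi.single ⟨j, k⟩ 1) := by
  have h (k l : Fin n) : dTwo n (Pi.single (⟨i, j⟩ : Index.{v} n) 1) ⟨k, l⟩ =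
      (Pi.single (⟨i, j⟩ : Index.{v} n) 1 : Index.{v} n → FreeOrthogonal n) ⟨k, l⟩ +
        if k = j then u n i l else 0 := by
    change _ + ∑ m, (Pi.single (⟨i, j⟩ : Index.{v} n) 1 : Index.{v} n → FreeOrthogonal n) ⟨m, k⟩ *
      u n m l = _
    congr 1
    simp [Pi.single_apply, ULift.ext_iff, ite_and]
  rw [map_eq_sum f (dTwo n _)]
  simp only [h, add_smul, Finset.sum_add_distrib]
  rw [← map_eq_sum]
  congr 1
  rw [Finset.sum_eq_single j]
  · simp
  · rintro k - hk
    simp [hk]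
  · simp

theorem map_dThree_one (f : (Index.{v} n → FreeOrthogonal n) →ₗ[FreeOrthogonal n] M) :
    f (dThree n 1) = ∑ i, ∑ j, (u n i j • f (Pi.single ⟨i, j⟩ 1) -
      if i = j then f (Pi.single ⟨i, j⟩ 1) else 0) := by
  rw [map_eq_sum]
  refine Finset.sum_congr rfl fun i _ => Finset.sum_congr rfl fun j _ => ?_
  have h : dThree n 1 (⟨i, j⟩ : Index.{v} n) = u n i j - if i = j then 1 else 0 := by
    change (1 : FreeOrthogonal n) * u n i j - (if i = j then 1 else 0) = _
    rw [one_mul]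
  rw [h]
  split_ifs <;> simp [sub_smul]

/-- The linear map from the free module with basis the matrix entries given by a matrix. -/
def ofEntries (c : Fin n → Fin n → M) :
    (Index.{v} n → FreeOrthogonal n) →ₗ[FreeOrthogonal n] M :=
  Fintype.linearCombination (FreeOrthogonal n) fun p : Index.{v} n => c p.down.1 p.down.2

theorem ofEntries_single (c : Fin n → Fin n → M) (i j : Fin n) :
    ofEntries.{v} c (Pi.single ⟨i, j⟩ 1) = c i j := by
  simp [ofEntries, Fintype.linearCombination_apply_single]

/-- The linear map from the free module of rank one given by an element. -/
def ofElement (m : M) : (PUnit.{v + 1} → FreeOrthogonal n) →ₗ[FreeOrthogonal n] M :=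
  Fintype.linearCombination (FreeOrthogonal n) fun _ : PUnit.{v + 1} => m

theorem ofElement_one (m : M) : ofElement.{v} m (1 : PUnit.{v + 1} → FreeOrthogonal n) = m := by
  simp [ofElement, Fintype.linearCombination_apply]

theorem hom_ext_one {f g : (PUnit.{v + 1} → FreeOrthogonal n) →ₗ[FreeOrthogonal n] M}
    (h : f 1 = g 1) : f = g :=
  LinearMap.ext fun x => by rw [map_eq_smul_one f, map_eq_smul_one g, h]

theorem hom_ext_entries {f g : (Index.{v} n → FreeOrthogonal n) →ₗ[FreeOrthogonal n] M}
    (h : ∀ i j, f (Pi.single ⟨i, j⟩ 1) = g (Pi.single ⟨i, j⟩ 1)) : f = g :=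
  LinearMap.ext fun x => by rw [map_eq_sum f, map_eq_sum g]; simp only [h]

end Differentials

section Vanishing

variable (hn : 2 ≤ n) (M : ModuleCat.{v} (FreeOrthogonal n))

include hn

theorem subsingleton_ext_zero
    (h : ∀ m : M, (∀ i j, u n i j • m = if i = j then m else 0) → m = 0) :
    Subsingleton (augCohomology (counit n) 0 M) := by
  refine subsingleton_of_forall_eq 0 fun x => ?_
  obtain ⟨f, hf, rfl⟩ := (resolution.{v} hn).extMk_surjective x 1 rfl
  let g : ModuleCat.of (FreeOrthogonal n) (PUnit.{v + 1} → FreeOrthogonal n) ⟶ M := f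
  have hg : ModuleCat.ofHom (dOne n) ≫ g = 0 := hf
  have h0 : g = 0 := by
    ext1
    refine hom_ext_one (h _ fun i j => ?_)
    rw [← sub_eq_zero, ← map_dOne_single]
    exact LinearMap.congr_fun (congrArg ModuleCat.Hom.hom hg) _
  have h1 : f = 0 := h0
  subst h1
  exact ProjectiveResolution.extMk_zero _ _ _

theorem subsingleton_ext_one
    (h : ∀ c : Fin n → Fin n → M, (∀ i j, c i j + ∑ k, u n i k • c j k = 0) →
      ∃ m, ∀ i j, c i j = u n i j • m - if i = j then m else 0) :
    Subsingleton (augCohomology (counit n) 1 M) := by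
  refine subsingleton_of_forall_eq 0 fun x => ?_
  obtain ⟨f, hf, rfl⟩ := (resolution.{v} hn).extMk_surjective x 2 rfl
  rw [ProjectiveResolution.extMk_eq_zero_iff _ _ _ _ _ 0 rfl]
  let g : ModuleCat.of (FreeOrthogonal n) (Index.{v} n → FreeOrthogonal n) ⟶ M := f
  have hg : ModuleCat.ofHom (dTwo n) ≫ g = 0 := hf
  obtain ⟨m, hm⟩ := h (fun i j => g.hom (Pi.single ⟨i, j⟩ 1)) fun i j => by
    rw [← map_dTwo_single]
    exact LinearMap.congr_fun (congrArg ModuleCat.Hom.hom hg) _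
  refine ⟨ModuleCat.ofHom (ofElement m), ?_⟩
  change ModuleCat.ofHom (dOne n) ≫ ModuleCat.ofHom (ofElement m) = g
  ext1
  refine hom_ext_entries fun i j => ?_
  rw [hm]
  exact (map_dOne_single (ofElement m) i j).trans (by rw [ofElement_one])

theorem subsingleton_ext_two
    (h : ∀ y : Fin n → Fin n → M,
      ∑ i, ∑ j, (u n i j • y i j - if i = j then y i j else 0) = 0 →
      ∃ c : Fin n → Fin n → M, ∀ i j, y i j = c i j + ∑ k, u n i k • c j k) :
    Subsingleton (augCohomology (counit n) 2 M) := by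
  refine subsingleton_of_forall_eq 0 fun x => ?_
  obtain ⟨f, hf, rfl⟩ := (resolution.{v} hn).extMk_surjective x 3 rfl
  rw [ProjectiveResolution.extMk_eq_zero_iff _ _ _ _ _ 1 rfl]
  let g : ModuleCat.of (FreeOrthogonal n) (Index.{v} n → FreeOrthogonal n) ⟶ M := f
  have hg : ModuleCat.ofHom (dThree n) ≫ g = 0 := hf
  obtain ⟨c, hc⟩ := h (fun i j => g.hom (Pi.single ⟨i, j⟩ 1)) (by
    rw [← map_dThree_one]
    exact LinearMap.congr_fun (congrArg ModuleCat.Hom.hom hg) _)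
  refine ⟨ModuleCat.ofHom (ofEntries c), ?_⟩
  change ModuleCat.ofHom (dTwo n) ≫ ModuleCat.ofHom (ofEntries c) = g
  ext1
  refine hom_ext_entries fun i j => ?_
  rw [hc]
  exact (map_dTwo_single (ofEntries c) i j).trans (by simp only [ofEntries_single])

theorem subsingleton_ext_of_lt {i : ℕ} (hi : 3 < i) :
    Subsingleton (augCohomology (counit n) i M) := by
  refine subsingleton_of_forall_eq 0 fun x => ?_
  obtain ⟨f, hf, rfl⟩ := (resolution.{v} hn).extMk_surjective x (i + 1) rfl
  have h1 : f = 0 :=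
    (isZero_resolution hn i hi).eq_of_src _ _
  subst h1
  exact ProjectiveResolution.extMk_zero _ _ _

end Vanishing

section Top

variable (hn : 2 ≤ n) (M : ModuleCat.{v} (FreeOrthogonal n))

theorem d_four_three_comp (f : (resolution.{v} hn).complex.X 3 ⟶ M) :
    (resolution.{v} hn).complex.d 4 3 ≫ f = 0 :=
  (isZero_resolution hn 4 (by norm_num)).eq_of_src _ _

/-- The cochain of degree three given by an element of the module. -/
def topCochain (m : M) : (resolution.{v} hn).complex.X 3 ⟶ M :=
  ModuleCat.ofHom (ofElement.{v} m)

variable {M} in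
theorem eq_topCochain (f : ModuleCat.of (FreeOrthogonal n) (PUnit.{v + 1} → FreeOrthogonal n) ⟶ M)
    {m : M} (h : f.hom 1 = m) : topCochain hn M m = f :=
  ModuleCat.hom_ext (hom_ext_one ((ofElement_one m).trans h.symm))

theorem topCochain_add (m m' : M) :
    topCochain hn M (m + m') = topCochain hn M m + topCochain hn M m' :=
  eq_topCochain hn (topCochain hn M m + topCochain hn M m')
    (congrArg₂ (· + ·) (ofElement_one.{v} m) (ofElement_one.{v} m'))

/-- The class in `Ext³` of an element of the module. -/
def topClass (m : M) : augCohomology (counit n) 3 M :=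
  (resolution.{v} hn).extMk (topCochain hn M m) 4 rfl (d_four_three_comp hn M _)

variable {M}

theorem topCochain_comp {M' : ModuleCat.{v} (FreeOrthogonal n)} (f : M ⟶ M') (m : M) :
    topCochain hn M m ≫ f = topCochain hn M' (f.hom m) :=
  (eq_topCochain hn (topCochain hn M m ≫ f) (congrArg f.hom (ofElement_one.{v} m))).symm

theorem topClass_surjective : Function.Surjective (topClass hn M) := fun x => by
  obtain ⟨f, hf, rfl⟩ := (resolution.{v} hn).extMk_surjective x 4 rfl
  obtain ⟨m, rfl⟩ : ∃ m, topCochain hn M m = f := ⟨_, eq_topCochain hn f rfl⟩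
  exact ⟨m, rfl⟩

/-- Since the resolution stops in degree three, every element is a cocycle and `Ext³(ℂ, M)` is the
cokernel of the last map, that is `M / (ker ε) M`. -/
theorem topClass_eq_zero_iff (m : M) : topClass hn M m = 0 ↔
    ∃ y : Fin n → Fin n → M, m = ∑ i, ∑ j, (u n i j • y i j - if i = j then y i j else 0) := by
  unfold topClass
  rw [ProjectiveResolution.extMk_eq_zero_iff _ _ _ _ _ 2 rfl]
  constructor
  · rintro ⟨f, hf⟩
    let g : ModuleCat.of (FreeOrthogonal n) (Index.{v} n → FreeOrthogonal n) ⟶ M := f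
    have hg : ModuleCat.ofHom (dThree n) ≫ g = ModuleCat.ofHom (ofElement m) := hf
    refine ⟨fun i j => g.hom (Pi.single ⟨i, j⟩ 1), ?_⟩
    rw [← map_dThree_one, ← ofElement_one.{v} (n := n) m]
    exact (LinearMap.congr_fun (congrArg ModuleCat.Hom.hom hg) _).symm
  · rintro ⟨y, hy⟩
    refine ⟨ModuleCat.ofHom (ofEntries y), ?_⟩
    change ModuleCat.ofHom (dThree n) ≫ ModuleCat.ofHom (ofEntries y) = _
    refine (eq_topCochain hn _ ?_).symm
    rw [hy]
    exact (map_dThree_one (ofEntries y)).trans (by simp only [ofEntries_single])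

theorem topClass_comp {M' : ModuleCat.{v} (FreeOrthogonal n)} (f : M ⟶ M') (m : M) :
    (topClass hn M m).comp (Ext.mk₀ f) (add_zero 3) = topClass hn M' (f.hom m) := by
  unfold topClass
  rw [ProjectiveResolution.extMk_comp_mk₀]
  simp only [topCochain_comp]

/-- The linear map from a module to `Ext³`. -/
def topClassₗ (M : ModuleCat.{v} (FreeOrthogonal n)) :
    M →ₗ[ℂ] augCohomology (counit n) 3 M where
  toFun := topClass hn M
  map_add' m m' := by
    unfold topClass
    rw [ProjectiveResolution.add_extMk]
    simp only [topCochain_add]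
  map_smul' r m := by
    rw [RingHom.id_apply, Ext.smul_eq_comp_mk₀, topClass_comp]
    rfl

end Top

end FreeOrthogonal

/-! ### `Ext` as a linear functor and its connecting maps -/

namespace CategoryTheory.Abelian.Ext

universe w₁ w₂ w₃

variable (k : Type) [Field k] {C : Type w₁} [Category.{w₂} C] [Abelian C] [Linear k C]
  [HasExt.{w₃} C] (X : C)

/-- The functor `Ext^j(X, -)` with values in vector spaces. -/
def linearFunctor (j : ℕ) : C ⥤ ModuleCat.{w₃} k where
  obj M := ModuleCat.of k (Ext X M j)
  map f := ModuleCat.ofHom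
    { toFun := fun x => x.comp (mk₀ f) (add_zero j)
      map_add' := fun _ _ => add_comp _ _ _ _
      map_smul' := fun _ _ => smul_comp _ _ _ _ }
  map_id M := by
    ext x
    exact comp_mk₀_id x
  map_comp f g := by
    ext x
    change x.comp (mk₀ (f ≫ g)) (add_zero j) =
      (x.comp (mk₀ f) (add_zero j)).comp (mk₀ g) (add_zero j)
    rw [comp_assoc_of_third_deg_zero, mk₀_comp_mk₀]

instance (j : ℕ) : (linearFunctor k X j).Additive where
  map_add {M M'} f g := by
    refine ModuleCat.hom_ext (LinearMap.ext fun (x : Ext X M j) => ?_)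
    have h : x.comp (mk₀ (f + g)) (add_zero j) =
        x.comp (mk₀ f) (add_zero j) + x.comp (mk₀ g) (add_zero j) := by
      rw [mk₀_add, comp_add]
    exact h

/-- The connecting map of the long exact sequence of `Ext^*(X, -)`. -/
def connecting {S : ShortComplex C} (hS : S.ShortExact) (j : ℕ) :
    (linearFunctor k X j).obj S.X₃ ⟶ (linearFunctor k X (j + 1)).obj S.X₁ :=
  ModuleCat.ofHom
    { toFun := fun x : Ext X S.X₃ j => x.comp hS.extClass rfl
      map_add' := fun _ _ => add_comp _ _ _ _
      map_smul' := fun _ _ => smul_comp _ _ _ _ }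

theorem connecting_naturality {S S' : ShortComplex C} (hS : S.ShortExact) (hS' : S'.ShortExact)
    (φ : S ⟶ S') (j : ℕ) :
    (linearFunctor k X j).map φ.τ₃ ≫ connecting k X hS' j =
      connecting k X hS j ≫ (linearFunctor k X (j + 1)).map φ.τ₁ := by
  refine ModuleCat.hom_ext (LinearMap.ext fun (x : Ext X S.X₃ j) => ?_)
  have h : (x.comp (mk₀ φ.τ₃) (add_zero j)).comp hS'.extClass rfl =
      (x.comp hS.extClass rfl).comp (mk₀ φ.τ₁) (add_zero (j + 1)) := by
    rw [comp_assoc_of_second_deg_zero, comp_assoc_of_third_deg_zero,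
      ShortComplex.ShortExact.extClass_naturality hS hS' φ]
  exact h

theorem connecting_injective {S : ShortComplex C} (hS : S.ShortExact) (j : ℕ)
    [Subsingleton (Ext X S.X₂ j)] : Function.Injective (connecting k X hS j) := by
  refine (injective_iff_map_eq_zero _).2 fun x hx => ?_
  obtain ⟨y, hy⟩ := covariant_sequence_exact₃ X hS x rfl hx
  rw [← hy, Subsingleton.elim y 0, zero_comp]
  rfl

theorem exists_connecting_eq_iff {S : ShortComplex C} (hS : S.ShortExact) (j : ℕ)
    (x : (linearFunctor k X (j + 1)).obj S.X₁) :
    (∃ y, connecting k X hS j y = x) ↔ (linearFunctor k X (j + 1)).map S.f x = 0 := by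
  constructor
  · rintro ⟨y, rfl⟩
    have h (y : Ext X S.X₃ j) : (y.comp hS.extClass rfl).comp (mk₀ S.f) (add_zero (j + 1)) = 0 := by
      rw [comp_assoc_of_third_deg_zero, hS.extClass_comp, comp_zero]
    exact h y
  · intro hx
    exact covariant_sequence_exact₁ X hS x hx rfl

/-- In the long exact sequence, `Ext^{j+1}(X, S.X₁)` is the only obstruction to right exactness of
`Ext^j(X, -)`. -/
theorem preservesFiniteColimits_linearFunctor (j : ℕ)
    (h : ∀ Y : C, Subsingleton (Ext X Y (j + 1))) :
    Limits.PreservesFiniteColimits (linearFunctor k X j) := by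
  refine ((Functor.preservesFiniteColimits_tfae (linearFunctor k X j)).out 0 3 :).1
    fun S hS => And.intro ?_ ?_
  · exact (ShortComplex.moduleCat_exact_iff _).2 fun x hx => covariant_sequence_exact₂ X hS x hx
  · refine (ModuleCat.epi_iff_surjective _).2 fun x => ?_
    have := h S.X₁
    exact covariant_sequence_exact₃ X hS x rfl (Subsingleton.elim _ _)

end CategoryTheory.Abelian.Ext

/-- Two surjections with the same kernel have isomorphic targets. -/
def LinearMap.equivOfKerEq {R M N P : Type*} [Ring R] [AddCommGroup M] [Module R M]
    [AddCommGroup N] [Module R N] [AddCommGroup P] [Module R P] (f : M →ₗ[R] N) (g : M →ₗ[R] P)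
    (hf : Function.Surjective f) (hg : Function.Surjective g)
    (h : LinearMap.ker f = LinearMap.ker g) : N ≃ₗ[R] P :=
  (f.quotKerEquivOfSurjective hf).symm ≪≫ₗ Submodule.quotEquivOfEq _ _ h ≪≫ₗ
    g.quotKerEquivOfSurjective hg

theorem LinearMap.equivOfKerEq_apply {R M N P : Type*} [Ring R] [AddCommGroup M] [Module R M]
    [AddCommGroup N] [Module R N] [AddCommGroup P] [Module R P] (f : M →ₗ[R] N) (g : M →ₗ[R] P)
    (hf : Function.Surjective f) (hg : Function.Surjective g)
    (h : LinearMap.ker f = LinearMap.ker g) (m : M) :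
    LinearMap.equivOfKerEq f g hf hg h (f m) = g m := by
  have h1 : (f.quotKerEquivOfSurjective hf).symm (f m) = Submodule.Quotient.mk m := by
    rw [LinearEquiv.symm_apply_eq]
    rfl
  simp only [LinearMap.equivOfKerEq, LinearEquiv.trans_apply, h1]
  rfl

/-! ### `Ext(ℂ, -)` of the regular module and of free modules -/

namespace FreeOrthogonal

open Abelian

attribute [local instance] ModuleCat.moduleOfAlgebraModule
attribute [local instance] ModuleCat.isScalarTower_of_algebra_moduleCat

variable {n : ℕ}

/-- The left regular module. -/
def regular (n : ℕ) : ModuleCat.{0} (FreeOrthogonal n) :=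
  ModuleCat.of (FreeOrthogonal n) (FreeOrthogonal n)

/-- The counit as a linear map on the regular module. -/
def counitₗ (n : ℕ) : regular n →ₗ[ℂ] ℂ where
  toFun := fun x : FreeOrthogonal n => counit n x
  map_add' := fun x y : FreeOrthogonal n => map_add (counit n) x y
  map_smul' r := fun x : FreeOrthogonal n => by
    change counit n (algebraMap ℂ (FreeOrthogonal n) r * x) = _
    rw [map_mul, AlgHom.commutes]
    rfl

theorem counit_eq_zero_iff (a : FreeOrthogonal n) : counit n a = 0 ↔
    ∃ y : Fin n → Fin n → FreeOrthogonal n,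
      a = ∑ i, ∑ j, (u n i j * y i j - if i = j then y i j else 0) := by
  constructor
  · intro ha
    obtain ⟨y, hy⟩ := exists_of_counit_eq_zero a
    refine ⟨y, ?_⟩
    rwa [ha, map_zero, sub_zero] at hy
  · rintro ⟨y, rfl⟩
    simp only [map_sum, map_sub, map_mul, counit_u]
    refine Finset.sum_eq_zero fun i _ => Finset.sum_eq_zero fun j _ => ?_
    split_ifs <;> simp

theorem counitₗ_surjective (n : ℕ) : Function.Surjective (counitₗ n) := fun z =>
  ⟨algebraMap ℂ (FreeOrthogonal n) z, (counit n).commutes z⟩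

/-- Both kernels are the augmentation ideal, generated as a right ideal by the `u_ij - δ_ij`. -/
theorem ker_topClassₗ_regular (hn : 2 ≤ n) :
    LinearMap.ker (topClassₗ hn (regular n)) = LinearMap.ker (counitₗ n) :=
  Submodule.ext fun a => (topClass_eq_zero_iff hn a).trans (counit_eq_zero_iff a).symm

/-- `Ext³(ℂ, A)` is the trivial right module. -/
theorem exists_ext_three_equiv (hn : 2 ≤ n) :
    ∃ e : augCohomology (counit n) 3 (regular n) ≃ₗ[ℂ] ℂ,
      ∀ (a : FreeOrthogonal n) x,
        e (augCohomology.map (counit n) 3 (rightMul a) x) = e x * counit n a := by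
  refine ⟨LinearMap.equivOfKerEq _ _ (topClass_surjective hn) (counitₗ_surjective n)
    (ker_topClassₗ_regular hn), fun a x => ?_⟩
  obtain ⟨b, rfl⟩ := topClass_surjective hn x
  have h1 : augCohomology.map (counit n) 3 (rightMul a) (topClass hn (regular n) b) =
      topClassₗ hn (regular n) ((rightMul a).hom b) := topClass_comp hn (rightMul a) b
  refine (congrArg _ h1).trans ((LinearMap.equivOfKerEq_apply _ _ _ _ _ _).trans ?_)
  refine (map_mul (counit n) b a).trans ?_
  exact congrArg (· * counit n a) (LinearMap.equivOfKerEq_apply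
    (topClassₗ hn (regular n)) (counitₗ n) (topClass_surjective hn) (counitₗ_surjective n)
    (ker_topClassₗ_regular hn) b).symm

theorem subsingleton_ext_regular (hn : 2 ≤ n) (i : ℕ) (hi : i ≠ 3) :
    Subsingleton (augCohomology (counit n) i
      (ModuleCat.of (FreeOrthogonal n) (FreeOrthogonal n))) := by
  match i, hi with
  | 0, _ => exact subsingleton_ext_zero hn _ fun m h => eq_zero_of_invariant hn h
  | 1, _ => exact subsingleton_ext_one hn _ fun c h => exists_of_cocycle hn h
  | 2, _ => exact subsingleton_ext_two hn _ fun y h => exists_of_sum_eq_zero h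
  | i + 4, _ => exact subsingleton_ext_of_lt hn _ (by omega)

section Free

variable {X : Type v}

/-- Reduces exactness over a free module of arbitrary rank to exactness over the ring: solutions are
chosen coordinate by coordinate. -/
theorem _root_.Finsupp.exists_forall_rel {α ι R S : Type*} [Finite ι] [Zero R] [Zero S]
    (P : (ι → R) → S → Prop) (h0 : P 0 0) (y : ι → (α →₀ R)) (h : ∀ x, ∃ b, P (fun i => y i x) b) :
    ∃ b : α →₀ S, ∀ x, P (fun i => y i x) (b x) := by
  classical
  have := Fintype.ofFinite ι
  choose b hb using h
  -- Choosing zero wherever all the data vanish keeps the support of the solution finite.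
  refine ⟨Finsupp.onFinset (Finset.univ.biUnion fun i => (y i).support)
    (fun x => if ∀ i, y i x = 0 then 0 else b x) fun x hx => ?_, fun x => ?_⟩
  · by_contra h1
    refine hx (if_pos fun i => ?_)
    by_contra h2
    exact h1 (Finset.mem_biUnion.2 ⟨i, Finset.mem_univ _, Finsupp.mem_support_iff.2 h2⟩)
  · rw [Finsupp.onFinset_apply]
    split_ifs with h1
    · rw [show (fun i => y i x) = 0 from funext h1]
      exact h0
    · exact hb x

/-- Arbitrary rank is needed because the dimension shift uses the free module on all elements of
`M`. -/
theorem subsingleton_ext_free (hn : 2 ≤ n) (i : ℕ) (hi : i ≠ 3) :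
    Subsingleton (augCohomology (counit n) i
      (ModuleCat.of (FreeOrthogonal n) (X →₀ FreeOrthogonal n))) := by
  have hsmul (a b : FreeOrthogonal n) (f : X →₀ FreeOrthogonal n) (x : X) (p : Prop) [Decidable p] :
      (if p then f else 0) x = if p then f x else 0 := by split_ifs <;> rfl
  match i, hi with
  | 0, _ =>
    refine subsingleton_ext_zero hn _ fun m h => Finsupp.ext fun x =>
      eq_zero_of_invariant hn fun i j => ?_
    have h1 := DFunLike.congr_fun (h i j) x
    split_ifs at h1 ⊢ <;> exact h1
  | 1, _ =>
    refine subsingleton_ext_one hn _ fun c h => ?_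
    obtain ⟨m, hm⟩ := Finsupp.exists_forall_rel
      (fun (c : Fin n × Fin n → FreeOrthogonal n) m =>
        ∀ i j, c (i, j) = u n i j * m - if i = j then m else 0) (by simp)
      (fun p => c p.1 p.2) fun x => exists_of_cocycle hn (c := fun i j => c i j x) fun i j => by
        have h1 := DFunLike.congr_fun (h i j) x
        rw [Finsupp.add_apply, Finsupp.finsetSum_apply] at h1
        exact h1
    refine ⟨m, fun i j => Finsupp.ext fun x => (hm x i j).trans ?_⟩
    rw [Finsupp.sub_apply]
    split_ifs <;> rfl
  | 2, _ =>
    refine subsingleton_ext_two hn _ fun y h => ?_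
    obtain ⟨c, hc⟩ := Finsupp.exists_forall_rel
      (fun (y : Fin n × Fin n → FreeOrthogonal n) (c : Fin n → Fin n → FreeOrthogonal n) =>
        ∀ i j, y (i, j) = c i j + ∑ k, u n i k * c j k) (by simp)
      (fun p => y p.1 p.2) fun x => exists_of_sum_eq_zero (y := fun i j => y i j x) (by
        have h1 := DFunLike.congr_fun h x
        simp only [Finsupp.finsetSum_apply, Finsupp.sub_apply] at h1
        refine Eq.trans ?_ h1
        refine Finset.sum_congr rfl fun i _ => Finset.sum_congr rfl fun j _ => ?_
        split_ifs <;> rfl)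
    refine ⟨fun i j => c.mapRange (fun f => f i j) rfl, fun i j => Finsupp.ext fun x =>
      (hc x i j).trans ?_⟩
    rw [Finsupp.add_apply, Finsupp.finsetSum_apply]
    rfl
  | i + 4, _ => exact subsingleton_ext_of_lt hn _ (by omega)

end Free

end FreeOrthogonal

/-! ### The tensor product with the trivial module as `Ext³` -/

namespace FreeOrthogonal

open Abelian

attribute [local instance] ModuleCat.moduleOfAlgebraModule
attribute [local instance] ModuleCat.isScalarTower_of_algebra_moduleCat

variable {n : ℕ}

/-- The difference `a - ε(a)` is a combination of the `u_ij - δ_ij`, so it maps `m` to a coboundary.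
-/
theorem topClass_smul (hn : 2 ≤ n) {M : ModuleCat.{v} (FreeOrthogonal n)} (a : FreeOrthogonal n)
    (m : M) : topClass hn M (a • m) = counit n a • topClass hn M m := by
  have h0 : topClassₗ hn M (a • m - counit n a • m) = 0 := by
    refine (topClass_eq_zero_iff hn _).2 ?_
    obtain ⟨y, hy⟩ := exists_of_counit_eq_zero a
    refine ⟨fun i j => y i j • m, ?_⟩
    have h1 : counit n a • m = algebraMap ℂ (FreeOrthogonal n) (counit n a) • m := rfl
    rw [h1, ← sub_smul, hy, Finset.sum_smul]
    refine Finset.sum_congr rfl fun i _ => ?_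
    rw [Finset.sum_smul]
    refine Finset.sum_congr rfl fun j _ => ?_
    rw [sub_smul, mul_smul, ite_smul, zero_smul]
  rw [map_sub, sub_eq_zero] at h0
  exact h0.trans (map_smul (topClassₗ hn M) _ _)

/-- The generator of the trivial right module. -/
def rightOne (n : ℕ) : trivialRight.{v} (counit n) := ULift.up.{v} (1 : ℂ)

/-- The linear coordinate on the trivial right module. -/
def rightCoord (n : ℕ) : trivialRight.{v} (counit n) →ₗ[ℂ] ℂ where
  toFun z := ULift.down.{v} z
  map_add' _ _ := rfl
  map_smul' r z := by
    change counit n (algebraMap ℂ (FreeOrthogonal n) r) * ULift.down.{v} z = _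
    rw [AlgHom.commutes]
    rfl

theorem rightCoord_smul_rightOne (z : trivialRight.{v} (counit n)) :
    rightCoord n z • rightOne n = z := by
  change ULift.up.{v} (counit n (algebraMap ℂ (FreeOrthogonal n) (ULift.down.{v} z)) * 1) = z
  rw [AlgHom.commutes, mul_one]
  rfl

theorem rightCoord_op_smul (a : FreeOrthogonal n) (z : trivialRight.{v} (counit n)) :
    rightCoord n (MulOpposite.op a • z) = counit n a * rightCoord n z := rfl

/-- The map `m ↦ 1 ⊗ m` to the relative tensor product with the trivial module. -/
def toRelTensor (M : ModuleCat.{v} (FreeOrthogonal n)) :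
    M →ₗ[ℂ] RelTensor ℂ (trivialRight.{v} (counit n)) M :=
  (relTensorRelations ℂ _ M).mkQ ∘ₗ TensorProduct.mk ℂ _ _ (rightOne n)

theorem mkQ_tmul {M : ModuleCat.{v} (FreeOrthogonal n)} (z : trivialRight.{v} (counit n)) (m : M) :
    (relTensorRelations ℂ _ M).mkQ (z ⊗ₜ[ℂ] m) = toRelTensor M (rightCoord n z • m) := by
  rw [map_smul]
  conv_lhs => rw [← rightCoord_smul_rightOne z, ← TensorProduct.smul_tmul', map_smul]
  rfl

theorem toRelTensor_surjective (M : ModuleCat.{v} (FreeOrthogonal n)) :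
    Function.Surjective (toRelTensor M) := fun t => by
  obtain ⟨t, rfl⟩ := Submodule.mkQ_surjective _ t
  induction t using TensorProduct.induction_on with
  | zero => exact ⟨0, by rw [map_zero, map_zero]⟩
  | tmul z m => exact ⟨_, (mkQ_tmul z m).symm⟩
  | add s t hs ht =>
    obtain ⟨x, hx⟩ := hs
    obtain ⟨y, hy⟩ := ht
    exact ⟨x + y, by rw [map_add, map_add, hx, hy]⟩

theorem toRelTensor_smul {M : ModuleCat.{v} (FreeOrthogonal n)} (a : FreeOrthogonal n) (m : M) :
    toRelTensor M (a • m) = counit n a • toRelTensor M m := by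
  have h : (MulOpposite.op a • rightOne.{v} n) ⊗ₜ[ℂ] m - rightOne.{v} n ⊗ₜ[ℂ] (a • m) ∈
      relTensorRelations ℂ _ M := Submodule.subset_span ⟨_, a, m, rfl⟩
  have h1 := (Submodule.Quotient.mk_eq_zero _).2 h
  have h2 : (relTensorRelations ℂ _ M).mkQ ((MulOpposite.op a • rightOne.{v} n) ⊗ₜ[ℂ] m) =
      (relTensorRelations ℂ _ M).mkQ (rightOne.{v} n ⊗ₜ[ℂ] (a • m)) := by
    rw [← sub_eq_zero, ← map_sub]
    exact h1
  rw [mkQ_tmul, rightCoord_op_smul, map_smul] at h2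
  refine h2.symm.trans ?_
  rw [show rightCoord n (rightOne.{v} n) = 1 from rfl, mul_one]

/-- The map from the relative tensor product with the trivial module to `Ext³`. -/
def relTensorToExt (hn : 2 ≤ n) (M : ModuleCat.{v} (FreeOrthogonal n)) :
    RelTensor ℂ (trivialRight.{v} (counit n)) M →ₗ[ℂ] augCohomology (counit n) 3 M :=
  (relTensorRelations ℂ _ M).liftQ
    (TensorProduct.lift ((LinearMap.lsmul ℂ (augCohomology (counit n) 3 M)).compl₁₂ (rightCoord n)
      (topClassₗ hn M)))
    (Submodule.span_le.2 (by
      rintro _ ⟨z, a, m, rfl⟩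
      refine LinearMap.mem_ker.2 ?_
      rw [map_sub, sub_eq_zero, TensorProduct.lift.tmul, TensorProduct.lift.tmul]
      change rightCoord n (MulOpposite.op a • z) • topClass hn M m =
        rightCoord n z • topClass hn M (a • m)
      rw [rightCoord_op_smul, topClass_smul, smul_smul, mul_comm]))

theorem relTensorToExt_toRelTensor (hn : 2 ≤ n) (M : ModuleCat.{v} (FreeOrthogonal n)) (m : M) :
    relTensorToExt hn M (toRelTensor M m) = topClassₗ hn M m := one_smul ℂ (topClassₗ hn M m)

/-- One inclusion holds because `topClass` factors through the tensor product; the other because `1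
⊗ u_ij y = 1 ⊗ δ_ij y`. -/
theorem ker_toRelTensor (hn : 2 ≤ n) (M : ModuleCat.{v} (FreeOrthogonal n)) :
    LinearMap.ker (toRelTensor M) = LinearMap.ker (topClassₗ hn M) := by
  ext m
  rw [LinearMap.mem_ker, LinearMap.mem_ker]
  constructor
  · intro h
    rw [← relTensorToExt_toRelTensor, h, map_zero]
  · intro h
    obtain ⟨y, rfl⟩ := (topClass_eq_zero_iff hn m).1 h
    rw [map_sum]
    refine Finset.sum_eq_zero fun i _ => ?_
    rw [map_sum]
    refine Finset.sum_eq_zero fun j _ => ?_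
    rw [map_sub, toRelTensor_smul, counit_u]
    split_ifs
    · rw [one_smul, sub_self]
    · rw [zero_smul, map_zero, sub_zero]

/-- The relative tensor product with the trivial module is `Ext³`. -/
def relTensorIsoExt (hn : 2 ≤ n) : relTensorFunctor.{v} ℂ (trivialRight (counit n)) ≅
    Ext.linearFunctor ℂ (trivialLeft.{v} (counit n)) 3 :=
  NatIso.ofComponents
    (fun M => (LinearMap.equivOfKerEq _ _ (toRelTensor_surjective M) (topClass_surjective hn)
      (ker_toRelTensor hn M) : _ ≃ₗ[ℂ] augCohomology (counit n) 3 M).toModuleIso)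
    (fun {M M'} f => by
      refine ModuleCat.hom_ext (LinearMap.ext fun t => ?_)
      obtain ⟨m, rfl⟩ := toRelTensor_surjective M t
      refine (LinearMap.equivOfKerEq_apply _ _ _ (topClass_surjective hn) (ker_toRelTensor hn M')
        (f.hom m)).trans ?_
      refine (topClass_comp hn f m).symm.trans ?_
      exact congrArg (fun x => Ext.comp x (Ext.mk₀ f) (add_zero 3))
        (LinearMap.equivOfKerEq_apply _ _ (toRelTensor_surjective M) (topClass_surjective hn)
          (ker_toRelTensor hn M) m).symm)

/-- Right exactness is inherited from `Ext³`, where it follows from `Ext⁴ = 0`. -/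
theorem preservesFiniteColimits_relTensor (hn : 2 ≤ n) :
    Limits.PreservesFiniteColimits (relTensorFunctor.{v} ℂ (trivialRight (counit n))) :=
  have := Ext.preservesFiniteColimits_linearFunctor ℂ (trivialLeft.{v} (counit n)) 3
    fun M => subsingleton_ext_of_lt hn M (by norm_num)
  Limits.preservesFiniteColimits_of_natIso (relTensorIsoExt hn).symm

end FreeOrthogonal

/-! ### Maps between spliced resolutions -/

namespace ChainComplex

open CategoryTheory

universe w₁ w₂

/-- A chain map between augmented complexes. -/
def augmentMap {C : Type w₁} [Category.{w₂} C] [Limits.HasZeroMorphisms C] {K K' : ChainComplex C ℕ}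
    {X X' : C} {f : K.X 0 ⟶ X} {f' : K'.X 0 ⟶ X'} (w : K.d 1 0 ≫ f = 0) (w' : K'.d 1 0 ≫ f' = 0)
    (ψ : K ⟶ K') (t : X ⟶ X') (h : ψ.f 0 ≫ f' = f ≫ t) : K.augment f w ⟶ K'.augment f' w' where
  f
    | 0 => t
    | i + 1 => ψ.f i
  comm' i j hij := by
    obtain rfl : j + 1 = i := hij
    match j with
    | 0 => exact h
    | j + 1 => exact ψ.comm (j + 1) j

end ChainComplex

namespace CategoryTheory.ProjectiveResolution

universe w₁ w₂ w₃ w₄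

variable {C : Type w₁} [Category.{w₂} C] [Abelian C]

theorem splice_π_f_zero {S : ShortComplex C} (hS : S.ShortExact) (P : ProjectiveResolution S.X₁)
    [Projective S.X₂] : (splice hS P).π.f 0 = S.g :=
  ofExact_π_f_zero _ _ _ _ _ _ _

/-- A chain map between spliced resolutions. -/
def spliceMap {S S' : ShortComplex C} (hS : S.ShortExact) (hS' : S'.ShortExact)
    (P : ProjectiveResolution S.X₁) (P' : ProjectiveResolution S'.X₁) [Projective S.X₂]
    [Projective S'.X₂] (φ : S ⟶ S') (ψ : P.complex ⟶ P'.complex)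
    (hψ : ψ.f 0 ≫ P'.augmentation = P.augmentation ≫ φ.τ₁) :
    (splice hS P).complex ⟶ (splice hS' P').complex :=
  ChainComplex.augmentMap (P.d_augmentation_comp S.f) (P'.d_augmentation_comp S'.f) ψ φ.τ₂ (by
    rw [← Category.assoc, hψ, Category.assoc, Category.assoc, φ.comm₁₂])

theorem spliceMap_comm {S S' : ShortComplex C} (hS : S.ShortExact) (hS' : S'.ShortExact)
    (P : ProjectiveResolution S.X₁) (P' : ProjectiveResolution S'.X₁) [Projective S.X₂]
    [Projective S'.X₂] (φ : S ⟶ S') (ψ : P.complex ⟶ P'.complex)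
    (hψ : ψ.f 0 ≫ P'.augmentation = P.augmentation ≫ φ.τ₁) :
    (spliceMap hS hS' P P' φ ψ hψ).f 0 ≫ (splice hS' P').π.f 0 =
      (splice hS P).π.f 0 ≫ φ.τ₃ := by
  rw [splice_π_f_zero, splice_π_f_zero]
  exact φ.comm₂₃

variable {D : Type w₃} [Category.{w₄} D] [Abelian D] (F : C ⥤ D) [F.Additive]

/-- The homology of a spliced resolution in high degrees. -/
def spliceHomologyIso {S : ShortComplex C} (hS : S.ShortExact) (P : ProjectiveResolution S.X₁)
    [Projective S.X₂] (i : ℕ) :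
    (HomologicalComplex.homologyFunctor D _ (i + 2)).obj
        ((F.mapHomologicalComplex _).obj (splice hS P).complex) ≅
      (HomologicalComplex.homologyFunctor D _ (i + 1)).obj
        ((F.mapHomologicalComplex _).obj P.complex) :=
  (HomologicalComplex.homologyFunctorIso' D (ComplexShape.down ℕ) (i + 3) (i + 2) (i + 1)
      (by simp) (by simp)).app _ ≪≫
    (HomologicalComplex.homologyFunctorIso' D (ComplexShape.down ℕ) (i + 2) (i + 1) i
      (by simp) (by simp)).symm.app ((F.mapHomologicalComplex _).obj P.complex)

theorem spliceHomologyIso_naturality {S S' : ShortComplex C} (hS : S.ShortExact)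
    (hS' : S'.ShortExact) (P : ProjectiveResolution S.X₁) (P' : ProjectiveResolution S'.X₁)
    [Projective S.X₂] [Projective S'.X₂] (φ : S ⟶ S') (ψ : P.complex ⟶ P'.complex)
    (hψ : ψ.f 0 ≫ P'.augmentation = P.augmentation ≫ φ.τ₁) (i : ℕ) :
    (F.mapHomologicalComplex _ ⋙ HomologicalComplex.homologyFunctor D _ (i + 2)).map
        (spliceMap hS hS' P P' φ ψ hψ) ≫ (spliceHomologyIso F hS' P' i).hom =
      (spliceHomologyIso F hS P i).hom ≫
        (F.mapHomologicalComplex _ ⋙ HomologicalComplex.homologyFunctor D _ (i + 1)).map ψ := by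
  have h1 := (HomologicalComplex.homologyFunctorIso' D (ComplexShape.down ℕ) (i + 3) (i + 2) (i + 1)
      (by simp) (by simp)).hom.naturality
        ((F.mapHomologicalComplex _).map (spliceMap hS hS' P P' φ ψ hψ))
  have h2 := (HomologicalComplex.homologyFunctorIso' D (ComplexShape.down ℕ) (i + 2) (i + 1) i
      (by simp) (by simp)).inv.naturality ((F.mapHomologicalComplex _).map ψ)
  refine (Category.assoc _ _ _).symm.trans ((congrArg (· ≫ _) h1).trans ?_)
  refine (Category.assoc _ _ _).trans (Eq.trans ?_ (Category.assoc _ _ _).symm)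
  exact congrArg (_ ≫ ·) h2

end CategoryTheory.ProjectiveResolution

/-! ### The first homology of a complex as a kernel -/

namespace ChainComplex

open CategoryTheory Limits

universe w₃ w₄

variable {D : Type w₃} [Category.{w₄} D] [Abelian D] {K : ChainComplex D ℕ} {Y : D} {q : K.X 1 ⟶ Y}
  (w : K.d 2 1 ≫ q = 0)

/-- The map from the first homology induced by a map on chains that vanishes on boundaries. -/
def homologyOneDesc : K.homology 1 ⟶ Y :=
  K.homologyι 1 ≫ K.descOpcycles q 2 (by simp) w

/-- Both `q` and the projection to the opcycles are cokernels of `K.d 2 1`. The first homology, the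
kernel of the map from the opcycles to `K.X 0`, thus becomes a kernel on `Y`. -/
theorem isIso_descOpcycles_of_exact (_ : Epi q) (hq : (ShortComplex.mk _ _ w).Exact) :
    IsIso (K.descOpcycles q 2 (by simp) w) := by
  have h1 := K.opcyclesIsCokernel 2 1 (by simp)
  have : Epi (ShortComplex.mk _ _ w).g := inferInstanceAs (Epi q)
  have h2 : IsColimit (CokernelCofork.ofπ q w) := hq.gIsCokernel
  have h3 : K.descOpcycles q 2 (by simp) w = (IsColimit.coconePointUniqueUpToIso h1 h2).hom := by
    rw [← cancel_epi (K.pOpcycles 1), HomologicalComplex.p_descOpcycles]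
    exact (IsColimit.comp_coconePointUniqueUpToIso_hom h1 h2 WalkingParallelPair.one).symm
  rw [h3]
  exact (IsColimit.coconePointUniqueUpToIso h1 h2).isIso_hom

theorem descOpcycles_comp {r : Y ⟶ K.X 0} (hr : q ≫ r = K.d 1 0) :
    K.descOpcycles q 2 (by simp) w ≫ r = K.fromOpcycles 1 0 := by
  rw [← cancel_epi (K.pOpcycles 1), HomologicalComplex.p_fromOpcycles, ← Category.assoc,
    HomologicalComplex.p_descOpcycles, hr]

theorem homologyOneDesc_comp {r : Y ⟶ K.X 0} (hr : q ≫ r = K.d 1 0) :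
    homologyOneDesc w ≫ r = 0 := by
  rw [homologyOneDesc, Category.assoc, descOpcycles_comp w hr,
    HomologicalComplex.homologyι_comp_fromOpcycles]

theorem mono_homologyOneDesc (h : Epi q) (hq : (ShortComplex.mk _ _ w).Exact) :
    Mono (homologyOneDesc w) :=
  have := isIso_descOpcycles_of_exact w h hq
  inferInstanceAs (Mono (K.homologyι 1 ≫ K.descOpcycles q 2 (by simp) w))

theorem exact_homologyOneDesc (h : Epi q) (hq : (ShortComplex.mk _ _ w).Exact) {r : Y ⟶ K.X 0}
    (hr : q ≫ r = K.d 1 0) : (ShortComplex.mk _ _ (homologyOneDesc_comp w hr)).Exact := by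
  have := isIso_descOpcycles_of_exact w h hq
  have h1 : (ShortComplex.mk _ _ (K.homologyι_comp_fromOpcycles 1 0)).Exact :=
    ShortComplex.exact_of_f_is_kernel _ (K.homologyIsKernel 1 0 (by simp))
  let θ : K.opcycles 1 ≅ Y := asIso (K.descOpcycles q 2 _ w)
  refine (ShortComplex.exact_iff_of_iso
    (S₁ := ShortComplex.mk _ _ (K.homologyι_comp_fromOpcycles 1 0))
    (S₂ := ShortComplex.mk _ _ (homologyOneDesc_comp w hr))
    (ShortComplex.isoMk (Iso.refl _) θ (Iso.refl _) (Category.id_comp _) ?_)).1 h1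
  exact (descOpcycles_comp w hr).trans (Category.comp_id _).symm

theorem homologyOneDesc_naturality {K' : ChainComplex D ℕ} {Y' : D} {q' : K'.X 1 ⟶ Y'}
    (w' : K'.d 2 1 ≫ q' = 0) (g : K ⟶ K') (t : Y ⟶ Y') (h : g.f 1 ≫ q' = q ≫ t) :
    HomologicalComplex.homologyMap g 1 ≫ homologyOneDesc w' = homologyOneDesc w ≫ t := by
  have h1 : HomologicalComplex.opcyclesMap g 1 ≫ K'.descOpcycles q' 2 (by simp) w' =
      K.descOpcycles q 2 (by simp) w ≫ t := by
    rw [← cancel_epi (K.pOpcycles 1), ← Category.assoc,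
      HomologicalComplex.p_opcyclesMap, Category.assoc, HomologicalComplex.p_descOpcycles,
      ← Category.assoc, HomologicalComplex.p_descOpcycles, h]
  unfold homologyOneDesc
  rw [← Category.assoc, HomologicalComplex.homologyι_naturality, Category.assoc, h1, Category.assoc]

end ChainComplex

/-! ### Dimension shifting -/

namespace CategoryTheory

open Limits

universe w₁ w₂ w₃ w₄

variable {C : Type w₁} [Category.{w₂} C] [Abelian C] {D : Type w₃} [Category.{w₄} D] [Abelian D]

/-- A natural identification of `T' S.X₃` with the kernel of `T S.X₁ ⟶ T S.X₂`, for the short exact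
sequences `S` such that `S.X₂` has a given property. -/
structure DimensionShift (T' T : C ⥤ D) (good : C → Prop) where
  δ {S : ShortComplex C} (hS : S.ShortExact) (h : good S.X₂) : T'.obj S.X₃ ⟶ T.obj S.X₁
  mono {S : ShortComplex C} (hS : S.ShortExact) (h : good S.X₂) : Mono (δ hS h)
  w {S : ShortComplex C} (hS : S.ShortExact) (h : good S.X₂) : δ hS h ≫ T.map S.f = 0
  exact {S : ShortComplex C} (hS : S.ShortExact) (h : good S.X₂) :
    (ShortComplex.mk _ _ (w hS h)).Exact
  naturality {S S' : ShortComplex C} (hS : S.ShortExact) (h : good S.X₂) (hS' : S'.ShortExact)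
    (h' : good S'.X₂) (φ : S ⟶ S') : T'.map φ.τ₃ ≫ δ hS' h' = δ hS h ≫ T.map φ.τ₁

theorem ShortComplex.Exact.iso_comp {W X Y Z : D} {f : X ⟶ Y} {g : Y ⟶ Z} {w : f ≫ g = 0}
    (h : (ShortComplex.mk f g w).Exact) (e : W ≅ X) (w' : (e.hom ≫ f) ≫ g = 0) :
    (ShortComplex.mk (e.hom ≫ f) g w').Exact :=
  (ShortComplex.exact_iff_of_iso
    (S₁ := ShortComplex.mk (e.hom ≫ f) g w') (S₂ := ShortComplex.mk f g w)
    (ShortComplex.isoMk e (Iso.refl _) (Iso.refl _) (Category.comp_id _).symm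
      ((Category.id_comp _).trans (Category.comp_id _).symm))).2 h

namespace DimensionShift

variable {T' T E' E : C ⥤ D} {good : C → Prop}

section Lift

variable (c : DimensionShift T' T good) (d : DimensionShift E' E good) (α : T ⟶ E)
  {S : ShortComplex C} (hS : S.ShortExact) (h : good S.X₂)

/-- The map induced on kernels by a natural transformation. -/
def lift : T'.obj S.X₃ ⟶ E'.obj S.X₃ :=
  have := d.mono hS h
  (d.exact hS h).lift (c.δ hS h ≫ α.app S.X₁) (by
    change (c.δ hS h ≫ α.app S.X₁) ≫ E.map S.f = 0
    rw [Category.assoc, ← α.naturality, ← Category.assoc, c.w, zero_comp])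

theorem lift_comp : lift c d α hS h ≫ d.δ hS h = c.δ hS h ≫ α.app S.X₁ :=
  have := d.mono hS h
  (d.exact hS h).lift_f _ _

theorem lift_naturality {S' : ShortComplex C} (hS' : S'.ShortExact) (h' : good S'.X₂)
    (φ : S ⟶ S') :
    T'.map φ.τ₃ ≫ lift c d α hS' h' = lift c d α hS h ≫ E'.map φ.τ₃ := by
  have := d.mono hS' h'
  rw [← cancel_mono (d.δ hS' h'), Category.assoc, lift_comp, Category.assoc, d.naturality hS h,
    ← Category.assoc, c.naturality hS h, Category.assoc, α.naturality, ← Category.assoc,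
    ← lift_comp, Category.assoc]

end Lift

theorem lift_lift (c : DimensionShift T' T good) (d : DimensionShift E' E good) (α : T ≅ E)
    {S : ShortComplex C} (hS : S.ShortExact) (h : good S.X₂) :
    lift c d α.hom hS h ≫ lift d c α.inv hS h = 𝟙 _ := by
  have := c.mono hS h
  rw [← cancel_mono (c.δ hS h), Category.assoc, lift_comp, ← Category.assoc, lift_comp,
    Category.assoc, Iso.hom_inv_id_app, Category.comp_id, Category.id_comp]

variable (good) in
/-- A presentation of an object by a projective object with a given property. -/
structure Cover (M : C) where
  {K P : C}
  ι : K ⟶ P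
  π : P ⟶ M
  w : ι ≫ π = 0
  shortExact : (ShortComplex.mk ι π w).ShortExact
  projective : Projective P
  good : good P

/-- The short exact sequence of a presentation. -/
abbrev Cover.toShortComplex {M : C} (c : Cover good M) : ShortComplex C :=
  ShortComplex.mk c.ι c.π c.w

/-- The map lifts to the middle terms because `c.P` is projective, and then restricts to the
kernels. This makes the isomorphisms obtained from chosen covers natural. -/
theorem Cover.exists_hom {M M' : C} (c : Cover good M) (c' : Cover good M') (f : M ⟶ M') :
    ∃ φ : c.toShortComplex ⟶ c'.toShortComplex, φ.τ₃ = f := by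
  have := c.projective
  have : Epi c'.π := c'.shortExact.epi_g
  have : Mono c'.ι := c'.shortExact.mono_f
  let p : c.P ⟶ c'.P := Projective.factorThru (c.π ≫ f) c'.π
  have hp : p ≫ c'.π = c.π ≫ f := Projective.factorThru_comp _ _
  have hk : (c.ι ≫ p) ≫ c'.π = 0 := by
    rw [Category.assoc, hp, ← Category.assoc, c.w, zero_comp]
  have : Mono (ShortComplex.mk c'.ι c'.π c'.w).f := c'.shortExact.mono_f
  have hl := c'.shortExact.exact.lift_f (c.ι ≫ p) hk
  exact ⟨ShortComplex.Hom.mk (c'.shortExact.exact.lift (c.ι ≫ p) hk) p f hl hp, rfl⟩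

/-- Functors with isomorphic dimension shifts are isomorphic. -/
def isoOfIso (c : DimensionShift T' T good) (d : DimensionShift E' E good) (α : T ≅ E)
    (cover : ∀ M : C, Cover good M) : T' ≅ E' :=
  NatIso.ofComponents
    (fun M =>
      { hom := lift c d α.hom (cover M).shortExact (cover M).good
        inv := lift d c α.inv (cover M).shortExact (cover M).good
        hom_inv_id := lift_lift c d α _ _
        inv_hom_id := lift_lift d c α.symm _ _ })
    (fun {M M'} f => by
      obtain ⟨φ, rfl⟩ := (cover M).exists_hom (cover M') f
      exact lift_naturality c d α.hom _ _ _ _ φ)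

end DimensionShift

namespace Functor

variable (F : C ⥤ D) [F.Additive]

open ProjectiveResolution

/-- The comparison of left derived functors of the ends of a short exact sequence with projective
middle term. -/
def leftDerivedShiftIso [HasProjectiveResolutions C] {S : ShortComplex C} (hS : S.ShortExact) (h : Projective S.X₂) (i : ℕ) :
    (F.leftDerived (i + 2)).obj S.X₃ ≅ (F.leftDerived (i + 1)).obj S.X₁ :=
  (splice hS (projectiveResolution S.X₁)).isoLeftDerivedObj F (i + 2) ≪≫
    spliceHomologyIso F hS (projectiveResolution S.X₁) i ≪≫
    ((projectiveResolution S.X₁).isoLeftDerivedObj F (i + 1)).symm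

/-- The dimension shift for left derived functors in degrees at least two. -/
def leftDerivedShift [HasProjectiveResolutions C] (i : ℕ) :
    DimensionShift (F.leftDerived (i + 2)) (F.leftDerived (i + 1)) Projective where
  δ hS h := (leftDerivedShiftIso F hS h i).hom
  mono hS h := inferInstance
  -- Left derived functors of positive degree vanish on the projective object `S.X₂`, so the kernel
  -- in question is all of the value at `S.X₁`.
  w {S} hS h := (F.isZero_leftDerived_obj_projective_succ i S.X₂).eq_of_tgt _ _
  exact {S} hS h := (ShortComplex.exact_iff_epi _
    ((F.isZero_leftDerived_obj_projective_succ i S.X₂).eq_of_tgt _ _)).2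
      (inferInstanceAs (Epi (leftDerivedShiftIso F hS h i).hom))
  naturality {S S'} hS h hS' h' φ := by
    have hψ := ProjectiveResolution.lift_commutes_zero φ.τ₁ (projectiveResolution S.X₁)
      (projectiveResolution S'.X₁)
    have h1 := isoLeftDerivedObj_hom_naturality φ.τ₃ _ _ _
      (spliceMap_comm hS hS' _ _ φ _ hψ) F (i + 2)
    have h2 := spliceHomologyIso_naturality F hS hS' _ _ φ _ hψ i
    have h3 := isoLeftDerivedObj_inv_naturality φ.τ₁ _ _ _ hψ F (i + 1)
    simp only [leftDerivedShiftIso, Iso.trans_hom, Iso.symm_hom, Category.assoc]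
    rw [← Category.assoc, h1, Category.assoc, ← Category.assoc (Functor.map _ _), h2,
      Category.assoc, ← h3]

section One

variable {S : ShortComplex C} (P : ProjectiveResolution S.X₁)

theorem map_d_augmentation : F.map (P.complex.d 1 0) ≫ F.map P.augmentation = 0 := by
  rw [← F.map_comp, d_augmentation, F.map_zero]

omit [Abelian D] [F.Additive] in
theorem epi_map_augmentation [PreservesFiniteColimits F] : Epi (F.map P.augmentation) :=
  inferInstance

theorem exact_map_augmentation [PreservesFiniteColimits F] :
    (ShortComplex.mk _ _ (F.map_d_augmentation P)).Exact :=
  have : Epi (ShortComplex.mk _ _ P.d_augmentation).g := inferInstanceAs (Epi P.augmentation)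
  ShortComplex.exact_of_g_is_cokernel _
    (CokernelCofork.mapIsColimit _ P.exact_augmentation.gIsCokernel F)

variable (hS : S.ShortExact) [Projective S.X₂]

/-- The map from the first homology of a spliced resolution to the value of the functor. -/
def homologyToObj :
    (HomologicalComplex.homologyFunctor D _ 1).obj
      ((F.mapHomologicalComplex _).obj (splice hS P).complex) ⟶ F.obj S.X₁ :=
  ChainComplex.homologyOneDesc (K := (F.mapHomologicalComplex _).obj (splice hS P).complex)
    (q := F.map P.augmentation) (F.map_d_augmentation P)

theorem map_augmentation_comp : F.map P.augmentation ≫ F.map S.f =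
    ((F.mapHomologicalComplex _).obj (splice hS P).complex).d 1 0 :=
  (F.map_comp _ _).symm

theorem homologyToObj_map : F.homologyToObj P hS ≫ F.map S.f = 0 :=
  ChainComplex.homologyOneDesc_comp (K := (F.mapHomologicalComplex _).obj (splice hS P).complex)
    _ (F.map_augmentation_comp P hS)

theorem mono_homologyToObj [PreservesFiniteColimits F] : Mono (F.homologyToObj P hS) :=
  ChainComplex.mono_homologyOneDesc (K := (F.mapHomologicalComplex _).obj (splice hS P).complex)
    (q := F.map P.augmentation) _ (F.epi_map_augmentation P) (F.exact_map_augmentation P)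

theorem exact_homologyToObj [PreservesFiniteColimits F] :
    (ShortComplex.mk _ _ (F.homologyToObj_map P hS)).Exact :=
  ChainComplex.exact_homologyOneDesc (K := (F.mapHomologicalComplex _).obj (splice hS P).complex)
    (q := F.map P.augmentation) _ (F.epi_map_augmentation P) (F.exact_map_augmentation P) (F.map_augmentation_comp P hS)

theorem homologyToObj_naturality {S' : ShortComplex C} (P' : ProjectiveResolution S'.X₁)
    (hS' : S'.ShortExact) [Projective S'.X₂] (φ : S ⟶ S') (ψ : P.complex ⟶ P'.complex)
    (hψ : ψ.f 0 ≫ P'.augmentation = P.augmentation ≫ φ.τ₁) :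
    (F.mapHomologicalComplex _ ⋙ HomologicalComplex.homologyFunctor D _ 1).map
        (spliceMap hS hS' P P' φ ψ hψ) ≫ F.homologyToObj P' hS' =
      F.homologyToObj P hS ≫ F.map φ.τ₁ :=
  ChainComplex.homologyOneDesc_naturality
    (K := (F.mapHomologicalComplex _).obj (splice hS P).complex)
    (K' := (F.mapHomologicalComplex _).obj (splice hS' P').complex)
    (q := F.map P.augmentation) (q' := F.map P'.augmentation) _ _
    ((F.mapHomologicalComplex _).map (spliceMap hS hS' P P' φ ψ hψ)) _
    ((F.map_comp _ _).symm.trans ((congrArg F.map hψ).trans (F.map_comp _ _)))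

end One

/-- The dimension shift for the first left derived functor of a right exact functor. -/
def leftDerivedOneShift [HasProjectiveResolutions C] [PreservesFiniteColimits F] :
    DimensionShift (F.leftDerived 1) F Projective where
  δ {S} hS h := ((splice hS (projectiveResolution S.X₁)).isoLeftDerivedObj F 1).hom ≫
    F.homologyToObj (projectiveResolution S.X₁) hS
  mono {S} hS h :=
    have := F.mono_homologyToObj (projectiveResolution S.X₁) hS
    mono_comp _ _
  w {S} hS h := by
    rw [Category.assoc, homologyToObj_map, comp_zero]
  exact {S} hS h :=
    (F.exact_homologyToObj (projectiveResolution S.X₁) hS).iso_comp _ _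
  naturality {S S'} hS h hS' h' φ := by
    have hψ := ProjectiveResolution.lift_commutes_zero φ.τ₁ (projectiveResolution S.X₁)
      (projectiveResolution S'.X₁)
    have h1 := isoLeftDerivedObj_hom_naturality φ.τ₃ _ _ _
      (spliceMap_comm hS hS' _ _ φ _ hψ) F 1
    have h2 := F.homologyToObj_naturality _ hS _ hS' φ _ hψ
    rw [← Category.assoc, h1, Category.assoc, h2, Category.assoc]

end Functor

end CategoryTheory

namespace CategoryTheory.DimensionShift

universe w₁ w₂ w₃ w₄

variable {C : Type w₁} [Category.{w₂} C] [Abelian C] {D : Type w₃} [Category.{w₄} D] [Abelian D]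

/-- A dimension shift restricts to smaller classes of middle terms. -/
def restrict {T' T : C ⥤ D} {good good' : C → Prop} (c : DimensionShift T' T good)
    (h : ∀ P, good' P → good P) : DimensionShift T' T good' where
  δ hS hP := c.δ hS (h _ hP)
  mono hS hP := c.mono hS (h _ hP)
  w hS hP := c.w hS (h _ hP)
  exact hS hP := c.exact hS (h _ hP)
  naturality hS hP hS' hP' φ := c.naturality hS (h _ hP) hS' (h _ hP') φ

end CategoryTheory.DimensionShift

namespace CategoryTheory.Abelian.Ext

universe w₁ w₂ w₃

variable (k : Type) [Field k] {C : Type w₁} [Category.{w₂} C] [Abelian C] [Linear k C]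
  [HasExt.{w₃} C] (X : C)

/-- The dimension shift for `Ext`. -/
def dimensionShift (j : ℕ) (good : C → Prop) (h : ∀ P, good P → Subsingleton (Ext X P j)) :
    DimensionShift (linearFunctor k X j) (linearFunctor k X (j + 1)) good where
  δ hS _ := connecting k X hS j
  mono hS hP :=
    have := h _ hP
    (ModuleCat.mono_iff_injective _).2 (connecting_injective k X hS j)
  w hS _ := ModuleCat.hom_ext (LinearMap.ext fun x =>
    (exists_connecting_eq_iff k X hS j _).1 ⟨x, rfl⟩)
  exact hS _ := (ShortComplex.moduleCat_exact_iff _).2 fun x hx =>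
    (exists_connecting_eq_iff k X hS j x).2 hx
  naturality hS _ hS' _ φ := connecting_naturality k X hS hS' φ j

end CategoryTheory.Abelian.Ext

/-! ### The free cover of a module -/

namespace ModuleCat

variable (R : Type) [Ring R] (M : ModuleCat.{v} R)

/-- The surjection from the free module on the elements of a module. -/
def freeCoverπ : ModuleCat.of R (M →₀ R) ⟶ M :=
  ModuleCat.ofHom (Finsupp.linearCombination R (id : M → M))

/-- The relations between the elements of a module. -/
def freeCoverKernel : ModuleCat.{v} R :=
  ModuleCat.of R (LinearMap.ker (Finsupp.linearCombination R (id : M → M)))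

/-- The inclusion of the relations in the free module on the elements of a module. -/
def freeCoverι : freeCoverKernel R M ⟶ ModuleCat.of R (M →₀ R) :=
  ModuleCat.ofHom (Submodule.subtype _)

theorem freeCoverι_π : freeCoverι R M ≫ freeCoverπ R M = 0 :=
  ModuleCat.hom_ext (LinearMap.ext fun x => x.2)

theorem freeCover_shortExact : (ShortComplex.mk _ _ (freeCoverι_π R M)).ShortExact where
  exact := (ShortComplex.moduleCat_exact_iff _).2 fun x hx => ⟨⟨x, hx⟩, rfl⟩
  mono_f := (ModuleCat.mono_iff_injective _).2 Subtype.val_injective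
  epi_g := (ModuleCat.epi_iff_surjective _).2 fun m => ⟨Finsupp.single m 1, by
    exact (Finsupp.linearCombination_single _ _ _).trans (one_smul _ _)⟩

theorem projective_freeCover : Projective (ModuleCat.of R (M →₀ R)) := inferInstance

end ModuleCat

/-! ### Poincaré duality -/

namespace FreeOrthogonal

open Abelian

variable {n : ℕ}

/-- The class of projective modules with the cohomology of a free module. -/
def CohomologicallyFree (P : ModuleCat.{v} (FreeOrthogonal n)) : Prop :=
  Projective P ∧ ∀ i, i ≠ 3 → Subsingleton (augCohomology (counit n) i P)

/-- The free cover of a module. -/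
def cover (hn : 2 ≤ n) (M : ModuleCat.{v} (FreeOrthogonal n)) :
    DimensionShift.Cover (CohomologicallyFree (n := n)) M where
  K := ModuleCat.freeCoverKernel (FreeOrthogonal n) M
  P := ModuleCat.of (FreeOrthogonal n) (M →₀ FreeOrthogonal n)
  ι := ModuleCat.freeCoverι (FreeOrthogonal n) M
  π := ModuleCat.freeCoverπ (FreeOrthogonal n) M
  w := ModuleCat.freeCoverι_π _ _
  shortExact := ModuleCat.freeCover_shortExact _ _
  projective := ModuleCat.projective_freeCover _ _
  good := ⟨ModuleCat.projective_freeCover _ _, fun i hi => subsingleton_ext_free hn i hi⟩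

/-- The dimension shift for cohomology. -/
def extShift (n j : ℕ) (hj : j ≠ 3) : DimensionShift
    (Ext.linearFunctor ℂ (trivialLeft.{v} (counit n)) j)
    (Ext.linearFunctor ℂ (trivialLeft.{v} (counit n)) (j + 1)) CohomologicallyFree :=
  Ext.dimensionShift _ _ _ _ fun _ hP => hP.2 j hj

/-- The dimension shift for homology. -/
def homologyShift (n i : ℕ) : DimensionShift (augHomology.{v} (counit n) (i + 2))
    (augHomology.{v} (counit n) (i + 1)) CohomologicallyFree :=
  (Functor.leftDerivedShift (relTensorFunctor.{v} ℂ (trivialRight (counit n))) i).restrict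
    fun _ hP => hP.1

/-- The dimension shift for homology in degree one. -/
def homologyOneShift (hn : 2 ≤ n) : DimensionShift (augHomology.{v} (counit n) 1)
    (relTensorFunctor.{v} ℂ (trivialRight (counit n))) CohomologicallyFree :=
  have := preservesFiniteColimits_relTensor.{v} hn
  (Functor.leftDerivedOneShift (relTensorFunctor.{v} ℂ (trivialRight (counit n)))).restrict
    fun _ hP => hP.1

/-- Poincaré duality in degree zero. -/
def dualityZero (hn : 2 ≤ n) : augHomology.{v} (counit n) 0 ≅
    Ext.linearFunctor ℂ (trivialLeft.{v} (counit n)) 3 :=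
  have := preservesFiniteColimits_relTensor.{v} hn
  (relTensorFunctor.{v} ℂ (trivialRight (counit n))).leftDerivedZeroIsoSelf ≪≫ relTensorIsoExt hn

/-- Poincaré duality in degree one. -/
def dualityOne (hn : 2 ≤ n) : augHomology.{v} (counit n) 1 ≅
    Ext.linearFunctor ℂ (trivialLeft.{v} (counit n)) 2 :=
  (homologyOneShift hn).isoOfIso (extShift n 2 (by norm_num)) (relTensorIsoExt hn) (cover hn)

/-- Poincaré duality in degree two. -/
def dualityTwo (hn : 2 ≤ n) : augHomology.{v} (counit n) 2 ≅
    Ext.linearFunctor ℂ (trivialLeft.{v} (counit n)) 1 :=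
  (homologyShift n 0).isoOfIso (extShift n 1 (by norm_num)) (dualityOne hn) (cover hn)

/-- Poincaré duality in degree three. -/
def dualityThree (hn : 2 ≤ n) : augHomology.{v} (counit n) 3 ≅
    Ext.linearFunctor ℂ (trivialLeft.{v} (counit n)) 0 :=
  (homologyShift n 1).isoOfIso (extShift n 0 (by norm_num)) (dualityTwo hn) (cover hn)

/-- On a free cover `0 → K → F → M → 0`, `H_4(M)` embeds in `H_3(K) ≅ Ext⁰(ℂ, K)`, which embeds in
`Ext⁰(ℂ, F) = 0`. Higher degrees follow by shifting. -/
theorem subsingleton_homology_of_lt (hn : 2 ≤ n) (i : ℕ) (M : ModuleCat.{v} (FreeOrthogonal n)) :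
    Subsingleton ((augHomology.{v} (counit n) (i + 4)).obj M) := by
  induction i generalizing M with
  | zero =>
    have hmono := (homologyShift n 2).mono (cover hn M).shortExact (cover hn M).good
    have h1 : Subsingleton (augCohomology (counit n) 0 (cover hn M).K) := by
      have h2 := (cover hn M).good.2 0 (by norm_num)
      have : Mono (cover hn M).ι := (cover hn M).shortExact.mono_f
      exact (Ext.postcomp_mk₀_injective_of_mono (trivialLeft.{v} (counit n))
        (cover hn M).ι).subsingleton
    have h3 : Subsingleton ((augHomology.{v} (counit n) 3).obj (cover hn M).K) :=
      @Equiv.subsingleton _ _ ((dualityThree hn).app (cover hn M).K).toLinearEquiv.toEquiv h1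
    exact ((ModuleCat.mono_iff_injective _).1 hmono).subsingleton
  | succ i ih =>
    have hmono := (homologyShift n (i + 3)).mono (cover hn M).shortExact (cover hn M).good
    have h3 := ih (cover hn M).K
    exact ((ModuleCat.mono_iff_injective _).1 hmono).subsingleton

theorem exists_equiv_of_iso {i j : ℕ} (α : augHomology.{v} (counit n) i ≅
    Ext.linearFunctor ℂ (trivialLeft.{v} (counit n)) j) :
    ∃ e : ∀ M : ModuleCat.{v} (FreeOrthogonal n),
        (augHomology (counit n) i).obj M ≃ₗ[ℂ] augCohomology (counit n) j M,
      ∀ (M M' : ModuleCat.{v} (FreeOrthogonal n)) (f : M ⟶ M')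
        (x : (augHomology (counit n) i).obj M),
        e M' ((augHomology (counit n) i).map f x) =
          augCohomology.map (counit n) j f (e M x) :=
  ⟨fun M => (α.app M).toLinearEquiv, fun _ _ f x =>
    LinearMap.congr_fun (congrArg ModuleCat.Hom.hom (α.hom.naturality f)) x⟩

theorem exists_duality (hn : 2 ≤ n) (i j : ℕ) (hij : i + j = 3) :
    ∃ e : ∀ M : ModuleCat.{v} (FreeOrthogonal n),
        (augHomology (counit n) i).obj M ≃ₗ[ℂ] augCohomology (counit n) j M,
      ∀ (M M' : ModuleCat.{v} (FreeOrthogonal n)) (f : M ⟶ M')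
        (x : (augHomology (counit n) i).obj M),
        e M' ((augHomology (counit n) i).map f x) =
          augCohomology.map (counit n) j f (e M x) := by
  obtain ⟨rfl, rfl⟩ | ⟨rfl, rfl⟩ | ⟨rfl, rfl⟩ | ⟨rfl, rfl⟩ :
      (i = 0 ∧ j = 3) ∨ (i = 1 ∧ j = 2) ∨ (i = 2 ∧ j = 1) ∨ (i = 3 ∧ j = 0) := by omega
  · exact exists_equiv_of_iso (dualityZero hn)
  · exact exists_equiv_of_iso (dualityOne hn)
  · exact exists_equiv_of_iso (dualityTwo hn)
  · exact exists_equiv_of_iso (dualityThree hn)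

end FreeOrthogonal

/-! ### Comultiplication, enveloping algebra and induced bimodules -/

namespace FreeOrthogonal

open MulOpposite

variable {n : ℕ}

/-- The enveloping algebra. -/
abbrev Enveloping (n : ℕ) : Type := FreeOrthogonal n ⊗[ℂ] (FreeOrthogonal n)ᵐᵒᵖ

/-- The comultiplication. -/
def comul (n : ℕ) : FreeOrthogonal n →ₐ[ℂ] FreeOrthogonal n ⊗[ℂ] FreeOrthogonal n :=
  lift (fun i j => ∑ k, u n i k ⊗ₜ[ℂ] u n k j)
    (fun i j => by
      simp only [Finset.sum_mul_sum, Algebra.TensorProduct.tmul_mul_tmul]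
      rw [Finset.sum_comm]
      have h (k : Fin n) : ∑ m, ∑ l, (u n i k * u n j l) ⊗ₜ[ℂ] (u n k m * u n l m) =
          (u n i k * u n j k) ⊗ₜ[ℂ] 1 := by
        rw [Finset.sum_comm]
        simp only [← tmul_sum, sum_row, tmul_ite, Finset.sum_ite_eq, Finset.mem_univ, if_true]
      rw [Finset.sum_congr rfl fun k _ => h k, ← sum_tmul, sum_row, ite_tmul]
      rfl)
    (fun i j => by
      simp only [Finset.sum_mul_sum, Algebra.TensorProduct.tmul_mul_tmul]
      rw [Finset.sum_comm]
      have h (k : Fin n) : ∑ m, ∑ l, (u n m k * u n m l) ⊗ₜ[ℂ] (u n k i * u n l j) =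
          1 ⊗ₜ[ℂ] (u n k i * u n k j) := by
        rw [Finset.sum_comm]
        simp only [← sum_tmul, sum_col, ite_tmul, Finset.sum_ite_eq, Finset.mem_univ, if_true]
      rw [Finset.sum_congr rfl fun k _ => h k, ← tmul_sum, sum_col, tmul_ite]
      rfl)

theorem comul_u (i j : Fin n) : comul n (u n i j) = ∑ k, u n i k ⊗ₜ[ℂ] u n k j := by
  rw [comul, lift_u]

theorem counit_comul (a : FreeOrthogonal n) :
    TensorProduct.lid ℂ _ (TensorProduct.map (counit n).toLinearMap LinearMap.id (comul n a)) = a := by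
  have h : ((Algebra.TensorProduct.lid ℂ (FreeOrthogonal n)).toAlgHom.comp
      (Algebra.TensorProduct.map (counit n) (AlgHom.id ℂ _))).comp (comul n) = AlgHom.id ℂ _ :=
    algHom_ext fun i j => by
      simp [comul_u, counit_u]
  exact DFunLike.congr_fun h a

/-- The homomorphism `a ↦ a₁ ⊗ S(a₂)` to the enveloping algebra. -/
def twist (n : ℕ) : FreeOrthogonal n →ₐ[ℂ] Enveloping n :=
  (Algebra.TensorProduct.map (AlgHom.id ℂ _) (antipode n)).comp (comul n)

theorem twist_u (i j : Fin n) : twist n (u n i j) = ∑ k, u n i k ⊗ₜ op (u n j k) := by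
  simp [twist, comul_u, antipode_u]

/-- The linear map `a ⊗ b ↦ (1 ⊗ b) a₁ ⊗ S(a₂)`. -/
def untwist (n : ℕ) : FreeOrthogonal n ⊗[ℂ] FreeOrthogonal n →ₗ[ℂ] Enveloping n :=
  TensorProduct.lift ((LinearMap.mul ℂ (Enveloping n)).flip.compl₁₂ (twist n).toLinearMap
    ((TensorProduct.mk ℂ (FreeOrthogonal n) (FreeOrthogonal n)ᵐᵒᵖ 1) ∘ₗ
      (opLinearEquiv ℂ).toLinearMap))

theorem untwist_tmul (a b : FreeOrthogonal n) :
    untwist n (a ⊗ₜ b) = (1 ⊗ₜ op b) * twist n a := rfl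

/-- In Sweedler notation the case `t = 1` is `a₁ ⊗ S(a₂) a₃ = a ⊗ 1`. The general `t` makes the
statement multiplicative in `a`, so that generators suffice. -/
theorem untwist_comul_mul (a : FreeOrthogonal n) (t : FreeOrthogonal n ⊗[ℂ] FreeOrthogonal n) :
    untwist n (comul n a * t) = (a ⊗ₜ 1) * untwist n t := by
  induction a using FreeOrthogonal.induction generalizing t with
  | hc c =>
    rw [AlgHom.commutes, ← Algebra.smul_def, map_smul, Algebra.algebraMap_eq_smul_one,
      ← smul_tmul', ← Algebra.TensorProduct.one_def, smul_mul_assoc, one_mul]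
  | hu i j =>
    induction t using TensorProduct.induction_on with
    | zero => simp
    | add s t hs ht => rw [mul_add, map_add, hs, ht, map_add, mul_add]
    | tmul x y =>
      -- The antipode identity on generators, which amounts to the column relations.
      have h : ∑ k, (1 ⊗ₜ op (u n k j) : Enveloping n) * twist n (u n i k) = u n i j ⊗ₜ 1 := by
        simp only [twist_u, Finset.mul_sum, Algebra.TensorProduct.tmul_mul_tmul, one_mul, ← op_mul]
        rw [Finset.sum_comm]
        have h1 (l : Fin n) : ∑ k, u n i l ⊗ₜ[ℂ] op (u n k l * u n k j) =
            if l = j then u n i l ⊗ₜ 1 else 0 := by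
          rw [← tmul_sum, ← Finset.op_sum, sum_col, ← tmul_ite]
          split_ifs <;> rfl
        rw [Finset.sum_congr rfl fun l _ => h1 l]
        simp
      have h2 : (u n i j ⊗ₜ 1 : Enveloping n) * ((1 ⊗ₜ op y) * twist n x) =
          (1 ⊗ₜ op y) * ((u n i j ⊗ₜ 1) * twist n x) := by
        rw [← mul_assoc, ← mul_assoc]
        simp only [Algebra.TensorProduct.tmul_mul_tmul, one_mul, mul_one]
      rw [comul_u, Finset.sum_mul, map_sum, untwist_tmul, h2, ← h, Finset.sum_mul, Finset.mul_sum]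
      refine Finset.sum_congr rfl fun k _ => ?_
      rw [Algebra.TensorProduct.tmul_mul_tmul, untwist_tmul, map_mul, op_mul,
        ← mul_one (1 : FreeOrthogonal n), ← Algebra.TensorProduct.tmul_mul_tmul, mul_one]
      simp only [mul_assoc]
  | hadd a b ha hb => rw [map_add, add_mul, map_add, ha, hb, add_tmul, add_mul]
  | hmul a b ha hb =>
    rw [map_mul (comul n), mul_assoc, ha, hb, ← mul_assoc, Algebra.TensorProduct.tmul_mul_tmul,
      one_mul]

theorem untwist_comul (a : FreeOrthogonal n) : untwist n (comul n a) = a ⊗ₜ 1 := by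
  have h := untwist_comul_mul a 1
  rwa [mul_one, Algebra.TensorProduct.one_def, untwist_tmul, map_one, mul_one, op_one,
    ← Algebra.TensorProduct.one_def, mul_one] at h

section Induced

variable (M : Type) [AddCommGroup M] [Module ℂ M]

/-- The bimodule induced by a left module. -/
def Induced (n : ℕ) (M : Type) [AddCommGroup M] [Module ℂ M] : Type := M ⊗[ℂ] FreeOrthogonal n

instance : AddCommGroup (Induced n M) := inferInstanceAs (AddCommGroup (M ⊗[ℂ] FreeOrthogonal n))

instance : Module ℂ (Induced n M) := inferInstanceAs (Module ℂ (M ⊗[ℂ] FreeOrthogonal n))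

variable {M} in
/-- The pure tensors of an induced bimodule. -/
def Induced.mk (m : M) (x : FreeOrthogonal n) : Induced n M := m ⊗ₜ[ℂ] x

variable {M} in
theorem Induced.induction {P : Induced n M → Prop} (h0 : P 0) (hmk : ∀ m x, P (Induced.mk m x))
    (hadd : ∀ s t, P s → P t → P (s + t)) (t : Induced n M) : P t :=
  TensorProduct.induction_on (motive := P) t h0 hmk hadd

variable {M} in
theorem Induced.hom_ext {N : Type*} [AddCommGroup N] [Module ℂ N] {f g : Induced n M →ₗ[ℂ] N}
    (h : ∀ m x, f (Induced.mk m x) = g (Induced.mk m x)) : f = g :=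
  TensorProduct.ext' h

/-- The right action on the tensor product with a module. -/
def rightAction : (FreeOrthogonal n)ᵐᵒᵖ →ₐ[ℂ] Module.End ℂ (Induced n M) :=
  ((Module.endTensorEndAlgHom (R := ℂ) (S := ℂ) (A := ℂ) (M := M) (N := FreeOrthogonal n)).comp
    Algebra.TensorProduct.includeRight).comp (Algebra.lsmul ℂ ℂ (FreeOrthogonal n))

variable {M} in
theorem rightAction_op (b x : FreeOrthogonal n) (m : M) :
    rightAction M (op b) (Induced.mk m x) = Induced.mk m (x * b) := rfl

variable [Module (FreeOrthogonal n) M] [IsScalarTower ℂ (FreeOrthogonal n) M]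

/-- The action of the tensor square of the algebra on the tensor product with a module. -/
def tensorAction : FreeOrthogonal n ⊗[ℂ] FreeOrthogonal n →ₐ[ℂ] Module.End ℂ (Induced n M) :=
  (Module.endTensorEndAlgHom (R := ℂ) (S := ℂ) (A := ℂ) (M := M) (N := FreeOrthogonal n)).comp
    (Algebra.TensorProduct.map (Algebra.lsmul ℂ ℂ M) (Algebra.lmul ℂ (FreeOrthogonal n)))

variable {M} in
theorem tensorAction_tmul (a b x : FreeOrthogonal n) (m : M) :
    tensorAction M (a ⊗ₜ b) (Induced.mk m x) = Induced.mk (a • m) (b * x) := rfl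

theorem tensorAction_comm_rightAction (t : FreeOrthogonal n ⊗[ℂ] FreeOrthogonal n)
    (b : (FreeOrthogonal n)ᵐᵒᵖ) : Commute (tensorAction M t) (rightAction M b) := by
  induction t using TensorProduct.induction_on with
  | zero => rw [map_zero]; exact Commute.zero_left _
  | add s t hs ht => rw [map_add]; exact hs.add_left ht
  | tmul x y =>
    refine Induced.hom_ext fun m z => ?_
    change Induced.mk (x • m) (y * (z * b.unop)) = Induced.mk (x • m) (y * z * b.unop)
    rw [mul_assoc]

/-- The action of the enveloping algebra on an induced bimodule. -/
def envelopingAction : Enveloping n →ₐ[ℂ] Module.End ℂ (Induced n M) :=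
  Algebra.TensorProduct.lift ((tensorAction M).comp (comul n)) (rightAction M)
    fun _ _ => tensorAction_comm_rightAction M _ _

instance : Module (Enveloping n) (Induced n M) :=
  Module.compHom _ (envelopingAction M).toRingHom

theorem tmul_smul_induced (a : FreeOrthogonal n) (b : (FreeOrthogonal n)ᵐᵒᵖ) (t : Induced n M) :
    (a ⊗ₜ b : Enveloping n) • t = tensorAction M (comul n a) (rightAction M b t) := by
  have h : envelopingAction M (a ⊗ₜ b) = tensorAction M (comul n a) * rightAction M b :=
    Algebra.TensorProduct.lift_tmul _ _ _ _ _
  exact LinearMap.congr_fun h t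

end Induced

end FreeOrthogonal

/-! ### Exactness of induction, and induction of free modules -/

namespace FreeOrthogonal

open MulOpposite

variable {n : ℕ}

section Map

variable {M M' : Type} [AddCommGroup M] [Module ℂ M] [AddCommGroup M'] [Module ℂ M']

/-- A linear map of the first factor, as a map of induced bimodules. -/
noncomputable def Induced.mapₗ (f : M →ₗ[ℂ] M') : Induced n M →ₗ[ℂ] Induced n M' :=
  f.rTensor (FreeOrthogonal n)

theorem mapₗ_rightAction (f : M →ₗ[ℂ] M') (b : (FreeOrthogonal n)ᵐᵒᵖ) (t : Induced n M) :
    Induced.mapₗ f (rightAction M b t) = rightAction M' b (Induced.mapₗ f t) := by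
  induction t using Induced.induction with
  | h0 => simp only [map_zero]
  | hadd x y hx hy => simp only [map_add, hx, hy]
  | hmk m x => rfl

variable [Module (FreeOrthogonal n) M] [IsScalarTower ℂ (FreeOrthogonal n) M]
  [Module (FreeOrthogonal n) M'] [IsScalarTower ℂ (FreeOrthogonal n) M']

theorem map_smul_of_map_tmul_smul {N : Type*} [AddCommGroup N] [Module ℂ N]
    [Module (Enveloping n) N] (f : Induced n M →ₗ[ℂ] N)
    (h : ∀ a b t, f ((a ⊗ₜ b : Enveloping n) • t) = (a ⊗ₜ b : Enveloping n) • f t)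
    (z : Enveloping n) (t : Induced n M) : f (z • t) = z • f t := by
  induction z using TensorProduct.induction_on with
  | zero =>
    exact (congrArg f (zero_smul (Enveloping n) t)).trans
      ((map_zero f).trans (zero_smul (Enveloping n) (f t)).symm)
  | tmul a b => exact h a b t
  | add x y hx hy => rw [add_smul, add_smul, map_add, hx, hy]

theorem mapₗ_tensorAction (f : M →ₗ[FreeOrthogonal n] M')
    (s : FreeOrthogonal n ⊗[ℂ] FreeOrthogonal n) (t : Induced n M) :
    Induced.mapₗ (f.restrictScalars ℂ) (tensorAction M s t) =
      tensorAction M' s (Induced.mapₗ (f.restrictScalars ℂ) t) := by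
  induction s using TensorProduct.induction_on with
  | zero => simp only [map_zero, LinearMap.zero_apply]
  | add x y hx hy => simp only [map_add, LinearMap.add_apply, hx, hy]
  | tmul a b =>
    induction t using Induced.induction with
    | h0 => simp only [map_zero]
    | hadd x y hx hy => simp only [map_add, hx, hy]
    | hmk m x => exact congrArg (fun y => Induced.mk y (b * x)) (map_smul f a m)

/-- The map of induced bimodules defined by a map of left modules. -/
noncomputable def Induced.map (f : M →ₗ[FreeOrthogonal n] M') : Induced n M →ₗ[Enveloping n] Induced n M' where
  toFun := Induced.mapₗ (f.restrictScalars ℂ)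
  map_add' := map_add _
  map_smul' z t := by
    refine map_smul_of_map_tmul_smul _ (fun a b t => ?_) z t
    rw [tmul_smul_induced, tmul_smul_induced, mapₗ_tensorAction, mapₗ_rightAction]

theorem Induced.map_mk (f : M →ₗ[FreeOrthogonal n] M') (m : M) (x : FreeOrthogonal n) :
    Induced.map f (Induced.mk m x) = Induced.mk (f m) x := rfl

theorem Induced.exact_map {M'' : Type} [AddCommGroup M''] [Module ℂ M'']
    [Module (FreeOrthogonal n) M''] [IsScalarTower ℂ (FreeOrthogonal n) M'']
    (f : M →ₗ[FreeOrthogonal n] M') (g : M' →ₗ[FreeOrthogonal n] M'') (h : Function.Exact f g) :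
    Function.Exact (Induced.map f) (Induced.map g) :=
  Module.Flat.rTensor_exact (R := ℂ) (FreeOrthogonal n) (f := f.restrictScalars ℂ)
    (g := g.restrictScalars ℂ) h

theorem Induced.map_injective (f : M →ₗ[FreeOrthogonal n] M') (h : Function.Injective f) :
    Function.Injective (Induced.map f) :=
  Module.Flat.rTensor_preserves_injective_linearMap (R := ℂ) (M := FreeOrthogonal n)
    (f.restrictScalars ℂ) h

theorem op_smul_mk (b x : FreeOrthogonal n) (m : M) :
    (1 ⊗ₜ op b : Enveloping n) • Induced.mk m x = Induced.mk m (x * b) := by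
  rw [tmul_smul_induced, map_one, map_one]
  rfl

/-- In Sweedler notation, `a₁ m ⊗ a₂ S(a₃) = a m ⊗ 1`; on generators this is the row relation. It
gives one half of the equivalence between free and induced bimodules, `untwist_comul` the other. -/
theorem twist_smul_mk_one (a : FreeOrthogonal n) (m : M) :
    twist n a • (Induced.mk m 1 : Induced n M) = Induced.mk (a • m) 1 := by
  induction a using FreeOrthogonal.induction generalizing m with
  | hc c =>
    rw [AlgHom.commutes, Algebra.algebraMap_eq_smul_one, Algebra.algebraMap_eq_smul_one,
      Algebra.TensorProduct.one_def, smul_tmul', tmul_smul_induced, map_smul, map_one, map_smul,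
      map_one, map_one, smul_assoc, one_smul]
    rfl
  | hu i j =>
    rw [twist_u, Finset.sum_smul]
    have h (k : Fin n) : (u n i k ⊗ₜ op (u n j k) : Enveloping n) • (Induced.mk m 1 : Induced n M) =
        ∑ l, Induced.mk (u n i l • m) (u n l k * u n j k) := by
      rw [tmul_smul_induced, comul_u, map_sum, LinearMap.sum_apply, rightAction_op, one_mul]
      rfl
    rw [Finset.sum_congr rfl fun k _ => h k, Finset.sum_comm]
    have h1 (l : Fin n) : ∑ k, Induced.mk (u n i l • m) (u n l k * u n j k) =
        if l = j then Induced.mk (u n i l • m) 1 else 0 := by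
      refine (tmul_sum _ _ _).symm.trans ?_
      rw [sum_row, tmul_ite]
      rfl
    rw [Finset.sum_congr rfl fun l _ => h1 l]
    simp
  | hadd a b ha hb =>
    rw [map_add, add_smul, ha, hb, add_smul]
    exact (add_tmul _ _ _).symm
  | hmul a b ha hb => rw [map_mul, mul_smul, hb, ha, mul_smul]

end Map

section Free

variable (n) (ι : Type) [Fintype ι] [DecidableEq ι]

/-- The map from a free bimodule to the bimodule induced from a free module. -/
noncomputable def freeToInduced : (ι → Enveloping n) →ₗ[Enveloping n] Induced n (ι → FreeOrthogonal n) :=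
  Fintype.linearCombination (Enveloping n) fun i => Induced.mk (Pi.single i 1) 1

/-- The map from the bimodule induced from a free module to a free bimodule. -/
noncomputable def inducedToFree : Induced n (ι → FreeOrthogonal n) →ₗ[ℂ] (ι → Enveloping n) :=
  LinearMap.pi fun i => untwist n ∘ₗ Induced.mapₗ (M := ι → FreeOrthogonal n)
    (M' := FreeOrthogonal n) (LinearMap.proj i)

variable {n ι}

theorem freeToInduced_single (i : ι) (z : Enveloping n) :
    freeToInduced n ι (Pi.single i z) = z • Induced.mk (Pi.single i 1) 1 :=
  Fintype.linearCombination_apply_single _ _ _ _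

omit [Fintype ι] [DecidableEq ι] in
theorem inducedToFree_mk (x : ι → FreeOrthogonal n) (y : FreeOrthogonal n) (i : ι) :
    inducedToFree n ι (Induced.mk x y) i = (1 ⊗ₜ op y) * twist n (x i) := rfl

theorem freeToInduced_inducedToFree (t : Induced n (ι → FreeOrthogonal n)) :
    freeToInduced n ι (inducedToFree n ι t) = t := by
  induction t using Induced.induction with
  | h0 => simp only [map_zero]
  | hadd x y hx hy => simp only [map_add, hx, hy]
  | hmk x y =>
    rw [freeToInduced, Fintype.linearCombination_apply]
    simp only [inducedToFree_mk, mul_smul, twist_smul_mk_one, op_smul_mk, one_mul]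
    refine (sum_tmul _ _ _).symm.trans (congrArg (fun z => Induced.mk z y) ?_)
    ext i
    simp [Finset.sum_apply, Pi.single_apply]

omit [Fintype ι] in
theorem inducedToFree_tensorAction (s : FreeOrthogonal n ⊗[ℂ] FreeOrthogonal n)
    (b : FreeOrthogonal n) (i : ι) :
    inducedToFree n ι (tensorAction _ s (Induced.mk (Pi.single i 1) b)) =
      Pi.single i ((1 ⊗ₜ op b) * untwist n s) := by
  induction s using TensorProduct.induction_on with
  | zero => simp only [map_zero, LinearMap.zero_apply, mul_zero, Pi.single_zero]
  | add x y hx hy => simp only [map_add, LinearMap.add_apply, hx, hy, mul_add, Pi.single_add]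
  | tmul x y =>
    rw [tensorAction_tmul]
    ext k
    rw [inducedToFree_mk, Pi.smul_apply, untwist_tmul, ← mul_assoc,
      Algebra.TensorProduct.tmul_mul_tmul, one_mul, ← op_mul]
    by_cases h : k = i
    · subst h
      rw [Pi.single_eq_same, Pi.single_eq_same, smul_eq_mul, mul_one]
    · rw [Pi.single_eq_of_ne h, Pi.single_eq_of_ne h, smul_zero, map_zero, mul_zero]

omit [Fintype ι] in
theorem inducedToFree_smul (z : Enveloping n) (i : ι) :
    inducedToFree n ι (z • Induced.mk (Pi.single i 1) 1) = Pi.single i z := by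
  induction z using TensorProduct.induction_on with
  | zero =>
    exact (congrArg (inducedToFree n ι) (zero_smul (Enveloping n) _)).trans
      ((map_zero _).trans (Pi.single_zero i).symm)
  | add x y hx hy => rw [add_smul, map_add, hx, hy, Pi.single_add]
  | tmul a b =>
    rw [tmul_smul_induced, ← op_unop b, rightAction_op, one_mul, inducedToFree_tensorAction,
      untwist_comul, Algebra.TensorProduct.tmul_mul_tmul, one_mul, mul_one]

theorem inducedToFree_freeToInduced (z : ι → Enveloping n) :
    inducedToFree n ι (freeToInduced n ι z) = z := by
  rw [freeToInduced, Fintype.linearCombination_apply, map_sum]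
  simp only [inducedToFree_smul]
  exact Finset.univ_sum_single z

variable (n ι) in
/-- The bimodule induced from a free module is free. -/
noncomputable def freeEquivInduced : (ι → Enveloping n) ≃ₗ[Enveloping n] Induced n (ι → FreeOrthogonal n) :=
  LinearEquiv.ofBijective (freeToInduced n ι)
    ⟨Function.LeftInverse.injective inducedToFree_freeToInduced,
      Function.RightInverse.surjective freeToInduced_inducedToFree⟩

theorem freeEquivInduced_single (i : ι) (z : Enveloping n) :
    freeEquivInduced n ι (Pi.single i z) = z • Induced.mk (Pi.single i 1) 1 :=
  freeToInduced_single i z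

instance : Module.Finite (Enveloping n) (Induced n (ι → FreeOrthogonal n)) :=
  Module.Finite.equiv (freeEquivInduced n ι)

instance : Module.Projective (Enveloping n) (Induced n (ι → FreeOrthogonal n)) :=
  Module.Projective.of_equiv (freeEquivInduced n ι)

end Free

section Augmentation

/-- The augmentation of the resolution of the diagonal bimodule, as a linear map. -/
noncomputable def inducedAugmentₗ (n : ℕ) : Induced n (PUnit.{1} → FreeOrthogonal n) →ₗ[ℂ] FreeOrthogonal n :=
  (TensorProduct.lid ℂ (FreeOrthogonal n)).toLinearMap ∘ₗ
    LinearMap.rTensor (FreeOrthogonal n) ((counit n).toLinearMap ∘ₗ LinearMap.proj PUnit.unit)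

theorem inducedAugmentₗ_mk (x : PUnit.{1} → FreeOrthogonal n) (y : FreeOrthogonal n) :
    inducedAugmentₗ n (Induced.mk x y) = counit n (x ⟨⟩) • y := rfl

/-- For `s` the comultiplication of `a`, the first factor on the right is `ε(a₁) a₂ = a`. This is
why the augmentation respects the left action. -/
theorem inducedAugmentₗ_tensorAction (s : FreeOrthogonal n ⊗[ℂ] FreeOrthogonal n)
    (x : PUnit.{1} → FreeOrthogonal n) (y : FreeOrthogonal n) :
    inducedAugmentₗ n (tensorAction _ s (Induced.mk x y)) =
      TensorProduct.lid ℂ _ (TensorProduct.map (counit n).toLinearMap LinearMap.id s) *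
        (counit n (x ⟨⟩) • y) := by
  induction s using TensorProduct.induction_on with
  | zero => simp only [map_zero, LinearMap.zero_apply, zero_mul]
  | add a b ha hb => simp only [map_add, LinearMap.add_apply, ha, hb, add_mul]
  | tmul a b =>
    rw [tensorAction_tmul, inducedAugmentₗ_mk, TensorProduct.map_tmul, TensorProduct.lid_tmul,
      Pi.smul_apply, smul_eq_mul, map_mul, mul_smul]
    change _ = (counit n a • b) * (counit n (x ⟨⟩) • y)
    rw [smul_mul_smul_comm, mul_smul]

theorem inducedAugmentₗ_tmul_smul (a : FreeOrthogonal n) (b : (FreeOrthogonal n)ᵐᵒᵖ)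
    (t : Induced n (PUnit.{1} → FreeOrthogonal n)) :
    inducedAugmentₗ n ((a ⊗ₜ b : Enveloping n) • t) =
      AlgHom.mulLeftRight ℂ (FreeOrthogonal n) (a ⊗ₜ b) (inducedAugmentₗ n t) := by
  induction t using Induced.induction with
  | h0 => rw [smul_zero, map_zero, map_zero]
  | hadd x y hx hy => rw [smul_add, map_add, map_add, map_add, hx, hy]
  | hmk x y =>
    rw [tmul_smul_induced, ← op_unop b, rightAction_op, inducedAugmentₗ_tensorAction,
      counit_comul, AlgHom.mulLeftRight_apply, inducedAugmentₗ_mk, unop_op, mul_assoc,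
      smul_mul_assoc]

/-- The augmentation of the resolution of the diagonal bimodule. -/
noncomputable def inducedAugment (n : ℕ) : Induced n (PUnit.{1} → FreeOrthogonal n) →ₗ[Enveloping n]
    diagonalBimodule ℂ (FreeOrthogonal n) where
  toFun t := inducedAugmentₗ n t
  map_add' := map_add (inducedAugmentₗ n)
  map_smul' z t := by
    change inducedAugmentₗ n (z • t) =
      AlgHom.mulLeftRight ℂ (FreeOrthogonal n) z (inducedAugmentₗ n t)
    induction z using TensorProduct.induction_on with
    | zero =>
      rw [map_zero, LinearMap.zero_apply]
      exact (congrArg (inducedAugmentₗ n) (zero_smul (Enveloping n) t)).trans (map_zero _)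
    | tmul a b => exact inducedAugmentₗ_tmul_smul a b t
    | add x y hx hy => rw [add_smul, map_add, map_add, LinearMap.add_apply, hx, hy]

theorem inducedAugment_surjective (n : ℕ) : Function.Surjective (inducedAugment n) :=
  fun (a : FreeOrthogonal n) => ⟨Induced.mk (fun _ => 1) a, by
    change counit n 1 • a = a
    rw [map_one, one_smul]⟩

theorem exact_dOne_counit (n : ℕ) : Function.Exact (dOne.{0} n)
    ((counit n).toLinearMap ∘ₗ LinearMap.proj (R := ℂ) (φ := fun _ : PUnit.{1} => FreeOrthogonal n)
      PUnit.unit) := fun x => by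
  constructor
  · intro hx
    obtain ⟨y, hy⟩ := exists_of_counit_eq_zero_right (a := x ⟨⟩) hx
    exact ⟨fun p => y p.down.1 p.down.2, funext fun _ => hy.symm⟩
  · rintro ⟨y, rfl⟩
    exact congrArg ULift.down.{0} (augment_dOne.{0} y)

/-- Tensoring the exact sequence ending in `ℂ` with `A` over the field keeps it exact, and `ℂ ⊗ A`
is `A`. -/
theorem exact_map_dOne_inducedAugment (n : ℕ) :
    Function.Exact (Induced.map (dOne.{0} n)) (inducedAugment n) := fun t => by
  have h := Module.Flat.rTensor_exact (R := ℂ) (FreeOrthogonal n)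
    (f := (dOne.{0} n).restrictScalars ℂ) (exact_dOne_counit n) t
  refine Iff.trans ?_ h
  exact (TensorProduct.lid ℂ (FreeOrthogonal n)).map_eq_zero_iff

theorem exact_dTwo_dOne (n : ℕ) : Function.Exact (dTwo.{0} n) (dOne.{0} n) := fun y => by
  constructor
  · intro hy
    obtain ⟨c, hc⟩ := exists_of_sum_eq_zero_right (y := fun i j => y ⟨i, j⟩) (congrFun hy ⟨⟩)
    exact ⟨fun p => c p.down.1 p.down.2, funext fun p => (hc p.down.1 p.down.2).symm⟩
  · rintro ⟨c, rfl⟩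
    exact dOne_dTwo c

theorem exact_dThree_dTwo (hn : 2 ≤ n) : Function.Exact (dThree.{0} n) (dTwo.{0} n) := fun c => by
  constructor
  · intro hc
    obtain ⟨x, hx⟩ := exists_of_cocycle_right hn (c := fun i j => c ⟨i, j⟩)
      (fun i j => congrFun hc ⟨i, j⟩)
    exact ⟨fun _ => x, funext fun p => (hx p.down.1 p.down.2).symm⟩
  · rintro ⟨x, rfl⟩
    exact dTwo_dThree x

theorem dThree_injective (hn : 2 ≤ n) : Function.Injective (dThree.{0} n) :=
  (injective_iff_map_eq_zero _).2 fun x hx => by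
    refine funext fun _ => eq_zero_of_invariant_right hn fun i j => ?_
    exact sub_eq_zero.1 (congrFun hx ⟨i, j⟩)

end Augmentation

end FreeOrthogonal

/-! ### Smoothness and the dimension -/

namespace FreeOrthogonal

open MulOpposite

variable {n : ℕ}

instance projective_induced (ι : Type) [Finite ι] :
    Projective (ModuleCat.of (Enveloping n) (Induced n (ι → FreeOrthogonal n))) :=
  have := Fintype.ofFinite ι
  have := Classical.decEq ι
  inferInstance

/-- The resolution of the diagonal bimodule of `A_o(n)`. -/
noncomputable def bimoduleResolution (hn : 2 ≤ n) :
    ProjectiveResolution (diagonalBimodule ℂ (FreeOrthogonal n)) :=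
  ProjectiveResolution.ofFourTerm
    (d₁ := ModuleCat.ofHom (Induced.map (dOne.{0} n)))
    (d₂ := ModuleCat.ofHom (Induced.map (dTwo.{0} n)))
    (d₃ := ModuleCat.ofHom (Induced.map (dThree.{0} n)))
    (p := ModuleCat.homEquiv.symm (inducedAugment n))
    (h₁ := ModuleCat.hom_ext (LinearMap.ext
      (Induced.exact_map _ _ (exact_dTwo_dOne n)).apply_apply_eq_zero))
    (h₂ := ModuleCat.hom_ext (LinearMap.ext
      (Induced.exact_map _ _ (exact_dThree_dTwo hn)).apply_apply_eq_zero))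
    (w := ModuleCat.hom_ext (LinearMap.ext
      (exact_map_dOne_inducedAugment n).apply_apply_eq_zero))
    ((ModuleCat.epi_iff_surjective _).2 (inducedAugment_surjective n))
    ((ShortComplex.moduleCat_exact_iff _).2 fun x hx =>
      (exact_map_dOne_inducedAugment n x).1 hx)
    ((ShortComplex.moduleCat_exact_iff _).2 fun x hx =>
      (Induced.exact_map _ _ (exact_dTwo_dOne n) x).1 hx)
    ((ShortComplex.moduleCat_exact_iff _).2 fun x hx =>
      (Induced.exact_map _ _ (exact_dThree_dTwo hn) x).1 hx)
    ((ModuleCat.mono_iff_injective _).2 (Induced.map_injective _ (dThree_injective hn)))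

theorem isZero_bimoduleResolution (hn : 2 ≤ n) (i : ℕ) (hi : 3 < i) :
    Limits.IsZero ((bimoduleResolution hn).complex.X i) :=
  ProjectiveResolution.isZero_ofFourTerm _ _ _ _ _ i hi

theorem isSmoothAlgebra (hn : 2 ≤ n) : IsSmoothAlgebra ℂ (FreeOrthogonal n) := by
  refine ⟨bimoduleResolution hn, fun i => ?_, 3, isZero_bimoduleResolution hn⟩
  match i with
  | 0 => exact inferInstanceAs
      (Module.Finite (Enveloping n) (Induced n (PUnit.{1} → FreeOrthogonal n)))
  | 1 => exact inferInstanceAs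
      (Module.Finite (Enveloping n) (Induced n (Index.{0} n → FreeOrthogonal n)))
  | 2 => exact inferInstanceAs
      (Module.Finite (Enveloping n) (Induced n (Index.{0} n → FreeOrthogonal n)))
  | 3 => exact inferInstanceAs
      (Module.Finite (Enveloping n) (Induced n (PUnit.{1} → FreeOrthogonal n)))
  | i + 4 =>
    have := ModuleCat.subsingleton_of_isZero (isZero_bimoduleResolution hn (i + 4) (by omega))
    infer_instance

theorem subsingleton_ext_diagonal (hn : 2 ≤ n) (N : ModuleCat.{0} (Enveloping n)) {i : ℕ}
    (hi : 3 < i) : Subsingleton (Abelian.Ext (diagonalBimodule ℂ (FreeOrthogonal n)) N i) := by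
  refine subsingleton_of_forall_eq 0 fun x => ?_
  obtain ⟨f, hf, rfl⟩ := (bimoduleResolution hn).extMk_surjective x (i + 1) rfl
  obtain rfl : f = 0 := (isZero_bimoduleResolution hn i hi).eq_of_src _ _
  exact ProjectiveResolution.extMk_zero _ _ _

/-- The counit of the enveloping algebra. -/
noncomputable def biCounit (n : ℕ) : Enveloping n →ₐ[ℂ] ℂ :=
  Algebra.TensorProduct.lift (counit n) ((counit n).fromOpposite fun _ _ => mul_comm _ _)
    fun _ _ => Commute.all _ _

theorem biCounit_tmul (a b : FreeOrthogonal n) :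
    biCounit n (a ⊗ₜ op b) = counit n a * counit n b := rfl

theorem biCounit_twist (a : FreeOrthogonal n) : biCounit n (twist n a) = counit n a := by
  have h : (biCounit n).comp (twist n) = counit n := algHom_ext fun i j => by
    rw [AlgHom.comp_apply, twist_u, map_sum]
    simp only [biCounit_tmul, counit_u]
    simp
  exact DFunLike.congr_fun h a

/-- The trivial bimodule. -/
noncomputable def trivialBimodule (n : ℕ) : ModuleCat.{0} (Enveloping n) :=
  (ModuleCat.restrictScalars (biCounit n).toRingHom).obj (ModuleCat.of ℂ ℂ)

variable (n) in
/-- The generator of the trivial bimodule. -/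
noncomputable def trivialBimodule.gen : trivialBimodule n := (1 : ℂ)

theorem trivialBimodule.gen_ne_zero : gen n ≠ 0 := (one_ne_zero : (1 : ℂ) ≠ 0)

theorem smul_trivialBimodule_of_biCounit_eq_zero {z : Enveloping n} (h : biCounit n z = 0)
    (x : trivialBimodule n) : z • x = 0 := by
  change biCounit n z * (show ℂ from x) = (0 : ℂ)
  rw [h, zero_mul]

/-- The cochain of degree three with values in the trivial bimodule. -/
noncomputable def bimoduleCochain (n : ℕ) :
    Induced n (PUnit.{1} → FreeOrthogonal n) →ₗ[Enveloping n] trivialBimodule n :=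
  Fintype.linearCombination (Enveloping n) (fun _ : PUnit.{1} =>
      trivialBimodule.gen n) ∘ₗ
    (freeEquivInduced n PUnit.{1}).symm.toLinearMap

theorem bimoduleCochain_single :
    bimoduleCochain n (Induced.mk (Pi.single ⟨⟩ 1) 1) =
      trivialBimodule.gen n := by
  have h : (freeEquivInduced n PUnit.{1}).symm (Induced.mk (Pi.single ⟨⟩ 1) 1) =
      Pi.single ⟨⟩ 1 := by
    rw [LinearEquiv.symm_apply_eq, freeEquivInduced_single, one_smul]
  refine (congrArg (Fintype.linearCombination (Enveloping n) (fun _ : PUnit.{1} =>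
      trivialBimodule.gen n)) h).trans ?_
  rw [Fintype.linearCombination_apply_single, one_smul]

/-- The last differential sends the generator to a combination of basis elements with coefficients
`twist (u_ij - δ_ij)`, all of which act by zero on the trivial bimodule. -/
theorem map_map_dThree_single
    (g : Induced n (Index.{0} n → FreeOrthogonal n) →ₗ[Enveloping n]
      trivialBimodule n) :
    g (Induced.map (dThree.{0} n) (Induced.mk (Pi.single ⟨⟩ 1) 1)) = 0 := by
  have h : dThree.{0} n (Pi.single ⟨⟩ 1) =
      ∑ p : Index.{0} n, (u n p.down.1 p.down.2 - if p.down.1 = p.down.2 then 1 else 0) •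
        (Pi.single p 1 : Index.{0} n → FreeOrthogonal n) := by
    ext p
    change 1 * u n p.down.1 p.down.2 - (if p.down.1 = p.down.2 then 1 else 0) = _
    simp [Finset.sum_apply, Pi.single_apply]
  rw [Induced.map_mk, h]
  have h1 : (Induced.mk (∑ p : Index.{0} n,
      (u n p.down.1 p.down.2 - if p.down.1 = p.down.2 then 1 else 0) •
        (Pi.single p 1 : Index.{0} n → FreeOrthogonal n)) 1 : Induced n _) =
      ∑ p : Index.{0} n, twist n (u n p.down.1 p.down.2 - if p.down.1 = p.down.2 then 1 else 0) •
        Induced.mk (Pi.single p 1 : Index.{0} n → FreeOrthogonal n) 1 := by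
    simp only [twist_smul_mk_one]
    exact sum_tmul _ _ _
  rw [h1, map_sum]
  refine Finset.sum_eq_zero fun p _ => ?_
  rw [map_smul]
  refine smul_trivialBimodule_of_biCounit_eq_zero ?_ _
  rw [biCounit_twist, map_sub, counit_u]
  split_ifs
  · rw [map_one, sub_self]
  · rw [map_zero, sub_self]

/-- Coboundaries vanish on the generator in degree three, whereas `bimoduleCochain` takes a nonzero
value there. -/
theorem not_subsingleton_ext_diagonal (hn : 2 ≤ n) :
    ¬ Subsingleton (Abelian.Ext (diagonalBimodule ℂ (FreeOrthogonal n))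
      (trivialBimodule n) 3) := fun _ => by
  let f : (bimoduleResolution hn).complex.X 3 ⟶ trivialBimodule n :=
    ModuleCat.homEquiv.symm (bimoduleCochain n)
  have h := Subsingleton.elim ((bimoduleResolution hn).extMk f 4 rfl
    ((isZero_bimoduleResolution hn 4 (by norm_num)).eq_of_src _ _)) 0
  rw [ProjectiveResolution.extMk_eq_zero_iff _ _ _ _ _ 2 rfl] at h
  obtain ⟨g, hg⟩ := h
  have h1 := LinearMap.congr_fun (congrArg ModuleCat.Hom.hom hg)
    (Induced.mk (Pi.single ⟨⟩ 1) 1 : Induced n (PUnit.{1} → FreeOrthogonal n))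
  have h2 : trivialBimodule.gen n = 0 :=
    bimoduleCochain_single.symm.trans (h1.symm.trans (map_map_dThree_single g.hom))
  exact trivialBimodule.gen_ne_zero h2

theorem algebraDim_eq (hn : 2 ≤ n) : algebraDim ℂ (FreeOrthogonal n) = 3 := by
  refine le_antisymm ?_ ?_
  · refine (projectiveDimension_le_iff _ 3).2 ?_
    refine (hasProjectiveDimensionLT_iff _ 4).2 fun i hi N e => ?_
    have := subsingleton_ext_diagonal hn N (i := i) hi
    exact Subsingleton.elim _ _
  · refine (projectiveDimension_ge_iff _ 3).2 fun h => not_subsingleton_ext_diagonal hn ?_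
    exact HasProjectiveDimensionLT.subsingleton _ 3 3 le_rfl _

end FreeOrthogonal

end

theorem theorem3 (n : ℕ) (hn : 2 ≤ n) :
    -- (i) `Ext^*(ℂ, A)` is the trivial right module `ℂ` in degree 3 and zero in other degrees
    ((∃ e : augCohomology (FreeOrthogonal.counit n) 3
            (ModuleCat.of (FreeOrthogonal n) (FreeOrthogonal n)) ≃ₗ[ℂ] ℂ,
        ∀ (a : FreeOrthogonal n) x,
          e (augCohomology.map (FreeOrthogonal.counit n) 3 (rightMul a) x) =
            e x * FreeOrthogonal.counit n a) ∧
      ∀ i : ℕ, i ≠ 3 → Subsingleton (augCohomology (FreeOrthogonal.counit n) i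
        (ModuleCat.of (FreeOrthogonal n) (FreeOrthogonal n)))) ∧
    -- (ii) `H_i(A, M) ≅ H^{3-i}(A, M)`, naturally in `M`; both vanish outside `0, …, 3`
    ((∀ i j : ℕ, i + j = 3 →
        ∃ e : ∀ M : ModuleCat.{v} (FreeOrthogonal n),
            (augHomology (FreeOrthogonal.counit n) i).obj M ≃ₗ[ℂ]
              augCohomology (FreeOrthogonal.counit n) j M,
          ∀ (M M' : ModuleCat.{v} (FreeOrthogonal n)) (f : M ⟶ M')
            (x : (augHomology (FreeOrthogonal.counit n) i).obj M),
            e M' ((augHomology (FreeOrthogonal.counit n) i).map f x) =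
              augCohomology.map (FreeOrthogonal.counit n) j f (e M x)) ∧
      ∀ i : ℕ, 3 < i → ∀ M : ModuleCat.{v} (FreeOrthogonal n),
        Subsingleton ((augHomology (FreeOrthogonal.counit n) i).obj M) ∧
          Subsingleton (augCohomology (FreeOrthogonal.counit n) i M)) ∧
    -- (iii) `A` is smooth of dimension 3
    (IsSmoothAlgebra ℂ (FreeOrthogonal n) ∧ algebraDim ℂ (FreeOrthogonal n) = 3) := by
  refine ⟨⟨FreeOrthogonal.exists_ext_three_equiv hn,
    fun i hi => FreeOrthogonal.subsingleton_ext_regular hn i hi⟩,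
    ⟨fun i j hij => FreeOrthogonal.exists_duality hn i j hij, fun i hi M => ⟨?_,
      FreeOrthogonal.subsingleton_ext_of_lt hn M hi⟩⟩, ?_⟩
  · obtain ⟨i, rfl⟩ := Nat.exists_eq_add_of_le' (Nat.succ_le_of_lt hi)
    exact FreeOrthogonal.subsingleton_homology_of_lt hn i M
  · exact ⟨FreeOrthogonal.isSmoothAlgebra hn, FreeOrthogonal.algebraDim_eq hn⟩
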